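/- Let $k,m\ge 1$ be integers and let $K$ be a field of characteristic $0$ (e.g. $\mathbb C$). All functions are formal power series over $K$ in the times $t=(t_1=x,t_3,t_5,\dots)$, $\partial=\partial_x$, and $n$ denotes positive odd integers. For pseudo-differential operators $P=\sum_{i\le N}a_i\partial^i$ write $P_{\ge0}=\sum_{i\ge0}a_i\partial^i$, $P_{<0}=P-P_{\ge 0}$, $P^*=\sum_i(-1)^i\partial^i a_i$, $\mathrm{Res}_\partial P=a_{-1}$, and $\mathrm{Res}_\lambda\sum_i a_i\lambda^i=a_{-1}$. Let $\xi(t,\lambda)=\sum_{n}t_n\lambda^n$ and $[\lambda^{-1}]=(\lambda^{-1},\tfrac13\lambda^{-3},\tfrac15\lambda^{-5},\dots)$. The $(k,m)$-constrained CKP hierarchy for $L=\partial+\sum_{i\ge1}u_{i+1}\partial^{-i}$ and functions $q_{a,i}$ ($a=1,2$, $1\le i\le m$) is the system $$(L^k)_{<0}=\sum_{i=1}^m\bigl(q_{1,i}\partial^{-1}q_{2,i}-(-1)^kq_{2,i}\partial^{-1}q_{1,i}\bigr),\quad L^*=-L,\quad L_{t_n}=[(L^n)_{\ge0},L],\quad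 \partial_{t_n}q_{a,i}=(L^n)_{\ge0}(q_{a,i}).$$ For $W=1+\sum_{i\ge1}w_i\partial^{-i}$ put $\psi(t,\lambda)=W(e^{\xi(t,\lambda)})=(1+\sum_{i\ge1} w_i\lambda^{-i})e^{\xi(t,\lambda)}$ and $\Omega(q,\psi)=(\partial^{-1}qW)(e^{\xi(t,\lambda)})$. Call $\psi$ a CKP wave function of $L$ if $L=W\partial W^{-1}$, $W_{t_n}=-(L^n)_{<0}W$ for all $n$, and $W^*=W^{-1}$. Consider the identities $$(1)\quad \mathrm{Res}_\lambda\,\lambda^k\psi(t,\lambda)\psi(t',-\lambda)=\sum_{i=1}^m\bigl(q_{1,i}(t)q_{2,i}(t')-(-1)^kq_{2,i}(t)q_{1,i}(t')\bigr),$$ $$(2)\quad \mathrm{Res}_\lambda\,\psi(t,\lambda)\,\Omega\bigl(q_{a,j}(t'),\psi(t',-\lambda)\bigr)=-q_{a,j}(t),\qquad a=1,2,\ 1\le j\le m.$$ **Theorem.** (i) $(L,q_{a,i})$ solves the $(k,m)$-constrained CKP hierarchy if and only if $L$ has a CKP wave function $\psi$ such that (1) and (2) hold. (ii) Let $L=W\partial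 W^{-1}$, and suppose that the $q_{a,i}$ are not all zero or that $\psi$ is a CKP wave function of $L$. Then (1) and (2) hold if and only if $\psi$ is a CKP wave function of $L$ and $(L,q_{a,i})$ solves the $(k,m)$-constrained CKP hierarchy. (iii) If $\psi$ is a CKP wave function of $L$ and $(L,q_{a,i})$ solves the $(k,m)$-constrained CKP hierarchy, then $\Omega(q_{a,j},\psi)$ is the squared eigenfunction potential: $\partial_{t_n}\Omega(q_{a,j},\psi)=\mathrm{Res}_\partial(\partial^{-1}\psi L^nq_{a,j}\partial^{-1})$ for all $n$. (iv) Let $\psi$ be a CKP wave function of $L$ with tau function $\tau$, that is, $\tau(0)\ne0$ and $$\psi(t,\lambda)=e^{\xi(t,\lambda)}\sqrt{\varphi(t,\lambda)}\,\frac{\tau(t-2[\lambda^{-1}])}{\tau(t)},\qquad \varphi(t,\lambda)=1+\lambda^{-1}\partial_x\log\frac{\tau(t-2[\lambda^{-1}])}{\tau(t)},$$ and put $\rho_{a,i}=\tau q_{a,i}$. Then (1) is equivalent to $$\mathrm{Res}_\lambda\,\lambda^k\sqrt{\varphi(t,\lambda)\varphi(t',-\lambda)}\,\tau(t-2[\lambda^{-1}])\,\tau(t'+2[\lambda^{-1}])\,e^{\xi(t-t',\lambda)}=\sum_{i=1}^m\bigl(\rho_{1,i}(t)\rho_{2,i}(t')-(-1)^k\rho_{2,i}(t)\rho_{1,i}(t')\bigr),$$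 and, for each $a$ and $j$, (2) is equivalent to $$\mathrm{Res}_\lambda\,\lambda^{-1}e^{\xi(t-t',\lambda)}\sqrt{\frac{\varphi(t,\lambda)}{\varphi(t',-\lambda)}}\,\tau(t-2[\lambda^{-1}])\Bigl(\tau(t')\rho_{a,j}(t'+2[\lambda^{-1}])+\rho_{a,j}(t')\tau(t'+2[\lambda^{-1}])\Bigr)=2\rho_{a,j}(t)\,\tau(t')^2.$$ The square roots are the formal ones, as power series in $\lambda^{-1}$ with constant term $1$. -/

import Mathlib

noncomputable section

namespace CKP

/-! ### Functions of the times -/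

/-- Functions of the times `t = (t₁, t₃, t₅, …)`: formal power series over `K`, where the variable
with index `i` is the time `t_{2i+1}`; in particular the variable with index `0` is `x = t₁`. -/
abbrev Fn (K : Type*) [Field K] := MvPowerSeries ℕ K

/-- Functions of two independent sets of times `t` (left summand) and `t'` (right summand). -/
abbrev Fn2 (K : Type*) [Field K] := MvPowerSeries (ℕ ⊕ ℕ) K

variable {K : Type*} [Field K]

/-- `∂_{t_{2i+1}}`. -/
abbrev dt (i : ℕ) : Fn K → Fn K := MvPowerSeries.pderiv K i

/-- `∂ = ∂_x = ∂_{t₁}`. -/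
abbrev dx : Fn K → Fn K := dt 0

/-- `f(t)` as a function of `(t, t')`. -/
def atT : Fn K →+* Fn2 K :=
  (MvPowerSeries.rename (R := K) (Function.Embedding.inl : ℕ ↪ ℕ ⊕ ℕ)).toRingHom

/-- `f(t')` as a function of `(t, t')`. -/
def atT' : Fn K →+* Fn2 K :=
  (MvPowerSeries.rename (R := K) (Function.Embedding.inr : ℕ ↪ ℕ ⊕ ℕ)).toRingHom

/-! ### Pseudo-differential operators -/

/-- Formal pseudo-differential operators `∑_{i ≤ N} a_i ∂^i` with coefficients in `Fn K`. Such an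
operator is stored as its symbol `∑_{i ≤ N} a_i λ^i`, a Laurent series in the variable `λ⁻¹`. The
product of operators, defined below, is not the product of symbols. -/
def PDO (K : Type*) [Field K] := LaurentSeries (Fn K)

instance : AddCommGroup (PDO K) := inferInstanceAs (AddCommGroup (LaurentSeries (Fn K)))

namespace PDO

/-- The symbol `∑ a_i λ^i` of `P = ∑ a_i ∂^i`, as a Laurent series in `λ⁻¹`. By `∂^i(e^ξ) = λ^i e^ξ`,
where `ξ(t,λ) = ∑ t_{2i+1} λ^{2i+1}`, one has `P(e^ξ) = (symbol of P) · e^ξ`. -/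
def symbol (P : PDO K) : LaurentSeries (Fn K) := P

/-- The coefficient `a_i` of `∂^i` in `∑ a_i ∂^i`. -/
def coeff (P : PDO K) (i : ℤ) : Fn K := HahnSeries.coeff P.symbol (-i)

/-- The operator `∑ a_i ∂^i`, for coefficients that vanish for all large `i`. -/
def ofCoeff (a : ℤ → Fn K) (h : ∃ N : ℤ, ∀ i, N < i → a i = 0) : PDO K :=
  HahnSeries.ofSuppBddBelow (fun j : ℤ => a (-j)) (by
    obtain ⟨N, hN⟩ := h
    refine ⟨-N, fun j hj => ?_⟩
    by_contra hlt
    exact hj (hN _ (by omega)))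

theorem exists_bound (P : PDO K) : ∃ N : ℤ, ∀ i, N < i → P.coeff i = 0 := by
  refine ⟨-HahnSeries.order P.symbol, fun i hi => ?_⟩
  exact HahnSeries.coeff_eq_zero_of_lt_order (by omega)

theorem coeff_ofCoeff (a : ℤ → Fn K) (h : ∃ N : ℤ, ∀ i, N < i → a i = 0) (i : ℤ) :
    (ofCoeff a h).coeff i = a i := by
  simp [coeff, symbol, ofCoeff]

/-- The operator `f ∂^n`. -/
def monomial (n : ℤ) (f : Fn K) : PDO K :=
  ofCoeff (fun i => if i = n then f else 0) ⟨n, fun i hi => if_neg (by omega)⟩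

/-- The operator of multiplication by `f`. -/
abbrev fn (f : Fn K) : PDO K := monomial 0 f

/-- The operator `∂^n`. -/
abbrev del (n : ℤ) : PDO K := monomial n 1

/-- The product, by the Leibniz rule
`(a ∂^i)(b ∂^j) = ∑_{l ≥ 0} (i choose l) a b^{(l)} ∂^{i+j-l}`: the coefficient of `∂^n` in `P Q` is
the sum over `p = (i, l)`, with finitely many nonzero terms. -/
instance : Mul (PDO K) where
  mul P Q := ofCoeff
    (fun n => ∑ᶠ p : ℤ × ℕ,
      (Ring.choose p.1 p.2 : ℤ) • (P.coeff p.1 * dx^[p.2] (Q.coeff (n - p.1 + p.2))))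
    (by
      obtain ⟨M, hM⟩ := P.exists_bound
      obtain ⟨N, hN⟩ := Q.exists_bound
      refine ⟨M + N, fun n hn => ?_⟩
      rw [finsum_eq_zero_of_forall_eq_zero]
      rintro ⟨i, l⟩
      by_cases hi : M < i
      · simp [hM i hi]
      · have hz : Q.coeff (n - i + l) = 0 := hN _ (by omega)
        have h0 : dx^[l] (0 : Fn K) = 0 := Function.iterate_fixed (map_zero _) l
        simp only [hz, h0, mul_zero, smul_zero])

instance : One (PDO K) := ⟨fn 1⟩

/-- The powers `P^n`. -/
def pow (P : PDO K) : ℕ → PDO K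
  | 0 => 1
  | n + 1 => pow P n * P

instance : Pow (PDO K) ℕ := ⟨pow⟩

/-- `P_{≥0}`. -/
def nonneg (P : PDO K) : PDO K :=
  ofCoeff (fun i => if 0 ≤ i then P.coeff i else 0) (by
    obtain ⟨N, hN⟩ := P.exists_bound
    exact ⟨N, fun i hi => by simp [hN i hi]⟩)

/-- `P_{<0}`. -/
def neg (P : PDO K) : PDO K :=
  ofCoeff (fun i => if i < 0 then P.coeff i else 0) ⟨0, fun i hi => if_neg (by omega)⟩

/-- The adjoint `P^* = ∑_i (-1)^i ∂^i a_i` of `P = ∑_i a_i ∂^i`, written with coefficients on the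
left: the coefficient of `∂^n` is `∑_{l ≥ 0} (-1)^{n+l} (n+l choose l) a_{n+l}^{(l)}`. -/
def adj (P : PDO K) : PDO K :=
  ofCoeff
    (fun n => ∑ᶠ l : ℕ, ((Int.negOnePow (n + l) : ℤ) * Ring.choose (n + l) l) •
      dx^[l] (P.coeff (n + l)))
    (by
      obtain ⟨N, hN⟩ := P.exists_bound
      refine ⟨N, fun n hn => finsum_eq_zero_of_forall_eq_zero fun l => ?_⟩
      have hz : P.coeff (n + l) = 0 := hN _ (by omega)
      have h0 : dx^[l] (0 : Fn K) = 0 := Function.iterate_fixed (map_zero _) l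
      simp only [hz, h0, smul_zero])

/-- `∂_{t_{2i+1}} P`, the derivative of all coefficients. -/
def flow (i : ℕ) (P : PDO K) : PDO K :=
  ofCoeff (fun n => dt i (P.coeff n)) (by
    obtain ⟨N, hN⟩ := P.exists_bound
    exact ⟨N, fun n hn => by simp [hN n hn]⟩)

/-- The action `P(f) = ∑_{i ≥ 0} a_i f^{(i)}` of a differential operator `P` on a function. It is
only used for `P = P_{≥0}`. -/
def app (P : PDO K) (f : Fn K) : Fn K := ∑ᶠ i : ℕ, P.coeff i * dx^[i] f

/-- `Res_∂ P`, the coefficient of `∂⁻¹`. -/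
def res (P : PDO K) : Fn K := P.coeff (-1)

end PDO

/-! ### The hierarchies -/

/-- `W = 1 + ∑_{i ≥ 1} w_i ∂^{-i}`. -/
def IsMonic (W : PDO K) : Prop := W.coeff 0 = 1 ∧ ∀ i, 0 < i → W.coeff i = 0

/-- `L = W ∂ W⁻¹`. -/
def IsDressing (L W : PDO K) : Prop := ∃ V : PDO K, W * V = 1 ∧ V * W = 1 ∧ L = W * PDO.del 1 * V

/-- `B_n = (L^n)_{≥0}` for `n = 2i+1`. -/
def B (L : PDO K) (i : ℕ) : PDO K := (L ^ (2 * i + 1)).nonneg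

/-- `f` is an eigenfunction of the hierarchy of `L`: `∂_{t_n} f = (L^n)_{≥0}(f)`, `n = 1, 3, 5, …` -/
def IsEigenfunction (L : PDO K) (f : Fn K) : Prop := ∀ i : ℕ, dt i f = (B L i).app f

/-- `L = ∂ + ∑_{i ≥ 1} u_{i+1} ∂^{-i}` is a Lax operator of the CKP hierarchy: `L^* = -L` and
`L_{t_n} = [(L^n)_{≥0}, L]` for `n = 1, 3, 5, …` -/
structure IsCKPLax (L : PDO K) : Prop where
  coeff_one : L.coeff 1 = 1
  coeff_zero : L.coeff 0 = 0
  coeff_of_gt : ∀ i, 1 < i → L.coeff i = 0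
  adj_eq : L.adj = -L
  lax : ∀ i : ℕ, L.flow i = B L i * L - L * B L i

/-- The `(k,m)`-constrained CKP hierarchy for `L` and `q_{a,i}`, where `q 0 i` is `q_{1,i}` and
`q 1 i` is `q_{2,i}`. -/
structure IsConstrainedCKP (k : ℕ) {m : ℕ} (L : PDO K) (q : Fin 2 → Fin m → Fn K) : Prop where
  isCKPLax : IsCKPLax L
  constraint : (L ^ k).neg = ∑ i : Fin m,
    (PDO.fn (q 0 i) * PDO.del (-1) * PDO.fn (q 1 i)
      - ((-1 : ℤ) ^ k) • (PDO.fn (q 1 i) * PDO.del (-1) * PDO.fn (q 0 i)))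
  eigen : ∀ a i, IsEigenfunction L (q a i)

/-- `W = 1 + ∑_{i ≥ 1} w_i ∂^{-i}` is a CKP dressing operator of `L`, that is, `ψ = W(e^ξ)` is a CKP
wave function of `L`: `L = W ∂ W⁻¹`, `W_{t_n} = -(L^n)_{<0} W` for `n = 1, 3, 5, …`, and
`W^* = W⁻¹`. -/
structure IsCKPWave (L W : PDO K) : Prop where
  monic : IsMonic W
  dressing : IsDressing L W
  sato : ∀ i : ℕ, W.flow i = -((L ^ (2 * i + 1)).neg * W)
  mul_adj : W * W.adj = 1
  adj_mul : W.adj * W = 1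

/-! ### Wave functions and residues in `λ` -/

section Exponential

variable {σ : Type*}

/-- `ξ(s,λ) = ∑_i s_{2i+1} λ^{2i+1}`, a power series in `λ`; here `s i` stands for `s_{2i+1}`. -/
def xi (s : ℕ → MvPowerSeries σ K) : PowerSeries (MvPowerSeries σ K) :=
  PowerSeries.mk fun n => if Odd n then s (n / 2) else 0

variable [CharZero K]

/-- `e^{ξ(s,λ)}`, a power series in `λ`. -/
def expXi (s : ℕ → MvPowerSeries σ K) : PowerSeries (MvPowerSeries σ K) :=
  (PowerSeries.exp K).subst (xi s)

/-- The coefficient of `λ^j` in `A(λ) e^{ξ(s,λ)}`, where `A` is a Laurent series in `λ⁻¹`, so that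
`A.coeff n` is the coefficient of `λ^{-n}`. For the families `s` used here (`t` and `t - t'`) every
monomial in the times occurs in finitely many of the products `A_{j-N} λ^{j-N} · (e^ξ)_N λ^N`, and
their sum is taken monomial by monomial. -/
def expCoeff (s : ℕ → MvPowerSeries σ K) (A : LaurentSeries (MvPowerSeries σ K)) (j : ℤ) :
    MvPowerSeries σ K :=
  fun d => ∑ᶠ N : ℕ, MvPowerSeries.coeff d
    (HahnSeries.coeff A ((N : ℤ) - j) * PowerSeries.coeff N (expXi s))

end Exponential

/-- The times `t`. -/
def timeT : ℕ → Fn K := fun i => MvPowerSeries.X i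

/-- The differences of times `t - t'`. -/
def timeDiff : ℕ → Fn2 K :=
  fun i => MvPowerSeries.X (Sum.inl i) - MvPowerSeries.X (Sum.inr i)

/-- `λ`, as a Laurent series in `λ⁻¹`. -/
def lam {R : Type*} [CommRing R] : LaurentSeries R := HahnSeries.single (-1) 1

/-- `A(-λ)` for a Laurent series `A(λ)` in `λ⁻¹`. -/
def negLam {R : Type*} [CommRing R] (A : LaurentSeries R) : LaurentSeries R where
  coeff n := (Int.negOnePow n : ℤ) • HahnSeries.coeff A n
  isPWO_support' := A.isPWO_support.mono fun n hn h0 => hn (by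
    simp only [h0, smul_zero])

/-- `A(t,λ)` as a Laurent series over the functions of `(t, t')`. -/
def lAtT (A : LaurentSeries (Fn K)) : LaurentSeries (Fn2 K) := HahnSeries.map A (atT (K := K))

/-- `A(t',λ)` as a Laurent series over the functions of `(t, t')`. -/
def lAtT' (A : LaurentSeries (Fn K)) : LaurentSeries (Fn2 K) := HahnSeries.map A (atT' (K := K))

/-- The family `t_{2i+1} + c λ^{-(2i+1)} / (2i+1)`, that is, `t + c[λ⁻¹]`, in the power series in the
times and the further variable `none`, which stands for `λ⁻¹`. -/
def shiftFamily (c : K) (i : ℕ) : MvPowerSeries (Option ℕ) K :=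
  MvPowerSeries.X (some i)
    + MvPowerSeries.C (c / (2 * i + 1)) * MvPowerSeries.X none ^ (2 * i + 1)

theorem hasSubst_shiftFamily (c : K) : MvPowerSeries.HasSubst (shiftFamily c) := by
  classical
  constructor
  · intro i
    simp [shiftFamily]
  · intro d
    refine ((d.support.finite_toSet.preimage (f := some)
      (Option.some_injective ℕ).injOn).union (Set.finite_Iic (d none))).subset fun i hi => ?_
    by_contra hn
    simp only [Set.mem_union, Set.mem_preimage, Finset.mem_coe, Finsupp.mem_support_iff,
      Set.mem_Iic, not_or, not_not, not_le] at hn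
    apply hi
    have h1 : d ≠ Finsupp.single (some i) 1 := by
      rintro rfl
      simp at hn
    have h2 : d ≠ Finsupp.single none (2 * i + 1) := by
      rintro rfl
      simp at hn
      omega
    rw [shiftFamily, map_add, MvPowerSeries.coeff_X, if_neg h1, MvPowerSeries.coeff_C_mul,
      MvPowerSeries.coeff_X_pow, if_neg h2, mul_zero, add_zero]

section Bilinear

variable [CharZero K]

/-- `Res_λ A(λ) e^{ξ(t - t', λ)}`. Since `ξ` is odd in `λ` and linear in `t`, this is also
`Res_λ A(λ) e^{ξ(t,λ)} e^{ξ(t',-λ)}`. -/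
def resExp (A : LaurentSeries (Fn2 K)) : Fn2 K := expCoeff timeDiff A (-1)

/-- The operator `∂⁻¹ q W`. The squared eigenfunction potential of `q` and `ψ = W(e^ξ)`, with the
integration constant fixed, is `Ω(q, ψ) = (∂⁻¹ q W)(e^ξ)`. -/
def Omega (q : Fn K) (W : PDO K) : PDO K := PDO.del (-1) * PDO.fn q * W

/-- `∂_{t_n} Ω(q,ψ) = Res_∂(∂⁻¹ ψ L^n q ∂⁻¹)` for `n = 1, 3, 5, …`, where `ψ = W(e^ξ)`. The equation
is read as an identity between the coefficients of each power `λ^j`. -/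
def IsSquaredEigenfunctionPotential (L W : PDO K) (q : Fn K) : Prop :=
  ∀ (i : ℕ) (j : ℤ), dt i (expCoeff timeT (Omega q W).symbol j) =
    (PDO.del (-1) * PDO.fn (expCoeff timeT W.symbol j) * L ^ (2 * i + 1) * PDO.fn q
      * PDO.del (-1)).res

/-- `Res_λ λ^k ψ(t,λ) ψ(t',-λ) = ∑_i (q_{1,i}(t) q_{2,i}(t') - (-1)^k q_{2,i}(t) q_{1,i}(t'))`, where
`ψ = W(e^ξ)`. -/
def Bilinear1 (k : ℕ) {m : ℕ} (W : PDO K) (q : Fin 2 → Fin m → Fn K) : Prop :=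
  resExp (lam ^ k * lAtT W.symbol * negLam (lAtT' W.symbol)) =
    ∑ i : Fin m, (atT (q 0 i) * atT' (q 1 i) - (-1) ^ k * (atT (q 1 i) * atT' (q 0 i)))

/-- `Res_λ ψ(t,λ) Ω(q(t'), ψ(t',-λ)) = -q(t)`, where `ψ = W(e^ξ)`. -/
def Bilinear2 (W : PDO K) (q : Fn K) : Prop :=
  resExp (lAtT W.symbol * negLam (lAtT' (Omega q W).symbol)) = -atT q

/-! ### Tau functions -/

/-- The formal square root with constant term `1` of a power series with constant term `1`:
its coefficients solve `r₀ = 1`, `2 r_{n+1} + ∑_{0<i<n+1} r_i r_{n+1-i} = f_{n+1}`. -/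
def sqrtCoeff {R : Type*} [CommRing R] [Algebra ℚ R] (f : PowerSeries R) : ℕ → R
  | 0 => 1
  | n + 1 => (2⁻¹ : ℚ) • (PowerSeries.coeff (n + 1) f
      - ∑ i : Fin n, sqrtCoeff f (i + 1) * sqrtCoeff f (n - i))
  decreasing_by all_goals omega

/-- The formal square root with constant term `1` of a power series with constant term `1`. -/
def sqrt {R : Type*} [CommRing R] [Algebra ℚ R] (f : PowerSeries R) : PowerSeries R :=
  PowerSeries.mk (sqrtCoeff f)

theorem constantCoeff_sqrt {R : Type*} [CommRing R] [Algebra ℚ R] (f : PowerSeries R) :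
    PowerSeries.constantCoeff (sqrt f) = 1 := by
  rw [← PowerSeries.coeff_zero_eq_constantCoeff_apply, sqrt, PowerSeries.coeff_mk, sqrtCoeff]

theorem sqrt_sq {R : Type*} [CommRing R] [Algebra ℚ R] (f : PowerSeries R)
    (hf : PowerSeries.constantCoeff f = 1) : sqrt f ^ 2 = f := by
  ext n
  rw [pow_two, PowerSeries.coeff_mul, Finset.Nat.sum_antidiagonal_eq_sum_range_succ_mk]
  cases n with
  | zero => simp [sqrt, sqrtCoeff, hf]
  | succ n =>
    rw [Finset.sum_range_succ, Finset.sum_range_succ']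
    have h : sqrtCoeff f (n + 1) = (2⁻¹ : ℚ) • (PowerSeries.coeff (n + 1) f
        - ∑ i ∈ Finset.range n, sqrtCoeff f (i + 1) * sqrtCoeff f (n - i)) := by
      rw [sqrtCoeff, Finset.sum_range]
    have h2 : 2 * sqrtCoeff f (n + 1) = PowerSeries.coeff (n + 1) f
        - ∑ i ∈ Finset.range n, sqrtCoeff f (i + 1) * sqrtCoeff f (n - i) := by
      rw [h, two_mul, ← add_smul]
      norm_num
    have h0 : sqrtCoeff f 0 = 1 := by rw [sqrtCoeff]
    simp only [sqrt, PowerSeries.coeff_mk, Nat.sub_zero, Nat.sub_self, h0, one_mul, mul_one,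
      Nat.add_sub_add_right]
    linear_combination h2

/-- `f(t + c[λ⁻¹])`, a power series in `λ⁻¹`, where `[λ⁻¹] = (λ⁻¹, λ⁻³/3, λ⁻⁵/5, …)`. -/
def shift (c : K) (f : Fn K) : PowerSeries (Fn K) :=
  MvPowerSeries.optionEquivLeft ℕ K (MvPowerSeries.subst (shiftFamily c) f)

/-- `∂_x` on power series in `λ⁻¹`. -/
def dxSeries (f : PowerSeries (Fn K)) : PowerSeries (Fn K) :=
  PowerSeries.mk fun n => dx (PowerSeries.coeff n f)

/-- `τ(t - 2[λ⁻¹]) / τ(t)`. -/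
def tauRatio (τ : Fn K) : PowerSeries (Fn K) := shift (-2) τ * PowerSeries.C τ⁻¹

/-- `φ(t,λ) = 1 + λ⁻¹ ∂_x log (τ(t - 2[λ⁻¹]) / τ(t))`, with `∂_x log g = g_x / g`. -/
def phi (τ : Fn K) : PowerSeries (Fn K) :=
  1 + PowerSeries.X * (dxSeries (tauRatio τ) * Ring.inverse (tauRatio τ))

/-- `τ` is a tau function for the wave function `ψ = W(e^ξ)`:
`ψ(t,λ) = e^{ξ(t,λ)} √φ(t,λ) τ(t - 2[λ⁻¹]) / τ(t)`, with `τ` invertible. -/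
def IsTau (W : PDO K) (τ : Fn K) : Prop :=
  MvPowerSeries.constantCoeff τ ≠ 0 ∧
    W.symbol = ((sqrt (phi τ) * tauRatio τ : PowerSeries (Fn K)) : LaurentSeries (Fn K))

/-- `F(t,λ)` as a power series in `λ⁻¹` over the functions of `(t, t')`. -/
def sAtT : PowerSeries (Fn K) →+* PowerSeries (Fn2 K) := PowerSeries.map atT

/-- `F(t',-λ)` as a power series in `λ⁻¹` over the functions of `(t, t')`. -/
def sAtT'Neg (F : PowerSeries (Fn K)) : PowerSeries (Fn2 K) :=
  PowerSeries.evalNegHom (PowerSeries.map atT' F)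

/-- `F(t',λ)` as a power series in `λ⁻¹` over the functions of `(t, t')`. -/
def sAtT' : PowerSeries (Fn K) →+* PowerSeries (Fn2 K) := PowerSeries.map atT'

/-- `Res_λ λ^k √(φ(t,λ) φ(t',-λ)) τ(t - 2[λ⁻¹]) τ(t' + 2[λ⁻¹]) e^{ξ(t-t',λ)}
= ∑_i (ρ_{1,i}(t) ρ_{2,i}(t') - (-1)^k ρ_{2,i}(t) ρ_{1,i}(t'))`. -/
def TauBilinear1 (k : ℕ) {m : ℕ} (τ : Fn K) (ρ : Fin 2 → Fin m → Fn K) : Prop :=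
  resExp (lam ^ k *
      ((sqrt (sAtT (phi τ) * sAtT'Neg (phi τ)) * sAtT (shift (-2) τ) * sAtT' (shift 2 τ) :
        PowerSeries (Fn2 K)) : LaurentSeries (Fn2 K))) =
    ∑ i : Fin m, (atT (ρ 0 i) * atT' (ρ 1 i) - (-1) ^ k * (atT (ρ 1 i) * atT' (ρ 0 i)))

/-- `Res_λ λ⁻¹ e^{ξ(t-t',λ)} √(φ(t,λ) / φ(t',-λ)) τ(t - 2[λ⁻¹])
· (τ(t') ρ(t' + 2[λ⁻¹]) + ρ(t') τ(t' + 2[λ⁻¹])) = 2 ρ(t) τ(t')²`. -/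
def TauBilinear2 (τ ρ : Fn K) : Prop :=
  resExp ((PowerSeries.X * sqrt (sAtT (phi τ) * Ring.inverse (sAtT'Neg (phi τ)))
      * sAtT (shift (-2) τ)
      * (PowerSeries.C (atT' τ) * sAtT' (shift 2 ρ) + PowerSeries.C (atT' ρ) * sAtT' (shift 2 τ)) :
        PowerSeries (Fn2 K)) : LaurentSeries (Fn2 K)) =
    2 * atT ρ * atT' τ ^ 2

end Bilinear

end CKP

end

/-!
The proof works with the ring of pseudo-differential operators, its adjoint and its flows, and with
the pairing `pair P Q = Res_λ P(e^ξ)(t,λ) Q(e^ξ)(t',-λ)`. Two facts about the pairing carry most of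
the argument:

* its restriction to the diagonal `t = t'` is `Res_∂ (P Q^*)` (`diag_pair`);
* `∂_{t_n}` acts on it by `P ↦ P_{t_n} + P ∂^n` (`dT_pair`), and for a wave function
  `W_{t_n} + W ∂^n = (L^n)_{≥0} W` (`IsCKPWave.flow_add`).

By Taylor's formula a set of functions of `(t, t')` that is stable under all `∂_{t_n}` and vanishes
on the diagonal is zero (`eq_zero_of_diag_eq_zero`). The two facts make such stable sets from the
bilinear identities, so that these identities are equivalent to identities between residues of
operators. If `ψ` is a CKP wave function, the second identity says that `q` is an eigenfunction
(`IsCKPWave.bilinear2_iff_isEigenfunction`), and for eigenfunctions the first one says that the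
constraint holds (`IsCKPWave.bilinear1_iff_constraint`). Conversely a single nonzero `q` with the
second identity already forces `ψ` to be a CKP wave function (`isCKPWave_of_bilinear2`): on the
diagonal, the identity says `W W^* q = q`, and its `t_n`-derivative says that an operator of negative
order, multiplied by `q`, is a function, hence zero. The bilinear identities therefore amount to the
constrained hierarchy as soon as a wave function exists.

It does exist (`IsCKPLax.exists_isCKPWave`). Sato's equations `W_{t_n} = -(L^n)_{<0} W` are solved
order by order: at each order the formal Poincaré lemma applies, by the zero curvature equations.
For a solution `W` the operator `W^* W` is independent of all times, and `W (W^* W)^{-1/2}` is a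
dressing operator that also satisfies `W^* = W⁻¹`.

The potential is computed directly: for an eigenfunction `q`, `∂_{t_n}` turns `∂⁻¹ q W` into
`(∂⁻¹ q L^n)_{≥0} W` (`nonneg_del_neg_one_mul_pow`), and the residue of the adjoint of
`∂⁻¹ ψ L^n q ∂⁻¹` is, up to sign, the action of `∂⁻¹ q L^n` on `ψ`.

For the tau functions, the first identity is only multiplied by `τ(t) τ(t')`. The tau form of the
second identity is `Res_λ ψ(t,λ) Y(t',λ) = q(t)` with an explicit `Y`, which makes `q` an
eigenfunction no matter what `Y` is, and so implies the second identity. For the converse,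
`t = t' + 2[μ⁻¹]` is put into the second identity. There
`e^{ξ(t-t',λ)} = 1 + 2 ∑_{N ≥ 1} (λ/μ)^N`, so that the residue is evaluated by setting `λ = μ`
(`subst_resExp`), and the result expresses `Ω(q(t'), ψ(t',-μ))` by `q` and `ψ(t' + 2[μ⁻¹], μ)`. The
latter is a quotient of tau functions because `φ(t + 2[λ⁻¹], λ) = φ(t, -λ)` (`substSeries_phi`).
-/

noncomputable section

namespace CKP

variable {K : Type*} [Field K]

/-! ### The ring of pseudo-differential operators -/

theorem dt_comm (i j : ℕ) (f : Fn K) : dt i (dt j f) = dt j (dt i f) := by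
  classical
  ext n
  simp only [MvPowerSeries.coeff_pderiv, Finsupp.add_apply]
  rw [add_right_comm]
  rcases eq_or_ne i j with rfl | h
  · rfl
  · simp only [Finsupp.single_apply, h, h.symm, if_false, add_zero]
    ring

theorem dt_mul (i : ℕ) (f g : Fn K) : dt i (f * g) = dt i f * g + f * dt i g := by
  have := (MvPowerSeries.pderiv K i).leibniz f g
  rw [smul_eq_mul, smul_eq_mul] at this
  refine this.trans ?_
  ring

theorem dt_zero (i : ℕ) : dt i (0 : Fn K) = 0 := map_zero (MvPowerSeries.pderiv K i)

theorem dt_one (i : ℕ) : dt i (1 : Fn K) = 0 := (MvPowerSeries.pderiv K i).map_one_eq_zero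

theorem dt_neg (i : ℕ) (f : Fn K) : dt i (-f) = -dt i f := map_neg (MvPowerSeries.pderiv K i) f

theorem dt_sum {ι : Type*} (i : ℕ) (s : Finset ι) (f : ι → Fn K) :
    dt i (∑ j ∈ s, f j) = ∑ j ∈ s, dt i (f j) := map_sum (MvPowerSeries.pderiv K i) f s

theorem dt_zsmul (i : ℕ) (c : ℤ) (f : Fn K) : dt i (c • f) = c • dt i f :=
  map_zsmul (MvPowerSeries.pderiv K i) c f

theorem iterate_dx_zero (l : ℕ) : dx^[l] (0 : Fn K) = 0 := iterate_map_zero _ l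

theorem iterate_dx_add (l : ℕ) (f g : Fn K) : dx^[l] (f + g) = dx^[l] f + dx^[l] g :=
  iterate_map_add _ l f g

theorem iterate_dx_one {l : ℕ} (hl : l ≠ 0) : dx^[l] (1 : Fn K) = 0 := by
  obtain ⟨l, rfl⟩ := Nat.exists_eq_succ_of_ne_zero hl
  rw [Function.iterate_succ_apply]
  simp

/-- `∂^l` as an additive map on functions. -/
def dxHom (l : ℕ) : Fn K →+ Fn K where
  toFun := dx^[l]
  map_zero' := iterate_dx_zero l
  map_add' := iterate_dx_add l

theorem iterate_dx_sum {ι : Type*} (l : ℕ) (s : Finset ι) (f : ι → Fn K) :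
    dx^[l] (∑ j ∈ s, f j) = ∑ j ∈ s, dx^[l] (f j) := map_sum (dxHom l) f s

theorem iterate_dx_zsmul (l : ℕ) (c : ℤ) (f : Fn K) : dx^[l] (c • f) = c • dx^[l] f :=
  map_zsmul (dxHom l) c f

theorem dx_iterate_dx (l : ℕ) (f : Fn K) : dx (dx^[l] f) = dx^[l + 1] f :=
  (Function.iterate_succ_apply' _ l f).symm

theorem dt_iterate_dx (i l : ℕ) (f : Fn K) : dt i (dx^[l] f) = dx^[l] (dt i f) := by
  induction l generalizing f with
  | zero => rfl
  | succ l ih => rw [Function.iterate_succ_apply, Function.iterate_succ_apply, ih, dt_comm]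

namespace PDO

@[ext] theorem ext {P Q : PDO K} (h : ∀ i, P.coeff i = Q.coeff i) : P = Q := by
  refine HahnSeries.ext (funext fun i => ?_)
  have := h (-i)
  rwa [coeff, coeff, neg_neg] at this

@[simp] theorem coeff_zero' (i : ℤ) : (0 : PDO K).coeff i = 0 := rfl

@[simp] theorem coeff_add (P Q : PDO K) (i : ℤ) : (P + Q).coeff i = P.coeff i + Q.coeff i := rfl

@[simp] theorem coeff_neg (P : PDO K) (i : ℤ) : (-P).coeff i = -P.coeff i := rfl

@[simp] theorem coeff_sub (P Q : PDO K) (i : ℤ) : (P - Q).coeff i = P.coeff i - Q.coeff i := by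
  rw [sub_eq_add_neg, coeff_add, coeff_neg, sub_eq_add_neg]

/-- The coefficient of `∂^i` as an additive map. -/
def coeffHom (i : ℤ) : PDO K →+ Fn K where
  toFun P := P.coeff i
  map_zero' := rfl
  map_add' _ _ := rfl

theorem coeff_sum {ι : Type*} (s : Finset ι) (P : ι → PDO K) (i : ℤ) :
    (∑ j ∈ s, P j).coeff i = ∑ j ∈ s, (P j).coeff i :=
  map_sum (coeffHom i) P s

@[simp] theorem coeff_zsmul (c : ℤ) (P : PDO K) (i : ℤ) : (c • P).coeff i = c • P.coeff i :=
  map_zsmul (coeffHom i) c P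

theorem coeff_monomial (n : ℤ) (f : Fn K) (i : ℤ) :
    (monomial n f).coeff i = if i = n then f else 0 := coeff_ofCoeff _ _ _

theorem monomial_add (n : ℤ) (f g : Fn K) : monomial n (f + g) = monomial n f + monomial n g := by
  ext1 i
  simp only [coeff_monomial, coeff_add]
  split_ifs <;> simp

theorem monomial_zero (n : ℤ) : monomial n (0 : Fn K) = 0 := by
  ext1 i
  simp [coeff_monomial]

theorem monomial_neg (n : ℤ) (f : Fn K) : monomial n (-f) = -monomial n f := by
  ext1 i
  simp only [coeff_monomial, coeff_neg]
  split_ifs <;> simp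

/-- `P` has order at most `N`. -/
def OrdLE (P : PDO K) (N : ℤ) : Prop := ∀ i, N < i → P.coeff i = 0

theorem OrdLE.mono {P : PDO K} {M N : ℤ} (h : P.OrdLE M) (hMN : M ≤ N) : P.OrdLE N :=
  fun i hi => h i (by omega)

theorem OrdLE.add {P Q : PDO K} {N : ℤ} (hP : P.OrdLE N) (hQ : Q.OrdLE N) : (P + Q).OrdLE N :=
  fun i hi => by rw [coeff_add, hP i hi, hQ i hi, add_zero]

theorem OrdLE.neg {P : PDO K} {N : ℤ} (hP : P.OrdLE N) : (-P).OrdLE N :=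
  fun i hi => by rw [coeff_neg, hP i hi, neg_zero]

theorem OrdLE.sub {P Q : PDO K} {N : ℤ} (hP : P.OrdLE N) (hQ : Q.OrdLE N) : (P - Q).OrdLE N := by
  rw [sub_eq_add_neg]
  exact hP.add hQ.neg

theorem ordLE_monomial (n : ℤ) (f : Fn K) : (monomial n f).OrdLE n := fun i hi => by
  rw [coeff_monomial, if_neg (by omega)]

theorem coeff_mul (P Q : PDO K) (n : ℤ) : (P * Q).coeff n = ∑ᶠ p : ℤ × ℕ,
      (Ring.choose p.1 p.2 : ℤ) • (P.coeff p.1 * dx^[p.2] (Q.coeff (n - p.1 + p.2))) :=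
  coeff_ofCoeff _ _ _

theorem coeff_mul_eq_sum {P Q : PDO K} {M N : ℤ} (hP : P.OrdLE M) (hQ : Q.OrdLE N) (n : ℤ) :
    (P * Q).coeff n = ∑ p ∈ Finset.Icc (n - N) M ×ˢ Finset.range (M + N - n + 1).toNat,
      (Ring.choose p.1 p.2 : ℤ) • (P.coeff p.1 * dx^[p.2] (Q.coeff (n - p.1 + p.2))) := by
  rw [coeff_mul]
  refine finsum_eq_sum_of_support_subset _ fun p hp => ?_
  rw [Function.mem_support] at hp
  by_contra hn
  apply hp
  simp only [Finset.coe_product, Set.mem_prod, Finset.mem_coe, Finset.mem_Icc, Finset.mem_range,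
    not_and_or, not_le] at hn
  by_cases h : M < p.1
  · rw [hP _ h, zero_mul, smul_zero]
  · rw [hQ _ (by omega), iterate_dx_zero, mul_zero, smul_zero]

theorem OrdLE.mul {P Q : PDO K} {M N : ℤ} (hP : P.OrdLE M) (hQ : Q.OrdLE N) :
    (P * Q).OrdLE (M + N) := fun n hn => by
  rw [coeff_mul_eq_sum hP hQ, Finset.Icc_eq_empty (by omega), Finset.empty_product,
    Finset.sum_empty]

theorem exists_ordLE (P : PDO K) : ∃ N : ℤ, P.OrdLE N := P.exists_bound

theorem exists_ordLE₂ (P Q : PDO K) : ∃ N : ℤ, P.OrdLE N ∧ Q.OrdLE N := by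
  obtain ⟨M, hM⟩ := P.exists_ordLE
  obtain ⟨N, hN⟩ := Q.exists_ordLE
  exact ⟨max M N, hM.mono (le_max_left _ _), hN.mono (le_max_right _ _)⟩

protected theorem mul_add' (P Q R : PDO K) : P * (Q + R) = P * Q + P * R := by
  obtain ⟨M, hP⟩ := P.exists_ordLE
  obtain ⟨N, hQ, hR⟩ := exists_ordLE₂ Q R
  ext1 n
  rw [coeff_add, coeff_mul_eq_sum hP hQ, coeff_mul_eq_sum hP hR, coeff_mul_eq_sum hP (hQ.add hR),
    ← Finset.sum_add_distrib]
  refine Finset.sum_congr rfl fun p _ => ?_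
  rw [coeff_add, iterate_dx_add, mul_add, smul_add]

protected theorem add_mul' (P Q R : PDO K) : (P + Q) * R = P * R + Q * R := by
  obtain ⟨M, hR⟩ := R.exists_ordLE
  obtain ⟨N, hP, hQ⟩ := exists_ordLE₂ P Q
  ext1 n
  rw [coeff_add, coeff_mul_eq_sum hP hR, coeff_mul_eq_sum hQ hR, coeff_mul_eq_sum (hP.add hQ) hR,
    ← Finset.sum_add_distrib]
  refine Finset.sum_congr rfl fun p _ => ?_
  rw [coeff_add, add_mul, smul_add]

/-- The product as a biadditive map. -/
def mulHom : PDO K →+ PDO K →+ PDO K :=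
  AddMonoidHom.mk' (fun P => AddMonoidHom.mk' (fun Q => P * Q) (PDO.mul_add' P))
    fun P Q => by
      ext1 R
      exact PDO.add_mul' P Q R

/-- Every operator is a finite sum of monomials `f ∂^n` up to an operator of arbitrarily negative
order. -/
theorem exists_eq_sum_monomial_add (P : PDO K) (N : ℤ) :
    ∃ (s : Finset ℤ) (R : PDO K), R.OrdLE N ∧ P = ∑ n ∈ s, monomial n (P.coeff n) + R := by
  obtain ⟨M, hM⟩ := P.exists_ordLE
  refine ⟨Finset.Ioc N M, P - ∑ n ∈ Finset.Ioc N M, monomial n (P.coeff n), fun i hi => ?_,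
    (add_sub_cancel _ _).symm⟩
  rw [coeff_sub, coeff_sum]
  simp only [coeff_monomial, Finset.sum_ite_eq, Finset.mem_Ioc]
  split_ifs with h
  · rw [sub_self]
  · rw [hM i (by omega), sub_zero]

/-- An additive map that shifts orders by a bounded amount is determined by its values on the
monomials `f ∂^n`. This is how all identities between operators are reduced to monomials. -/
theorem hom_eq_of_monomial {F G : PDO K →+ PDO K} {c : ℤ}
    (hF : ∀ P N, OrdLE P N → (F P).OrdLE (N + c)) (hG : ∀ P N, OrdLE P N → (G P).OrdLE (N + c))
    (h : ∀ n f, F (monomial n f) = G (monomial n f)) (P : PDO K) : F P = G P := by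
  ext1 i
  obtain ⟨s, R, hR, hP⟩ := P.exists_eq_sum_monomial_add (i - c - 1)
  rw [hP, map_add, map_add, map_sum, map_sum, Finset.sum_congr rfl fun n _ => h n _, coeff_add,
    coeff_add, hF R _ hR i (by omega), hG R _ hR i (by omega)]

theorem coeff_monomial_mul_eq_sum (i : ℤ) (a : Fn K) {Q : PDO K} {N : ℤ} (hQ : Q.OrdLE N) (n : ℤ)
    {M : ℕ} (hM : N - n + i < M) : (monomial i a * Q).coeff n =
      ∑ l ∈ Finset.range M, (Ring.choose i l : ℤ) • (a * dx^[l] (Q.coeff (n - i + l))) := by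
  rw [coeff_mul, finsum_eq_sum_of_support_subset (s := {i} ×ˢ Finset.range M)]
  · rw [Finset.sum_product, Finset.sum_singleton]
    refine Finset.sum_congr rfl fun l _ => ?_
    rw [coeff_monomial, if_pos rfl]
  · intro p hp
    rw [Function.mem_support] at hp
    by_contra hn
    apply hp
    simp only [Finset.coe_product, Set.mem_prod, Finset.coe_singleton, Set.mem_singleton_iff,
      Finset.mem_coe, Finset.mem_range, not_and_or, not_lt] at hn
    rw [coeff_monomial]
    split_ifs with h
    · rw [hQ _ (by omega), iterate_dx_zero, mul_zero, smul_zero]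
    · rw [zero_mul, smul_zero]

theorem coeff_fn_mul (f : Fn K) (Q : PDO K) (n : ℤ) : (fn f * Q).coeff n = f * Q.coeff n := by
  obtain ⟨N, hQ⟩ := Q.exists_ordLE
  have hM : N - n + 0 < ((N - n).toNat + 1 : ℕ) := by omega
  rw [coeff_monomial_mul_eq_sum 0 f hQ n hM, Finset.sum_eq_single 0]
  · simp
  · intro l _ hl
    rw [Ring.choose_zero_pos ℤ (Nat.pos_of_ne_zero hl), zero_smul]
  · simp

theorem coeff_del_one_mul (Q : PDO K) (n : ℤ) :
    (del 1 * Q).coeff n = Q.coeff (n - 1) + dx (Q.coeff n) := by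
  obtain ⟨N, hQ⟩ := Q.exists_ordLE
  have hM : N - n + 1 < ((N - n).toNat + 2 : ℕ) := by omega
  rw [coeff_monomial_mul_eq_sum 1 1 hQ n hM, Finset.sum_range_succ', Finset.sum_range_succ',
    Finset.sum_eq_zero]
  · simp [add_comm]
  · intro l _
    have : Ring.choose (1 : ℤ) (l + 1 + 1) = 0 := by
      have := Ring.choose_natCast (R := ℤ) 1 (l + 2)
      rwa [Nat.choose_eq_zero_of_lt (by omega)] at this
    rw [this, zero_smul]

theorem monomial_mul_monomial_coeff (i j : ℤ) (a b : Fn K) (n : ℕ) :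
    (monomial i a * monomial j b).coeff (i + j - n) =
      (Ring.choose i n : ℤ) • (a * dx^[n] b) := by
  rw [coeff_monomial_mul_eq_sum i a (ordLE_monomial j b) (i + j - n) (M := n + 1) (by push_cast; omega),
    Finset.sum_eq_single n]
  · rw [coeff_monomial, if_pos (by omega)]
  · intro l _ hl
    rw [coeff_monomial, if_neg (by omega), iterate_dx_zero, mul_zero, smul_zero]
  · simp

theorem coeff_mul_del (P : PDO K) (j n : ℤ) : (P * del j).coeff n = P.coeff (n - j) := by
  rw [coeff_mul, finsum_eq_single _ (n - j, 0)]
  · simp [coeff_monomial]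
  · rintro ⟨i, l⟩ h
    rw [coeff_monomial]
    split_ifs with h'
    · have hl : l ≠ 0 := by
        rintro rfl
        exact h (by ext <;> simp at *; omega)
      rw [iterate_dx_one hl, mul_zero, smul_zero]
    · rw [iterate_dx_zero, mul_zero, smul_zero]

theorem monomial_mul_del (i j : ℤ) (a : Fn K) : monomial i a * del j = monomial (i + j) a := by
  ext1 n
  rw [coeff_mul_del, coeff_monomial, coeff_monomial]
  exact if_congr (by omega) rfl rfl

theorem fn_mul_monomial (f : Fn K) (j : ℤ) (b : Fn K) :
    fn f * monomial j b = monomial j (f * b) := by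
  ext1 n
  rw [coeff_fn_mul, coeff_monomial, coeff_monomial]
  split_ifs <;> simp

theorem fn_mul_del (f : Fn K) (j : ℤ) : fn f * del j = monomial j f := by
  rw [fn_mul_monomial, mul_one]

theorem del_one_mul_monomial (j : ℤ) (b : Fn K) :
    del 1 * monomial j b = monomial (j + 1) b + monomial j (dx b) := by
  ext1 n
  rw [coeff_del_one_mul, coeff_add, coeff_monomial, coeff_monomial, coeff_monomial, coeff_monomial]
  congr 1
  · exact if_congr (by omega) rfl rfl
  · split_ifs <;> simp

/-- The factor `a` of `a ∂^i` can be split off before associativity is known. -/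
theorem monomial_mul_eq (i : ℤ) (a : Fn K) (Q : PDO K) : monomial i a * Q = fn a * (del i * Q) := by
  obtain ⟨N, hQ⟩ := Q.exists_ordLE
  ext1 n
  have hM : N - n + i < ((N - n + i).toNat + 1 : ℕ) := by omega
  rw [coeff_fn_mul, coeff_monomial_mul_eq_sum i a hQ n hM, coeff_monomial_mul_eq_sum i 1 hQ n hM,
    Finset.mul_sum]
  refine Finset.sum_congr rfl fun l _ => ?_
  rw [one_mul, mul_smul_comm]

theorem fn_mul_fn_mul (f g : Fn K) (Q : PDO K) : fn f * (fn g * Q) = fn (f * g) * Q := by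
  ext1 n
  rw [coeff_fn_mul, coeff_fn_mul, coeff_fn_mul, mul_assoc]

theorem fn_mul_assoc (f : Fn K) (Q R : PDO K) : fn f * Q * R = fn f * (Q * R) := by
  obtain ⟨N, hR⟩ := R.exists_ordLE
  refine hom_eq_of_monomial (c := N)
    (F := (mulHom.flip R).comp (mulHom (fn f))) (G := (mulHom (fn f)).comp (mulHom.flip R))
    (fun P M hP => ?_) (fun P M hP => ?_) (fun n g => ?_) Q
  · have := ((ordLE_monomial 0 f).mul hP).mul hR
    rwa [zero_add] at this
  · have := (ordLE_monomial 0 f).mul (hP.mul hR)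
    rwa [zero_add] at this
  · change fn f * monomial n g * R = fn f * (monomial n g * R)
    rw [fn_mul_monomial, monomial_mul_eq n (f * g), monomial_mul_eq n g, fn_mul_fn_mul]

/-- On a monomial `Q` this is Pascal's rule for the binomial coefficients. -/
theorem del_one_mul_assoc (Q R : PDO K) : del 1 * Q * R = del 1 * (Q * R) := by
  obtain ⟨N, hR⟩ := R.exists_ordLE
  refine hom_eq_of_monomial (c := N + 1)
    (F := (mulHom.flip R).comp (mulHom (del 1))) (G := (mulHom (del 1)).comp (mulHom.flip R))
    (fun P M hP => ?_) (fun P M hP => ?_) (fun j b => ?_) Q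
  · exact (((ordLE_monomial 1 1).mul hP).mul hR).mono (by omega)
  · exact ((ordLE_monomial 1 1).mul (hP.mul hR)).mono (by omega)
  · change del 1 * monomial j b * R = del 1 * (monomial j b * R)
    ext1 n
    obtain ⟨M, hM⟩ : ∃ M : ℕ, N - n + j + 1 < M := ⟨(N - n + j + 1).toNat + 1, by omega⟩
    rw [del_one_mul_monomial, PDO.add_mul', coeff_add, coeff_del_one_mul,
      coeff_monomial_mul_eq_sum (j + 1) b hR n (M := M + 1) (by push_cast; omega),
      coeff_monomial_mul_eq_sum j (dx b) hR n (M := M) (by omega),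
      coeff_monomial_mul_eq_sum j b hR n (M := M) (by omega),
      coeff_monomial_mul_eq_sum j b hR (n - 1) (M := M + 1) (by push_cast; omega),
      Finset.sum_range_succ', Finset.sum_range_succ']
    simp only [Ring.choose_succ_succ, add_smul, Finset.sum_add_distrib, map_sum, map_zsmul, dt_mul,
      smul_add, dx_iterate_dx, Ring.choose_zero_right]
    have e' : ∀ l : ℕ, n - 1 - j + ((l + 1 : ℕ) : ℤ) = n - j + l := fun l => by push_cast; ring
    have e'' : n - (j + 1) = n - 1 - j := by ring
    simp only [e', e'']
    abel

/-- This is Vandermonde's identity for the binomial coefficients. -/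
theorem del_mul_del_mul (m n : ℤ) (Y : PDO K) : del m * (del n * Y) = del (m + n) * Y := by
  obtain ⟨N, hY⟩ := Y.exists_ordLE
  ext1 k
  obtain ⟨M, hM⟩ : ∃ M : ℕ, N - k + m + n < M := ⟨(N - k + m + n).toNat + 1, by omega⟩
  rw [coeff_monomial_mul_eq_sum m 1 ((ordLE_monomial n 1).mul hY) k (M := M) (by omega),
    coeff_monomial_mul_eq_sum (m + n) 1 hY k (M := M) (by omega)]
  have h : ∀ l ∈ Finset.range M,
      (Ring.choose m l : ℤ) • (1 * dx^[l] ((del n * Y).coeff (k - m + l)))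
        = ∑ s ∈ Finset.range (M - l), (Ring.choose m l * Ring.choose n s : ℤ) •
          dx^[l + s] (Y.coeff (k - (m + n) + (l + s : ℕ))) := by
    intro l hl
    rw [Finset.mem_range] at hl
    rw [coeff_monomial_mul_eq_sum n 1 hY (k - m + l) (M := M - l) (by omega), one_mul,
      iterate_dx_sum, Finset.smul_sum]
    refine Finset.sum_congr rfl fun s _ => ?_
    rw [iterate_dx_zsmul, smul_smul, one_mul, Function.iterate_add_apply]
    have e : k - m + l - n + s = k - (m + n) + ((l + s : ℕ) : ℤ) := by push_cast; ring
    rw [e]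
  rw [Finset.sum_congr rfl h, ← Finset.sum_range_diag_flip M fun l s =>
    (Ring.choose m l * Ring.choose n s : ℤ) • dx^[l + s] (Y.coeff (k - (m + n) + (l + s : ℕ)))]
  refine Finset.sum_congr rfl fun l _ => ?_
  rw [Ring.add_choose_eq l (Commute.all m n), Finset.Nat.sum_antidiagonal_eq_sum_range_succ_mk,
    Finset.sum_smul, one_mul]
  refine Finset.sum_congr rfl fun s hs => ?_
  rw [Nat.add_sub_cancel' (Nat.lt_succ_iff.mp (Finset.mem_range.mp hs))]

theorem del_zero_mul (Y : PDO K) : del 0 * Y = Y := by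
  ext1 n
  rw [coeff_fn_mul, one_mul]

/-- The case `n = 1` is Pascal's rule, and the powers of `∂` generate the others. -/
theorem del_mul_assoc (n : ℤ) (Q R : PDO K) : del n * Q * R = del n * (Q * R) := by
  induction n using Int.induction_on generalizing Q with
  | zero => rw [del_zero_mul, del_zero_mul]
  | succ i ih =>
    rw [← del_mul_del_mul, ih, del_one_mul_assoc, del_mul_del_mul]
  | pred i ih =>
    have h : del (-(i : ℤ) - 1) * (del 1 * (del (-1) * Q)) = del (-(i : ℤ) - 1) * Q := by
      rw [del_mul_del_mul 1, add_neg_cancel, del_zero_mul]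
    rw [← h, del_mul_del_mul, sub_add_cancel, ih, ← del_zero_mul (Q * R), ← add_neg_cancel 1,
      ← del_mul_del_mul 1, del_mul_del_mul (-(i : ℤ) - 1), sub_add_cancel]
    congr 1
    rw [← del_zero_mul (del (-1) * Q * R), ← neg_add_cancel 1, ← del_mul_del_mul (-1),
      ← del_one_mul_assoc, del_mul_del_mul 1 (-1), add_neg_cancel, del_zero_mul]

protected theorem mul_assoc' (P Q R : PDO K) : P * Q * R = P * (Q * R) := by
  obtain ⟨M, hQ⟩ := Q.exists_ordLE
  obtain ⟨N, hR⟩ := R.exists_ordLE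
  refine hom_eq_of_monomial (c := M + N)
    (F := (mulHom.flip R).comp (mulHom.flip Q)) (G := mulHom.flip (Q * R))
    (fun P L hP => ?_) (fun P L hP => ?_) (fun j b => ?_) P
  · exact ((hP.mul hQ).mul hR).mono (by omega)
  · exact hP.mul (hQ.mul hR)
  · change monomial j b * Q * R = monomial j b * (Q * R)
    rw [monomial_mul_eq, fn_mul_assoc, del_mul_assoc, ← monomial_mul_eq]

instance : Ring (PDO K) where
  __ := (inferInstance : AddCommGroup (PDO K))
  mul := (· * ·)
  one := 1
  left_distrib := PDO.mul_add'
  right_distrib := PDO.add_mul'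
  zero_mul P := map_zero ((mulHom (K := K)).flip P)
  mul_zero P := map_zero (mulHom P)
  mul_assoc := PDO.mul_assoc'
  one_mul := del_zero_mul
  mul_one P := by
    ext1 n
    exact (coeff_mul_del P 0 n).trans (by rw [sub_zero])
  npow n P := P ^ n
  npow_zero _ := rfl
  npow_succ _ _ := rfl

theorem one_def : (1 : PDO K) = monomial 0 1 := rfl

theorem del_mul_del (m n : ℤ) : (del m * del n : PDO K) = del (m + n) := monomial_mul_del m n 1

theorem fn_mul_fn (f g : Fn K) : fn f * fn g = fn (f * g) := fn_mul_monomial f 0 g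

/-! ### Adjoints, residues, differential parts and flows -/

theorem coeff_adj_eq_sum {P : PDO K} {N : ℤ} (hP : P.OrdLE N) (n : ℤ) {M : ℕ} (hM : N - n < M) :
    P.adj.coeff n = ∑ l ∈ Finset.range M,
      ((Int.negOnePow (n + l) : ℤ) * Ring.choose (n + l) l) • dx^[l] (P.coeff (n + l)) := by
  rw [adj, coeff_ofCoeff]
  refine finsum_eq_sum_of_support_subset _ fun l hl => ?_
  rw [Function.mem_support] at hl
  by_contra hn
  apply hl
  rw [Finset.mem_coe, Finset.mem_range] at hn
  rw [hP _ (by omega), iterate_dx_zero, smul_zero]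

theorem OrdLE.adj {P : PDO K} {N : ℤ} (hP : P.OrdLE N) : P.adj.OrdLE N := fun n hn => by
  rw [coeff_adj_eq_sum hP n (M := 0) (by push_cast; omega), Finset.sum_range_zero]

theorem adj_add (P Q : PDO K) : (P + Q).adj = P.adj + Q.adj := by
  obtain ⟨N, hP, hQ⟩ := exists_ordLE₂ P Q
  ext1 n
  have hM : N - n < ((N - n).toNat + 1 : ℕ) := by omega
  rw [coeff_add, coeff_adj_eq_sum hP n hM, coeff_adj_eq_sum hQ n hM,
    coeff_adj_eq_sum (hP.add hQ) n hM, ← Finset.sum_add_distrib]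
  refine Finset.sum_congr rfl fun l _ => ?_
  rw [coeff_add, iterate_dx_add, smul_add]

/-- The adjoint as an additive map. -/
def adjHom : PDO K →+ PDO K := AddMonoidHom.mk' adj adj_add

theorem adj_neg (P : PDO K) : (-P).adj = -P.adj := map_neg adjHom P

theorem adj_sub (P Q : PDO K) : (P - Q).adj = P.adj - Q.adj := map_sub adjHom P Q

theorem adj_zsmul (c : ℤ) (P : PDO K) : (c • P).adj = c • P.adj := map_zsmul adjHom c P

theorem del_mul_fn_coeff (i : ℤ) (a : Fn K) (n : ℤ) {l : ℕ} (h : n + l = i) :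
    (del i * fn a).coeff n = (Ring.choose i l : ℤ) • dx^[l] a := by
  have := monomial_mul_monomial_coeff i 0 1 a l
  rwa [one_mul, show i + 0 - (l : ℤ) = n by omega] at this

theorem adj_monomial (i : ℤ) (a : Fn K) :
    (monomial i a).adj = (Int.negOnePow i : ℤ) • (del i * fn a) := by
  ext1 n
  rw [coeff_zsmul]
  rcases lt_or_ge i n with h | h
  · rw [(ordLE_monomial i a).adj n h,
      ((ordLE_monomial i 1).mul (ordLE_monomial 0 a)) n (by omega), smul_zero]
  · obtain ⟨l, hl⟩ := Int.eq_ofNat_of_zero_le (sub_nonneg.mpr h)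
    rw [coeff_adj_eq_sum (ordLE_monomial i a) n (M := l + 1) (by push_cast; omega),
      del_mul_fn_coeff i a n (l := l) (by omega), smul_smul,
      Finset.sum_eq_single l]
    · rw [coeff_monomial, if_pos (by omega), show n + (l : ℤ) = i by omega]
    · intro s _ hs
      rw [coeff_monomial, if_neg (by omega), iterate_dx_zero, smul_zero]
    · simp

theorem adj_fn (f : Fn K) : (fn f).adj = fn f := by
  rw [adj_monomial, Int.negOnePow_zero, Units.val_one, one_smul, fn_mul_fn, one_mul]

theorem del_zero : (del 0 : PDO K) = 1 := rfl

theorem fn_one : (fn 1 : PDO K) = 1 := rfl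

theorem adj_del (n : ℤ) : (del n : PDO K).adj = (Int.negOnePow n : ℤ) • del n := by
  rw [adj_monomial, fn_one, mul_one]

theorem adj_mul_del (P : PDO K) (j : ℤ) :
    (P * del j).adj = (Int.negOnePow j : ℤ) • (del j * P.adj) := by
  refine hom_eq_of_monomial (c := j) (F := adjHom.comp (mulHom.flip (del j)))
    (G := (Int.negOnePow j : ℤ) • (mulHom (del j)).comp adjHom) (fun P N hP => ?_)
    (fun P N hP i hi => ?_) (fun i a => ?_) P
  · exact (hP.mul (ordLE_monomial j 1)).adj
  · change ((Int.negOnePow j : ℤ) • (del j * P.adj)).coeff i = 0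
    rw [coeff_zsmul, (ordLE_monomial j 1).mul hP.adj i (by omega), smul_zero]
  · change (monomial i a * del j).adj = (Int.negOnePow j : ℤ) • (del j * (monomial i a).adj)
    rw [monomial_mul_del, adj_monomial, adj_monomial, mul_smul_comm, smul_smul, ← mul_assoc,
      del_mul_del, add_comm i j, Int.negOnePow_add, Units.val_mul]

theorem adj_fn_mul (f : Fn K) (P : PDO K) : (fn f * P).adj = P.adj * fn f := by
  refine hom_eq_of_monomial (c := 0) (F := adjHom.comp (mulHom (fn f)))
    (G := (mulHom.flip (fn f)).comp adjHom) (fun P N hP => ?_)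
    (fun P N hP => ?_) (fun i a => ?_) P
  · exact ((ordLE_monomial 0 f).mul hP).adj.mono (by omega)
  · exact hP.adj.mul (ordLE_monomial 0 f)
  · change (fn f * monomial i a).adj = (monomial i a).adj * fn f
    rw [fn_mul_monomial, adj_monomial, adj_monomial, smul_mul_assoc, mul_assoc, fn_mul_fn,
      mul_comm f a]

theorem del_one_mul_fn (b : Fn K) : del 1 * fn b = fn b * del 1 + fn (dx b) := by
  rw [del_one_mul_monomial, fn_mul_del, zero_add]

theorem eq_zero_of_ordLE {P : PDO K} {c : ℤ} (h : ∀ n : ℕ, P.OrdLE (c - n)) : P = 0 := by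
  ext1 i
  exact h ((c - i).toNat + 1) i (by push_cast; omega)

theorem eq_del_neg_one_mul {P Q : PDO K} (h : del 1 * P = Q) : P = del (-1) * Q := by
  rw [← h, ← mul_assoc, del_mul_del, neg_add_cancel, del_zero, one_mul]

/-- The difference `G i b` of the two sides satisfies `∂ G i b = G i b' - G (i+1) b`, so that it
vanishes with `G (i+1)`, for `∂⁻¹` lowers the order and can be split off arbitrarily often. -/
theorem adj_del_mul_fn (i : ℤ) (b : Fn K) :
    (del i * fn b).adj = (Int.negOnePow i : ℤ) • (fn b * del i) := by
  let G : ℤ → Fn K → PDO K := fun i b =>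
    (del i * fn b).adj - (Int.negOnePow i : ℤ) • (fn b * del i)
  suffices h : ∀ b, G i b = 0 from sub_eq_zero.mp (h b)
  have hstep : ∀ i b, G (i + 1) b = G i (dx b) - del 1 * G i b := by
    intro i b
    have e : del (i + 1) * fn b = del i * fn b * del 1 + del i * fn (dx b) := by
      rw [← del_mul_del, mul_assoc, del_one_mul_fn, mul_add, mul_assoc]
    have e2 : del 1 * (fn b * del i) = fn b * del (i + 1) + fn (dx b) * del i := by
      rw [← mul_assoc, del_one_mul_fn, add_mul, mul_assoc, del_mul_del, add_comm 1 i]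
    simp only [G]
    rw [e, adj_add, adj_mul_del, mul_sub, mul_smul_comm, e2, Int.negOnePow_succ,
      Int.negOnePow_one]
    simp only [Units.val_neg, Units.val_one, neg_smul, one_smul, smul_add]
    abel
  have hord : ∀ i b, (G i b).OrdLE i := fun i b =>
    OrdLE.sub (((ordLE_monomial i 1).mul (ordLE_monomial 0 b)).adj.mono (by omega))
      fun j hj => by
        rw [coeff_zsmul, ((ordLE_monomial 0 b).mul (ordLE_monomial i 1)) j (by omega), smul_zero]
  induction i using Int.induction_on with
  | zero =>
    intro b
    simp only [G, del_zero, one_mul, mul_one, adj_fn, Int.negOnePow_zero, Units.val_one, one_smul,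
      sub_self]
  | succ i ih =>
    intro b
    rw [hstep, ih, ih, mul_zero, sub_zero]
  | pred i ih =>
    have h1 : ∀ b, G (-(i : ℤ) - 1) b = del (-1) * G (-(i : ℤ) - 1) (dx b) := by
      intro b
      have := hstep (-(i : ℤ) - 1) b
      rw [sub_add_cancel, ih, eq_comm, sub_eq_zero] at this
      exact eq_del_neg_one_mul this.symm
    intro b
    refine eq_zero_of_ordLE (c := -(i : ℤ) - 1) fun n => ?_
    induction n generalizing b with
    | zero => exact (hord _ b).mono (by simp)
    | succ n ihn =>
      rw [h1]
      exact ((ordLE_monomial (-1) 1).mul (ihn (dx b))).mono (by push_cast; omega)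

theorem adj_mul (P Q : PDO K) : (P * Q).adj = Q.adj * P.adj := by
  obtain ⟨N, hQ⟩ := Q.exists_ordLE
  refine hom_eq_of_monomial (c := N) (F := adjHom.comp (mulHom.flip Q))
    (G := (mulHom Q.adj).comp adjHom) (fun P M hP => ?_)
    (fun P M hP => ?_) (fun i a => ?_) P
  · exact (hP.mul hQ).adj
  · exact (hQ.adj.mul hP.adj).mono (by omega)
  · change (monomial i a * Q).adj = Q.adj * (monomial i a).adj
    rw [monomial_mul_eq, adj_fn_mul, adj_monomial, mul_smul_comm, ← mul_assoc, ← smul_mul_assoc]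
    congr 1
    refine hom_eq_of_monomial (c := i) (F := adjHom.comp (mulHom (del i)))
      (G := (Int.negOnePow i : ℤ) • (mulHom.flip (del i)).comp adjHom) (fun P M hP => ?_)
      (fun P M hP n hn => ?_) (fun j b => ?_) Q
    · exact ((ordLE_monomial i 1).mul hP).adj.mono (by omega)
    · change ((Int.negOnePow i : ℤ) • (P.adj * del i)).coeff n = 0
      rw [coeff_zsmul, hP.adj.mul (ordLE_monomial i 1) n (by omega), smul_zero]
    · change (del i * monomial j b).adj = (Int.negOnePow i : ℤ) • ((monomial j b).adj * del i)
      rw [← fn_mul_del b j, ← mul_assoc, adj_mul_del, adj_del_mul_fn, adj_mul_del, adj_fn,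
        smul_mul_assoc, mul_smul_comm, smul_comm, mul_assoc]

theorem adj_one : (1 : PDO K).adj = 1 := adj_fn 1

theorem adj_adj (P : PDO K) : P.adj.adj = P := by
  refine hom_eq_of_monomial (c := 0) (F := adjHom.comp adjHom) (G := AddMonoidHom.id _)
    (fun P M hP => ?_) (fun P M hP => ?_) (fun i a => ?_) P
  · rw [add_zero]
    exact hP.adj.adj
  · rwa [add_zero]
  · change (monomial i a).adj.adj = monomial i a
    rw [adj_monomial, adj_zsmul, adj_mul, adj_fn, adj_del, mul_smul_comm, smul_smul, fn_mul_del,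
      ← Units.val_mul, Int.units_mul_self, Units.val_one, one_smul]

theorem adj_pow (P : PDO K) (n : ℕ) : (P ^ n).adj = P.adj ^ n := by
  induction n with
  | zero => exact adj_one
  | succ n ih => rw [pow_succ, adj_mul, ih, pow_succ']

/-! #### Differential and integral parts -/

theorem nonneg_coeff (P : PDO K) (i : ℤ) :
    P.nonneg.coeff i = if 0 ≤ i then P.coeff i else 0 := coeff_ofCoeff _ _ _

theorem neg_coeff (P : PDO K) (i : ℤ) :
    P.neg.coeff i = if i < 0 then P.coeff i else 0 := coeff_ofCoeff _ _ _

theorem nonneg_add_neg (P : PDO K) : P.nonneg + P.neg = P := by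
  ext1 i
  rw [coeff_add, nonneg_coeff, neg_coeff]
  split_ifs <;> first | omega | simp

theorem neg_add (P Q : PDO K) : (P + Q).neg = P.neg + Q.neg := by
  ext1 i
  simp only [neg_coeff, coeff_add]
  split_ifs <;> simp

/-- `P ↦ P_{<0}` as an additive map. -/
def negHom : PDO K →+ PDO K := AddMonoidHom.mk' neg neg_add

theorem neg_sub (P Q : PDO K) : (P - Q).neg = P.neg - Q.neg := map_sub negHom P Q

theorem neg_neg (P : PDO K) : (-P).neg = -P.neg := map_neg negHom P

theorem ordLE_neg (P : PDO K) : P.neg.OrdLE (-1) := fun i hi => by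
  rw [neg_coeff, if_neg (by omega)]

theorem OrdLE.neg_eq {P : PDO K} (hP : P.OrdLE (-1)) : P.neg = P := by
  ext1 i
  rw [neg_coeff]
  split_ifs with h
  · rfl
  · exact (hP i (by omega)).symm

theorem OrdLE.nonneg_eq_zero {P : PDO K} (hP : P.OrdLE (-1)) : P.nonneg = 0 := by
  ext1 i
  rw [nonneg_coeff]
  split_ifs with h
  · exact hP i (by omega)
  · rfl

theorem nonneg_add (P Q : PDO K) : (P + Q).nonneg = P.nonneg + Q.nonneg := by
  ext1 i
  simp only [nonneg_coeff, coeff_add]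
  split_ifs <;> simp

/-- `P` is a differential operator. -/
def IsDiff (P : PDO K) : Prop := ∀ i < 0, P.coeff i = 0

theorem IsDiff.neg_eq_zero {P : PDO K} (hP : P.IsDiff) : P.neg = 0 := by
  ext1 i
  rw [neg_coeff]
  split_ifs with h
  · exact hP i h
  · rfl

theorem IsDiff.nonneg_eq {P : PDO K} (hP : P.IsDiff) : P.nonneg = P := by
  have := P.nonneg_add_neg
  rwa [hP.neg_eq_zero, add_zero] at this

theorem isDiff_nonneg (P : PDO K) : P.nonneg.IsDiff := fun i hi => by
  rw [nonneg_coeff, if_neg (by omega)]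

theorem isDiff_monomial {n : ℤ} (hn : 0 ≤ n) (f : Fn K) : (monomial n f).IsDiff := fun i hi => by
  rw [coeff_monomial, if_neg (by omega)]

theorem choose_eq_zero {i : ℤ} {l : ℕ} (h0 : 0 ≤ i) (hl : i < l) : Ring.choose i l = 0 := by
  lift i to ℕ using h0
  rw [Ring.choose_natCast, Nat.choose_eq_zero_of_lt (by omega), Nat.cast_zero]

theorem IsDiff.mul {P Q : PDO K} (hP : P.IsDiff) (hQ : Q.IsDiff) : (P * Q).IsDiff := fun n hn => by
  rw [coeff_mul]
  refine finsum_eq_zero_of_forall_eq_zero fun p => ?_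
  rcases lt_or_ge p.1 0 with h | h
  · rw [hP _ h, zero_mul, smul_zero]
  · rcases lt_or_ge p.1 p.2 with h' | h'
    · rw [choose_eq_zero h h', zero_smul]
    · rw [hQ _ (by omega), iterate_dx_zero, mul_zero, smul_zero]

theorem IsDiff.adj {P : PDO K} (hP : P.IsDiff) : P.adj.IsDiff := fun n hn => by
  rw [PDO.adj, coeff_ofCoeff]
  refine finsum_eq_zero_of_forall_eq_zero fun l => ?_
  rcases lt_or_ge (n + l) 0 with h | h
  · rw [hP _ h, iterate_dx_zero, smul_zero]
  · rw [choose_eq_zero h (by omega), mul_zero, zero_smul]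

theorem adj_neg_part (P : PDO K) : P.neg.adj = P.adj.neg := by
  conv_rhs => rw [← P.nonneg_add_neg, adj_add, neg_add, P.isDiff_nonneg.adj.neg_eq_zero, zero_add,
    (ordLE_neg P).adj.neg_eq]

theorem adj_nonneg_part (P : PDO K) : P.nonneg.adj = P.adj.nonneg := by
  conv_rhs => rw [← P.nonneg_add_neg, adj_add, nonneg_add, P.isDiff_nonneg.adj.nonneg_eq,
    (ordLE_neg P).adj.nonneg_eq_zero, add_zero]

/-! #### Residues and the action on functions -/

theorem res_adj (P : PDO K) : P.adj.res = -P.res := by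
  obtain ⟨N, hP⟩ := P.exists_ordLE
  rw [res, res, coeff_adj_eq_sum hP (-1) (M := (N + 1).toNat + 1) (by push_cast; omega),
    Finset.sum_eq_single 0]
  · simp
  -- the coefficient of `∂^{-1+l}` contributes with the binomial coefficient `(-1+l choose l)`
  · intro l _ hl
    rw [choose_eq_zero (by omega) (by omega), mul_zero, zero_smul]
  · simp

theorem app_eq_sum {P : PDO K} {N : ℤ} (hP : P.OrdLE N) (f : Fn K) {M : ℕ} (hM : N < M) :
    P.app f = ∑ i ∈ Finset.range M, P.coeff i * dx^[i] f := by
  rw [app]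
  refine finsum_eq_sum_of_support_subset _ fun l hl => ?_
  rw [Function.mem_support] at hl
  by_contra hn
  apply hl
  rw [Finset.mem_coe, Finset.mem_range] at hn
  rw [hP _ (by omega), zero_mul]

theorem app_nonneg (P : PDO K) (f : Fn K) : P.nonneg.app f = P.app f := by
  rw [app, app]
  refine finsum_congr fun i => ?_
  rw [nonneg_coeff, if_pos (by omega)]

/-- The action of `P` on `f` is the coefficient of `∂^0` in the operator `P f`. -/
theorem coeff_zero_mul_fn (P : PDO K) (f : Fn K) : (P * fn f).coeff 0 = P.app f := by
  obtain ⟨N, hP⟩ := P.exists_ordLE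
  obtain ⟨M, hM⟩ : ∃ M : ℕ, N < M := ⟨N.toNat + 1, by omega⟩
  have hinj : Set.InjOn (fun i : ℕ => ((i : ℤ), i)) (Finset.range M : Set ℕ) :=
    fun a _ b _ h => (Prod.ext_iff.mp h).2
  rw [app_eq_sum hP f hM, coeff_mul, finsum_eq_sum_of_support_subset
    (s := (Finset.range M).image fun i : ℕ => ((i : ℤ), i)), Finset.sum_image hinj]
  · refine Finset.sum_congr rfl fun i _ => ?_
    rw [coeff_monomial, if_pos (by ring), Ring.choose_natCast, Nat.choose_self, Nat.cast_one,
      one_smul]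
  · rintro ⟨i, l⟩ hp
    rw [Function.mem_support] at hp
    by_contra hn
    apply hp
    rw [coeff_monomial]
    split_ifs with h
    · have hi : i = l := by simpa [sub_eq_zero, neg_add_eq_zero] using h
      rw [hP i, zero_mul, smul_zero]
      by_contra hle
      apply hn
      simp only [Finset.coe_image, Set.mem_image, Finset.mem_coe, Finset.mem_range, Prod.mk.injEq]
      exact ⟨l, by omega, hi.symm, rfl⟩
    · rw [iterate_dx_zero, mul_zero, smul_zero]

theorem res_mul_fn_mul_del (P : PDO K) (f : Fn K) : (P * fn f * del (-1)).res = P.app f := by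
  rw [res, coeff_mul_del, sub_self, coeff_zero_mul_fn]

/-! #### Flows -/

theorem flow_coeff (i : ℕ) (P : PDO K) (n : ℤ) : (P.flow i).coeff n = dt i (P.coeff n) :=
  coeff_ofCoeff _ _ _

theorem flow_add (i : ℕ) (P Q : PDO K) : (P + Q).flow i = P.flow i + Q.flow i := by
  ext1 n
  simp only [flow_coeff, coeff_add, map_add]

/-- `∂_{t_{2i+1}}` on operators as an additive map. -/
def flowHom (i : ℕ) : PDO K →+ PDO K := AddMonoidHom.mk' (flow i) (flow_add i)

theorem flow_sub (i : ℕ) (P Q : PDO K) : (P - Q).flow i = P.flow i - Q.flow i :=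
  map_sub (flowHom i) P Q

theorem OrdLE.flow {P : PDO K} {N : ℤ} (hP : P.OrdLE N) (i : ℕ) : (P.flow i).OrdLE N :=
  fun n hn => by rw [flow_coeff, hP n hn, dt_zero]

theorem flow_mul (i : ℕ) (P Q : PDO K) : (P * Q).flow i = P.flow i * Q + P * Q.flow i := by
  obtain ⟨M, hP⟩ := P.exists_ordLE
  obtain ⟨N, hQ⟩ := Q.exists_ordLE
  ext1 n
  rw [flow_coeff, coeff_add, coeff_mul_eq_sum hP hQ, coeff_mul_eq_sum (hP.flow i) hQ,
    coeff_mul_eq_sum hP (hQ.flow i), dt_sum, ← Finset.sum_add_distrib]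
  refine Finset.sum_congr rfl fun p _ => ?_
  rw [dt_zsmul, dt_mul, dt_iterate_dx, smul_add, flow_coeff, flow_coeff]

theorem flow_monomial (i : ℕ) (n : ℤ) (f : Fn K) :
    (monomial n f).flow i = monomial n (dt i f) := by
  ext1 j
  rw [flow_coeff, coeff_monomial, coeff_monomial]
  split_ifs <;> simp

theorem flow_del (i : ℕ) (n : ℤ) : (del n : PDO K).flow i = 0 := by
  rw [flow_monomial, dt_one, monomial_zero]

theorem flow_one (i : ℕ) : (1 : PDO K).flow i = 0 := flow_del i 0

theorem flow_comm (i j : ℕ) (P : PDO K) : (P.flow i).flow j = (P.flow j).flow i := by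
  ext1 n
  simp only [flow_coeff, dt_comm j i]

theorem flow_neg_part (i : ℕ) (P : PDO K) : P.neg.flow i = (P.flow i).neg := by
  ext1 n
  rw [flow_coeff, neg_coeff, neg_coeff, flow_coeff]
  split_ifs <;> simp

theorem flow_adj (i : ℕ) (P : PDO K) : P.adj.flow i = (P.flow i).adj := by
  obtain ⟨N, hP⟩ := P.exists_ordLE
  ext1 n
  have hM : N - n < ((N - n).toNat + 1 : ℕ) := by omega
  rw [flow_coeff, coeff_adj_eq_sum hP n hM, coeff_adj_eq_sum (hP.flow i) n hM, dt_sum]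
  refine Finset.sum_congr rfl fun l _ => ?_
  rw [dt_zsmul, dt_iterate_dx, flow_coeff]

/-- `P_x = [∂, P]`. -/
theorem flow_zero_eq (P : PDO K) : P.flow 0 = del 1 * P - P * del 1 := by
  ext1 n
  rw [flow_coeff, coeff_sub, coeff_del_one_mul, coeff_mul_del, add_sub_cancel_left]

end PDO

/-! ### The exponential `e^ξ` -/

section ODE

open PowerSeries

/-- Uniqueness for linear differential equations `F' = F g` of formal power series. -/
theorem eq_zero_of_derivative_eq_mul {R : Type*} [CommRing R] [IsAddTorsionFree R]
    {F g : PowerSeries R} (hF : derivative R F = F * g) (h0 : constantCoeff F = 0) : F = 0 := by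
  ext n
  rw [map_zero]
  induction n using Nat.strong_induction_on with
  | _ n ih =>
    cases n with
    | zero => rwa [coeff_zero_eq_constantCoeff_apply]
    | succ n =>
      have h := congrArg (coeff n) hF
      rw [coeff_derivative, coeff_mul, Finset.sum_eq_zero] at h
      · have h2 : (n + 1) • coeff (n + 1) F = 0 := by
          rw [nsmul_eq_mul, mul_comm]
          exact_mod_cast h
        rwa [← nsmul_zero (n + 1), nsmul_right_inj n.succ_ne_zero] at h2
      · intro p hp
        rw [ih p.1 (by have := Finset.HasAntidiagonal.mem_antidiagonal.mp hp; omega), zero_mul]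

theorem eq_of_derivative_eq_mul {R : Type*} [CommRing R] [IsAddTorsionFree R]
    {E F g : PowerSeries R} (hE : derivative R E = E * g) (hF : derivative R F = F * g)
    (h0 : constantCoeff E = constantCoeff F) : E = F := by
  refine sub_eq_zero.mp (eq_zero_of_derivative_eq_mul (g := g) ?_ ?_)
  · rw [map_sub, hE, hF, sub_mul]
  · rw [map_sub, h0, sub_self]

/-- A derivation of the coefficients, applied to a power series coefficientwise. -/
def dmap {R S : Type*} [CommRing S] [CommRing R] [Algebra S R] (D : Derivation S R R)
    (F : PowerSeries R) : PowerSeries R :=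
  PowerSeries.mk fun n => D (coeff n F)

theorem dmap_mul {R S : Type*} [CommRing S] [CommRing R] [Algebra S R] (D : Derivation S R R)
    (F G : PowerSeries R) : dmap D (F * G) = dmap D F * G + F * dmap D G := by
  ext n
  simp only [dmap, coeff_mk, coeff_mul, map_add, map_sum, Derivation.leibniz, smul_eq_mul]
  rw [← Finset.sum_add_distrib]
  refine Finset.sum_congr rfl fun p _ => ?_
  ring

theorem dmap_one {R S : Type*} [CommRing S] [CommRing R] [Algebra S R] (D : Derivation S R R) :
    dmap D (1 : PowerSeries R) = 0 := by
  ext n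
  rw [dmap, coeff_mk, coeff_one]
  split_ifs <;> simp

theorem derivative_dmap {R S : Type*} [CommRing S] [CommRing R] [Algebra S R]
    (D : Derivation S R R) (F : PowerSeries R) :
    derivative R (dmap D F) = dmap D (derivative R F) := by
  ext n
  simp only [dmap, coeff_mk, coeff_derivative, Derivation.leibniz, smul_eq_mul]
  have h : D ((n : R) + 1) = 0 := by
    have := D.map_natCast (n + 1)
    push_cast at this
    exact this
  rw [h]
  ring

end ODE

section Exp

variable {σ τ : Type*}

instance [CharZero K] : IsAddTorsionFree (MvPowerSeries σ K) :=
  inferInstanceAs (IsAddTorsionFree ((σ →₀ ℕ) → K))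

theorem hasSubst_xi (s : ℕ → MvPowerSeries σ K) : PowerSeries.HasSubst (xi s) := by
  refine PowerSeries.HasSubst.of_constantCoeff_zero' ?_
  rw [← PowerSeries.coeff_zero_eq_constantCoeff_apply, xi, PowerSeries.coeff_mk, if_neg (by decide)]

theorem coeff_derivative_xi (s : ℕ → MvPowerSeries σ K) (n : ℕ) :
    PowerSeries.coeff n (PowerSeries.derivative _ (xi s)) =
      if Even n then (n + 1 : ℕ) • s (n / 2) else 0 := by
  rw [PowerSeries.coeff_derivative, xi, PowerSeries.coeff_mk, nsmul_eq_mul, mul_comm]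
  by_cases h : Even n
  · obtain ⟨m, rfl⟩ := h
    rw [if_pos (by simp), if_pos (by simp), show (m + m + 1) / 2 = (m + m) / 2 by omega]
    push_cast
    ring
  · rw [if_neg (by simpa [parity_simps] using h), if_neg h, mul_zero]

variable [CharZero K]

theorem expXi_eq (s : ℕ → MvPowerSeries σ K) :
    expXi s = ((PowerSeries.exp K).map (algebraMap K (MvPowerSeries σ K))).subst (xi s) := by
  ext1 n
  rw [expXi, PowerSeries.coeff_subst' (hasSubst_xi s), PowerSeries.coeff_subst' (hasSubst_xi s)]
  refine finsum_congr fun d => ?_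
  rw [PowerSeries.coeff_map, algebraMap_smul]

/-- The differential equation `∂_λ e^ξ = e^ξ ∂_λ ξ`, which determines `e^ξ`. -/
theorem derivative_expXi (s : ℕ → MvPowerSeries σ K) :
    PowerSeries.derivative _ (expXi s) = expXi s * PowerSeries.derivative _ (xi s) := by
  rw [expXi_eq, PowerSeries.derivative_subst (hasSubst_xi s), PowerSeries.map_exp,
    PowerSeries.derivative_exp]

theorem constantCoeff_expXi (s : ℕ → MvPowerSeries σ K) :
    PowerSeries.constantCoeff (expXi s) = 1 := by
  rw [expXi, ← PowerSeries.coeff_zero_eq_constantCoeff_apply,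
    PowerSeries.coeff_subst' (hasSubst_xi s), finsum_eq_single _ 0]
  · simp
  · intro n hn
    have h0 : PowerSeries.constantCoeff (xi s) = 0 := by
      rw [← PowerSeries.coeff_zero_eq_constantCoeff_apply, xi, PowerSeries.coeff_mk,
        if_neg (by decide)]
    rw [PowerSeries.coeff_zero_eq_constantCoeff_apply, map_pow, h0, zero_pow hn, smul_zero]

/-- A family of times whose member `s i`, standing for `s_{2i+1}`, has weight at least `2i+1`. -/
def IsTimes (w : σ → ℕ) (s : ℕ → MvPowerSeries σ K) : Prop :=
  ∀ i, ((2 * i + 1 : ℕ) : ℕ∞) ≤ (s i).weightedOrder w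

/-- The coefficient of `λ^N` in `e^ξ` has weight at least `N`. Hence each monomial in the times
occurs in finitely many terms of `A(λ) e^ξ`. -/
theorem le_weightedOrder_expXi {w : σ → ℕ} {s : ℕ → MvPowerSeries σ K} (hs : IsTimes w s) (N : ℕ) :
    (N : ℕ∞) ≤ (PowerSeries.coeff N (expXi s)).weightedOrder w := by
  induction N using Nat.strong_induction_on with
  | _ N ih =>
    cases N with
    | zero => simp
    | succ N =>
      refine MvPowerSeries.nat_le_weightedOrder w fun d hd => ?_
      have h := congrArg (PowerSeries.coeff N) (derivative_expXi s)
      rw [PowerSeries.coeff_derivative, PowerSeries.coeff_mul] at h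
      have h2 : (N + 1) • PowerSeries.coeff (N + 1) (expXi s) = _ :=
        Eq.trans (by rw [nsmul_eq_mul, mul_comm]; push_cast; rfl) h
      have h3 := congrArg (MvPowerSeries.coeff d) h2
      rw [map_nsmul, map_sum, Finset.sum_eq_zero] at h3
      · rwa [← nsmul_zero (N + 1), nsmul_right_inj N.succ_ne_zero] at h3
      · intro p hp
        rw [Finset.HasAntidiagonal.mem_antidiagonal] at hp
        refine MvPowerSeries.coeff_eq_zero_of_lt_weightedOrder w ?_
        refine lt_of_lt_of_le (b := ((p.1 + (p.2 + 1) : ℕ) : ℕ∞)) (by exact_mod_cast (by omega)) ?_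
        rw [coeff_derivative_xi]
        split_ifs with he
        · rw [mul_smul_comm, ← Nat.cast_smul_eq_nsmul K]
          refine le_trans ?_ (MvPowerSeries.le_weightedOrder_smul w)
          refine le_trans ?_ (MvPowerSeries.le_weightedOrder_mul w)
          rw [Nat.cast_add]
          refine add_le_add (ih _ (by omega)) (le_trans ?_ (hs (p.2 / 2)))
          rw [Nat.two_mul_div_two_of_even he]
        · simp

/-- `∂ e^ξ = c λ^{2i+1} e^ξ` for a derivation `∂` with `∂ s_{2i+1} = c` that kills the other
times. -/
theorem derivation_coeff_expXi {s : ℕ → MvPowerSeries σ K}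
    (D : Derivation K (MvPowerSeries σ K) (MvPowerSeries σ K)) (i : ℕ) (c : MvPowerSeries σ K)
    (hD : ∀ j, D (s j) = if j = i then c else 0) (N : ℕ) :
    D (PowerSeries.coeff N (expXi s)) =
      if 2 * i + 1 ≤ N then c * PowerSeries.coeff (N - (2 * i + 1)) (expXi s) else 0 := by
  have h : dmap D (expXi s) = PowerSeries.C c * PowerSeries.X ^ (2 * i + 1) * expXi s := by
    refine sub_eq_zero.mp (eq_zero_of_derivative_eq_mul
      (g := PowerSeries.derivative _ (xi s)) ?_ ?_)
    · have hxi : dmap D (PowerSeries.derivative _ (xi s)) =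
          PowerSeries.C c * PowerSeries.derivative _ (PowerSeries.X ^ (2 * i + 1)) := by
        ext1 n
        rw [dmap, PowerSeries.coeff_mk, coeff_derivative_xi, PowerSeries.coeff_C_mul,
          PowerSeries.coeff_derivative, PowerSeries.coeff_X_pow]
        split_ifs with h1 h2 h2
        · rw [map_nsmul, hD, if_pos (by omega), nsmul_eq_mul]
          push_cast
          ring
        · obtain ⟨m, rfl⟩ := h1
          rw [map_nsmul, hD, if_neg (by omega), smul_zero, zero_mul, mul_zero]
        · exact absurd ⟨i, by omega⟩ h1
        · rw [map_zero, zero_mul, mul_zero]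
      rw [map_sub, derivative_dmap, derivative_expXi, dmap_mul, hxi, Derivation.leibniz,
        Derivation.leibniz, derivative_expXi]
      have hC : PowerSeries.derivative (MvPowerSeries σ K) (PowerSeries.C c) = 0 :=
        PowerSeries.derivative_C
      rw [hC]
      simp only [smul_eq_mul]
      ring
    · rw [map_sub, ← PowerSeries.coeff_zero_eq_constantCoeff_apply, dmap, PowerSeries.coeff_mk,
        PowerSeries.coeff_zero_eq_constantCoeff_apply, constantCoeff_expXi, D.map_one_eq_zero]
      simp
  have := congrArg (PowerSeries.coeff N) h
  rw [dmap, PowerSeries.coeff_mk, mul_assoc, PowerSeries.coeff_C_mul,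
    PowerSeries.coeff_X_pow_mul'] at this
  rw [this]
  split_ifs <;> simp

/-! ### Wave functions as formal series -/

/-- The coefficient of a monomial of weight less than `M` in `A(λ) e^ξ` is already given by the
first `M` terms of `e^ξ`. -/
theorem coeff_expCoeff {w : σ → ℕ} {s : ℕ → MvPowerSeries σ K} (hs : IsTimes w s)
    (A : LaurentSeries (MvPowerSeries σ K)) (j : ℤ) {d : σ →₀ ℕ} {M : ℕ}
    (hM : Finsupp.weight w d < M) :
    MvPowerSeries.coeff d (expCoeff s A j) = MvPowerSeries.coeff d
      (∑ N ∈ Finset.range M, HahnSeries.coeff A (N - j) * PowerSeries.coeff N (expXi s)) := by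
  rw [map_sum]
  refine (finsum_eq_sum_of_support_subset _ fun N hN => ?_)
  rw [Function.mem_support] at hN
  by_contra hn
  apply hN
  rw [Finset.mem_coe, Finset.mem_range, not_lt] at hn
  refine MvPowerSeries.coeff_eq_zero_of_lt_weightedOrder w ?_
  refine lt_of_lt_of_le (b := (N : ℕ∞)) (by exact_mod_cast (by omega)) ?_
  refine le_trans ?_ (MvPowerSeries.le_weightedOrder_mul w)
  exact le_trans (le_weightedOrder_expXi hs N) le_add_self

/-- The derivative of `A(λ) e^ξ` is `(∂A + c λ^{2i+1} A)(λ) e^ξ`. -/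
theorem derivation_expCoeff {w : σ → ℕ} {s : ℕ → MvPowerSeries σ K} (hs : IsTimes w s)
    (l : σ) (i : ℕ) (c : MvPowerSeries σ K)
    (hD : ∀ j, MvPowerSeries.pderiv K l (s j) = if j = i then c else 0)
    {A A' : LaurentSeries (MvPowerSeries σ K)}
    (h : ∀ m, A'.coeff m = MvPowerSeries.pderiv K l (A.coeff m)
      + c * A.coeff (m + (2 * i + 1 : ℕ))) (j : ℤ) :
    MvPowerSeries.pderiv K l (expCoeff s A j) = expCoeff s A' j := by
  ext d
  obtain ⟨M, hM⟩ : ∃ M, Finsupp.weight w (d + Finsupp.single l 1) + Finsupp.weight w d < M :=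
    ⟨_, Nat.lt_succ_self _⟩
  rw [MvPowerSeries.coeff_pderiv, coeff_expCoeff hs A j (M := M + (2 * i + 1)) (by omega),
    ← MvPowerSeries.coeff_pderiv, coeff_expCoeff hs A' j (M := M) (by omega)]
  have hlt : MvPowerSeries.coeff d (∑ N ∈ Finset.range (M + (2 * i + 1)),
        MvPowerSeries.pderiv K l (A.coeff (N - j)) * PowerSeries.coeff N (expXi s))
      = MvPowerSeries.coeff d (∑ N ∈ Finset.range M,
        MvPowerSeries.pderiv K l (A.coeff (N - j)) * PowerSeries.coeff N (expXi s)) := by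
    rw [Finset.sum_range_add, map_add, add_eq_left, map_sum]
    refine Finset.sum_eq_zero fun N _ => ?_
    refine MvPowerSeries.coeff_eq_zero_of_lt_weightedOrder w ?_
    refine lt_of_lt_of_le (b := ((M + N : ℕ) : ℕ∞)) (by exact_mod_cast (by omega)) ?_
    refine le_trans ?_ (MvPowerSeries.le_weightedOrder_mul w)
    exact le_trans (le_weightedOrder_expXi hs _) le_add_self
  rw [map_sum]
  simp only [Derivation.leibniz, smul_eq_mul, Finset.sum_add_distrib, map_add, h, add_mul,
    derivation_coeff_expXi _ i c hD]
  rw [add_comm]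
  congr 1
  · rw [← hlt]
    simp only [mul_comm]
  · congr 1
    rw [add_comm M, Finset.sum_range_add, Finset.sum_eq_zero, zero_add]
    · refine Finset.sum_congr rfl fun N _ => ?_
      rw [if_pos (by omega), Nat.add_sub_cancel_left, show
        ((2 * i + 1 + N : ℕ) : ℤ) - j = N - j + (2 * i + 1 : ℕ) by push_cast; ring]
      ring
    · intro N hN
      rw [Finset.mem_range] at hN
      rw [if_neg (by omega), mul_zero]

theorem expCoeff_add {w : σ → ℕ} {s : ℕ → MvPowerSeries σ K} (hs : IsTimes w s)
    (A B : LaurentSeries (MvPowerSeries σ K)) (j : ℤ) :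
    expCoeff s (A + B) j = expCoeff s A j + expCoeff s B j := by
  ext d
  rw [map_add, coeff_expCoeff hs _ j (Nat.lt_succ_self _), coeff_expCoeff hs _ j
    (Nat.lt_succ_self _), coeff_expCoeff hs _ j (Nat.lt_succ_self _), ← map_add,
    ← Finset.sum_add_distrib]
  simp only [HahnSeries.coeff_add, add_mul]

theorem mul_expCoeff {w : σ → ℕ} {s : ℕ → MvPowerSeries σ K} (hs : IsTimes w s)
    (f : MvPowerSeries σ K) {A B : LaurentSeries (MvPowerSeries σ K)}
    (h : ∀ n, B.coeff n = f * A.coeff n) (j : ℤ) :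
    f * expCoeff s A j = expCoeff s B j := by
  classical
  ext d
  rw [coeff_expCoeff hs _ j (Nat.lt_succ_self _)]
  simp only [h, mul_assoc]
  rw [← Finset.mul_sum, MvPowerSeries.coeff_mul, MvPowerSeries.coeff_mul]
  refine Finset.sum_congr rfl fun p hp => ?_
  rw [coeff_expCoeff hs]
  rw [Finset.HasAntidiagonal.mem_antidiagonal] at hp
  rw [← hp, map_add]
  omega

/-- A substitution that does not lower weights can be carried out in `A(λ) e^ξ` term by term. -/
theorem coeff_subst_expCoeff {w : σ → ℕ} {s : ℕ → MvPowerSeries σ K} (hs : IsTimes w s)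
    {w' : τ → ℕ} {a : σ → MvPowerSeries τ K} (ha : MvPowerSeries.HasSubst a)
    (haw : ∀ i, (w i : ℕ∞) ≤ (a i).weightedOrder w')
    (A : LaurentSeries (MvPowerSeries σ K)) (j : ℤ) {d : τ →₀ ℕ} {M : ℕ}
    (hM : Finsupp.weight w' d < M) :
    MvPowerSeries.coeff d (MvPowerSeries.subst a (expCoeff s A j)) = MvPowerSeries.coeff d
      (∑ N ∈ Finset.range M, MvPowerSeries.subst a (HahnSeries.coeff A (N - j))
        * MvPowerSeries.subst a (PowerSeries.coeff N (expXi s))) := by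
  set S := ∑ N ∈ Finset.range M, HahnSeries.coeff A (N - j) * PowerSeries.coeff N (expXi s) with hS
  have h1 : MvPowerSeries.subst a S = ∑ N ∈ Finset.range M,
      MvPowerSeries.subst a (HahnSeries.coeff A (N - j))
        * MvPowerSeries.subst a (PowerSeries.coeff N (expXi s)) := by
    rw [hS, ← MvPowerSeries.substAlgHom_apply (R := K) ha, map_sum]
    simp only [map_mul, MvPowerSeries.substAlgHom_apply]
  rw [← h1, ← sub_eq_zero, ← map_sub, ← MvPowerSeries.subst_sub ha]
  refine MvPowerSeries.coeff_eq_zero_of_lt_weightedOrder w' (lt_of_lt_of_le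
    (b := (M : ℕ∞)) (by exact_mod_cast hM)
    (le_trans ?_ (MvPowerSeries.le_weightedOrder_subst w' ha _)))
  refine le_iInf₂ fun e he => ?_
  have hMe : M ≤ Finsupp.weight w e := by
    by_contra hlt
    rw [not_le] at hlt
    apply he
    rw [map_sub, coeff_expCoeff hs A j hlt, sub_self]
  refine le_trans (b := ((Finsupp.weight w e : ℕ) : ℕ∞)) (by exact_mod_cast hMe) ?_
  rw [Finsupp.weight_apply, Finsupp.weight_apply, Finsupp.sum, Finsupp.sum, Nat.cast_sum]
  refine Finset.sum_le_sum fun i _ => ?_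
  rw [smul_eq_mul, Nat.cast_mul, nsmul_eq_mul]
  exact mul_le_mul_right (haw i) _

end Exp

/-! ### Two sets of times and restriction to the diagonal -/

/-- `∂_{t_{2i+1}}` on functions of `(t, t')`. -/
abbrev dT (i : ℕ) : Derivation K (Fn2 K) (Fn2 K) := MvPowerSeries.pderiv K (Sum.inl i)

theorem atT_eq (f : Fn K) :
    atT f = MvPowerSeries.rename (Function.Embedding.inl : ℕ ↪ ℕ ⊕ ℕ) f := rfl

theorem atT'_eq (f : Fn K) :
    atT' f = MvPowerSeries.rename (Function.Embedding.inr : ℕ ↪ ℕ ⊕ ℕ) f := rfl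

theorem atT_injective : Function.Injective (atT (K := K)) :=
  MvPowerSeries.rename_injective _

theorem pderiv_rename {σ τ : Type*} (e : σ ↪ τ) (f : MvPowerSeries σ K) (i : σ) :
    MvPowerSeries.pderiv K (e i) (MvPowerSeries.rename e f) =
      MvPowerSeries.rename e (MvPowerSeries.pderiv K i f) := by
  classical
  ext d
  rw [MvPowerSeries.coeff_pderiv]
  by_cases hd : ∃ x, d = Finsupp.embDomain e x
  · obtain ⟨x, rfl⟩ := hd
    rw [MvPowerSeries.coeff_embDomain_rename, ← Finsupp.embDomain_single, ← Finsupp.embDomain_add,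
      MvPowerSeries.coeff_embDomain_rename, MvPowerSeries.coeff_pderiv, Finsupp.embDomain_apply_self]
  · rw [MvPowerSeries.coeff_rename_eq_zero, MvPowerSeries.coeff_rename_eq_zero, zero_mul]
    · rintro ⟨x, hx⟩
      exact hd ⟨x, by rw [← hx, Finsupp.embDomain_eq_mapDomain]⟩
    · rintro ⟨x, hx⟩
      apply hd
      refine ⟨x - Finsupp.single i 1, ?_⟩
      ext t
      by_cases ht : t ∈ Set.range e
      · obtain ⟨s, rfl⟩ := ht
        have := DFunLike.congr_fun hx (e s)
        rw [Finsupp.mapDomain_apply e.injective, Finsupp.add_apply, Finsupp.single_apply] at this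
        rw [Finsupp.embDomain_apply_self, Finsupp.tsub_apply, Finsupp.single_apply]
        simp only [e.injective.eq_iff] at this
        omega
      · have := DFunLike.congr_fun hx t
        rw [Finsupp.mapDomain_of_notMem_range _ _ ht, Finsupp.add_apply] at this
        rw [Finsupp.embDomain_of_notMem_range _ _ _ ht]
        omega

theorem dT_atT (i : ℕ) (f : Fn K) : dT i (atT f) = atT (dt i f) :=
  pderiv_rename Function.Embedding.inl f i

theorem dT_atT' (i : ℕ) (f : Fn K) : dT i (atT' f) = 0 := by
  ext d
  rw [MvPowerSeries.coeff_pderiv, atT'_eq, MvPowerSeries.coeff_rename_eq_zero, zero_mul, map_zero]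
  rintro ⟨x, hx⟩
  have := DFunLike.congr_fun hx (Sum.inl i)
  rw [Finsupp.mapDomain_of_notMem_range _ _ (by simp)] at this
  simp at this

instance : Filter.TendstoCofinite (Sum.elim id id : ℕ ⊕ ℕ → ℕ) := by
  rw [Filter.tendstoCofinite_iff_finite_preimage_singleton]
  intro b
  refine (Set.toFinite {Sum.inl b, Sum.inr b}).subset ?_
  rintro (i | i) hi
  · left
    simpa using hi
  · right
    simpa using hi

/-- The restriction `f(t, t') ↦ f(t, t)` to the diagonal. -/
def diag : Fn2 K →ₐ[K] Fn K := MvPowerSeries.rename (Sum.elim id id : ℕ ⊕ ℕ → ℕ)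

theorem diag_atT (f : Fn K) : diag (atT f) = f := by
  rw [diag, atT_eq, MvPowerSeries.rename_rename]
  exact MvPowerSeries.rename_id_apply f

theorem diag_atT' (f : Fn K) : diag (atT' f) = f := by
  rw [diag, atT'_eq, MvPowerSeries.rename_rename]
  exact MvPowerSeries.rename_id_apply f

theorem diag_eq_subst (f : Fn2 K) : diag f =
    MvPowerSeries.subst (MvPowerSeries.X ∘ (Sum.elim id id : ℕ ⊕ ℕ → ℕ)) f :=
  MvPowerSeries.rename_eq_subst _ f

/-- For a monomial `e` in the times `t'` alone, no other monomial of `f` contributes to the image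
of `e` under restriction to the diagonal, if `f` has no monomials of that degree that involve
`t`. -/
theorem coeff_diag (f : Fn2 K) (e : ℕ ⊕ ℕ →₀ ℕ) (he : ∀ i, e (Sum.inl i) = 0)
    (h : ∀ e' : ℕ ⊕ ℕ →₀ ℕ, e'.degree = e.degree → (∃ i, e' (Sum.inl i) ≠ 0) →
      MvPowerSeries.coeff e' f = 0) :
    MvPowerSeries.coeff (e.mapDomain (Sum.elim id id)) (diag f) = MvPowerSeries.coeff e f := by
  rw [diag, MvPowerSeries.coeff_rename]
  refine Finset.sum_eq_single e (fun e' he' hne => ?_) (fun hn => absurd ?_ hn)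
  · simp only [Set.Finite.mem_toFinset, Set.mem_preimage, Set.mem_singleton_iff] at he'
    refine h e' ?_ ?_
    · have := congrArg Finsupp.degree he'
      rwa [Finsupp.degree_mapDomain, Finsupp.degree_mapDomain] at this
    · by_contra hcon
      push Not at hcon
      apply hne
      have key : ∀ g : ℕ ⊕ ℕ →₀ ℕ, (∀ i, g (Sum.inl i) = 0) → ∀ j,
          (g.mapDomain (Sum.elim id id : ℕ ⊕ ℕ → ℕ)) j = g (Sum.inr j) := by
        intro g hg j
        have hg' : g = (g.comapDomain Sum.inr Sum.inr_injective.injOn).mapDomain Sum.inr := by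
          ext (i | i)
          · rw [hg, Finsupp.mapDomain_of_notMem_range _ _ (by simp)]
          · rw [Finsupp.mapDomain_apply Sum.inr_injective, Finsupp.comapDomain_apply]
        conv_lhs => rw [hg', ← Finsupp.mapDomain_comp]
        have : (Sum.elim id id : ℕ ⊕ ℕ → ℕ) ∘ Sum.inr = id := rfl
        rw [this, Finsupp.mapDomain_id, Finsupp.comapDomain_apply]
      ext (i | i)
      · rw [he, hcon]
      · rw [← key e' hcon, ← key e he, he']
  · simp

/-- A set of functions of `(t, t')` that is stable under all `∂_{t_n}` and vanishes on the diagonal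
is trivial, by Taylor's formula. -/
theorem eq_zero_of_diag_eq_zero [CharZero K] {M : Set (Fn2 K)} (hM : ∀ G ∈ M, ∀ i, dT i G ∈ M)
    (h0 : ∀ G ∈ M, diag G = 0) {G : Fn2 K} (hG : G ∈ M) : G = 0 := by
  -- by induction on the degree: monomials that involve `t` are reached by differentiation, and
  -- then those in `t'` alone by restriction to the diagonal
  suffices h : ∀ N : ℕ, ∀ G ∈ M, ∀ e : ℕ ⊕ ℕ →₀ ℕ, e.degree = N → MvPowerSeries.coeff e G = 0 by
    ext e
    exact h _ G hG e rfl
  intro N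
  induction N using Nat.strong_induction_on with
  | _ N ih =>
    intro G hG e he
    have h1 : ∀ e' : ℕ ⊕ ℕ →₀ ℕ, e'.degree = e.degree → (∃ i, e' (Sum.inl i) ≠ 0) →
        MvPowerSeries.coeff e' G = 0 := by
      rintro e' he' ⟨i, hi⟩
      have hle : Finsupp.single (Sum.inl i) 1 ≤ e' := by
        rw [Finsupp.single_le_iff]
        omega
      obtain ⟨c, rfl⟩ := exists_add_of_le hle
      rw [map_add, Finsupp.degree_single] at he'
      have h2 := ih c.degree (by omega) _ (hM G hG i) c rfl
      rw [MvPowerSeries.coeff_pderiv, add_comm c] at h2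
      refine (mul_eq_zero.mp h2).resolve_right ?_
      exact Nat.cast_add_one_ne_zero _
    by_cases h : ∃ i, e (Sum.inl i) ≠ 0
    · exact h1 e rfl h
    · push Not at h
      rw [← coeff_diag G e h h1, h0 G hG, map_zero]

/-! ### The pairing `Res_λ P(e^ξ)(t,λ) Q(e^ξ)(t',-λ)` -/

/-- The weight `2i+1` of the time `t_{2i+1}`. -/
def wt (i : ℕ) : ℕ := 2 * i + 1

section Times

theorem pderiv_timeT (l j : ℕ) :
    MvPowerSeries.pderiv K l (timeT j) = if j = l then 1 else 0 := by
  rw [timeT]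
  split_ifs with h
  · rw [h, MvPowerSeries.pderiv_X_self]
  · rw [MvPowerSeries.pderiv_X_of_ne h]

theorem dT_timeDiff (l j : ℕ) : dT (K := K) l (timeDiff j) = if j = l then 1 else 0 := by
  rw [timeDiff, map_sub, MvPowerSeries.pderiv_X_of_ne (by simp : (Sum.inr j : ℕ ⊕ ℕ) ≠ Sum.inl l),
    sub_zero]
  split_ifs with h
  · rw [h, MvPowerSeries.pderiv_X_self]
  · rw [MvPowerSeries.pderiv_X_of_ne (by simpa using h)]

theorem symbol_coeff (P : PDO K) (m : ℤ) : P.symbol.coeff m = P.coeff (-m) := by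
  rw [PDO.coeff, neg_neg]

theorem le_weightedOrder_X {σ : Type*} (w : σ → ℕ) (i : σ) :
    (w i : ℕ∞) ≤ (MvPowerSeries.X i : MvPowerSeries σ K).weightedOrder w := by
  classical
  refine MvPowerSeries.nat_le_weightedOrder w fun d hd => ?_
  rw [MvPowerSeries.coeff_X, if_neg]
  rintro rfl
  rw [Finsupp.weight_single, one_smul] at hd
  exact lt_irrefl _ hd

theorem isTimes_timeT : IsTimes (K := K) wt timeT := fun i => le_weightedOrder_X wt i

theorem isTimes_timeDiff : IsTimes (K := K) (Sum.elim wt wt) timeDiff := fun i => by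
  rw [timeDiff, sub_eq_add_neg]
  refine le_trans (le_min ?_ ?_) (MvPowerSeries.min_weightedOrder_le_add _)
  · exact le_weightedOrder_X (Sum.elim wt wt) (Sum.inl i)
  · rw [MvPowerSeries.weightedOrder_neg]
    exact le_weightedOrder_X (Sum.elim wt wt) (Sum.inr i)

theorem coeff_lAtT (P : PDO K) (m : ℤ) : (lAtT P.symbol).coeff m = atT (P.coeff (-m)) := by
  rw [lAtT, HahnSeries.map_coeff, symbol_coeff]

theorem coeff_negLam_lAtT' (Q : PDO K) (m : ℤ) :
    (negLam (lAtT' Q.symbol)).coeff m = (Int.negOnePow m : ℤ) • atT' (Q.coeff (-m)) := by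
  change (Int.negOnePow m : ℤ) • (lAtT' Q.symbol).coeff m = _
  rw [lAtT', HahnSeries.map_coeff, symbol_coeff]

theorem lAtT_add (P Q : PDO K) : lAtT (P + Q).symbol = lAtT P.symbol + lAtT Q.symbol := by
  ext m : 2
  rw [HahnSeries.coeff_add, coeff_lAtT, coeff_lAtT, coeff_lAtT, PDO.coeff_add, map_add]

theorem lAtT_mul_del (P : PDO K) (n : ℕ) :
    lAtT (P * PDO.del n).symbol = lam ^ n * lAtT P.symbol := by
  ext m : 2
  rw [lam, HahnSeries.single_pow, one_pow, HahnSeries.coeff_single_mul, one_mul, coeff_lAtT,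
    coeff_lAtT, PDO.coeff_mul_del]
  congr 2
  simp
  ring

variable [CharZero K]

/-- `∂_{t_n} P(e^ξ) = (P_{t_n} + P ∂^n)(e^ξ)`. -/
theorem dt_expCoeff (i : ℕ) (P : PDO K) (j : ℤ) :
    dt i (expCoeff timeT P.symbol j) =
      expCoeff timeT (P.flow i + P * PDO.del (2 * i + 1)).symbol j := by
  refine derivation_expCoeff isTimes_timeT i i 1 (pderiv_timeT i) (fun m => ?_) j
  rw [symbol_coeff, symbol_coeff, symbol_coeff, PDO.coeff_add, PDO.flow_coeff, PDO.coeff_mul_del,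
    one_mul]
  congr 2
  push_cast
  ring

theorem map_coeff_mul_of_eq_zero {R : Type*} [CommRing R] {S : Type*} [CommRing S] [Algebra S R]
    (D : Derivation S R R) {A A' B : LaurentSeries R} (hA : ∀ n, D (A.coeff n) = A'.coeff n)
    (hB : ∀ n, D (B.coeff n) = 0) (m : ℤ) : D ((A * B).coeff m) = (A' * B).coeff m := by
  rw [HahnSeries.coeff_mul, HahnSeries.coeff_mul_left' A.isPWO_support (x := A'), map_sum]
  · refine Finset.sum_congr rfl fun p _ => ?_
    rw [Derivation.leibniz, hB, smul_zero, zero_add, hA, smul_eq_mul, mul_comm]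
  · intro n hn h0
    apply hn
    rw [← hA, h0, map_zero]

/-- `Res_λ P(e^ξ)(t,λ) Q(e^ξ)(t',-λ)`. -/
def pair (P Q : PDO K) : Fn2 K := resExp (lAtT P.symbol * negLam (lAtT' Q.symbol))

theorem pair_add (P P' Q : PDO K) : pair (P + P') Q = pair P Q + pair P' Q := by
  rw [pair, lAtT_add, add_mul]
  exact expCoeff_add isTimes_timeDiff _ _ _

/-- The pairing as an additive map of its first argument. -/
def pairHom (Q : PDO K) : PDO K →+ Fn2 K := AddMonoidHom.mk' (fun P => pair P Q)
  fun P P' => pair_add P P' Q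

theorem pair_sub (P P' Q : PDO K) : pair (P - P') Q = pair P Q - pair P' Q :=
  map_sub (pairHom Q) P P'

theorem pair_fn_mul (f : Fn K) (P Q : PDO K) : pair (PDO.fn f * P) Q = atT f * pair P Q := by
  refine (mul_expCoeff isTimes_timeDiff _ (fun n => ?_) _).symm
  have h : lAtT (PDO.fn f * P).symbol = HahnSeries.single 0 (atT f) * lAtT P.symbol := by
    ext m : 2
    rw [HahnSeries.coeff_single_mul, coeff_lAtT, coeff_lAtT, PDO.coeff_fn_mul, map_mul, sub_zero]
  rw [h, mul_assoc, HahnSeries.coeff_single_mul, sub_zero]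

/-- `∂_{t_n}` acts on the pairing through its first argument, by `P ↦ P_{t_n} + P ∂^n`. -/
theorem dT_pair (i : ℕ) (P Q : PDO K) :
    dT i (pair P Q) = pair (P.flow i + P * PDO.del (2 * i + 1)) Q := by
  refine derivation_expCoeff isTimes_timeDiff (Sum.inl i) i 1 (dT_timeDiff i) (fun m => ?_) (-1)
  have e : ((2 * i + 1 : ℕ) : ℤ) = 2 * i + 1 := by push_cast; ring
  rw [lAtT_add, add_mul, HahnSeries.coeff_add, ← e, lAtT_mul_del, one_mul]
  congr 1
  · symm
    refine map_coeff_mul_of_eq_zero _ (fun n => ?_) (fun n => ?_) m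
    · rw [coeff_lAtT, coeff_lAtT, dT_atT, PDO.flow_coeff]
    · rw [coeff_negLam_lAtT', map_zsmul, dT_atT', smul_zero]
  · rw [mul_assoc, lam, HahnSeries.single_pow, one_pow, HahnSeries.coeff_single_mul, one_mul]
    congr 1
    simp
    ring

theorem dT_zero_pair (P Q : PDO K) : dT 0 (pair P Q) = pair (PDO.del 1 * P) Q := by
  rw [dT_pair, PDO.flow_zero_eq]
  simp

/-- On the diagonal `e^{ξ(t-t',λ)} = 1`. -/
theorem diag_expXi_timeDiff (N : ℕ) :
    diag (K := K) (PowerSeries.coeff N (expXi timeDiff)) = if N = 0 then 1 else 0 := by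
  have hE : PowerSeries.map (diag (K := K)).toRingHom (expXi timeDiff) = 1 := by
    refine eq_of_derivative_eq_mul (g := 0) ?_ ?_ ?_
    · ext1 n
      have h := congrArg (PowerSeries.map (diag (K := K)).toRingHom) (derivative_expXi timeDiff)
      have hz : PowerSeries.map (diag (K := K)).toRingHom (PowerSeries.derivative _
          (xi timeDiff)) = 0 := by
        ext1 m
        rw [PowerSeries.coeff_map, coeff_derivative_xi, map_zero]
        split_ifs
        · rw [map_nsmul]
          have : (diag (K := K)).toRingHom (timeDiff (m / 2)) = 0 := by
            change diag (timeDiff (m / 2)) = 0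
            rw [timeDiff, map_sub, diag, MvPowerSeries.rename_X, MvPowerSeries.rename_X]
            simp
          rw [this, smul_zero]
        · rw [map_zero]
      rw [map_mul, hz, mul_zero] at h
      have := congrArg (PowerSeries.coeff n) h
      rw [PowerSeries.coeff_map, PowerSeries.coeff_derivative, map_mul] at this
      rw [mul_zero, PowerSeries.coeff_derivative, PowerSeries.coeff_map]
      rw [← this]
      congr 1
      simp
    · simp
    · rw [← PowerSeries.coeff_zero_eq_constantCoeff_apply, PowerSeries.coeff_map,
        PowerSeries.coeff_zero_eq_constantCoeff_apply, constantCoeff_expXi]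
      simp
  have := congrArg (PowerSeries.coeff N) hE
  rw [PowerSeries.coeff_map, PowerSeries.coeff_one] at this
  exact this

theorem diag_resExp (A : LaurentSeries (Fn2 K)) : diag (resExp A) = diag (A.coeff 1) := by
  ext d
  rw [resExp, diag_eq_subst, coeff_subst_expCoeff isTimes_timeDiff (w' := wt)
    (MvPowerSeries.HasSubst.X_comp _) ?_ A (-1) (Nat.lt_succ_self _)]
  · simp only [← diag_eq_subst, diag_expXi_timeDiff, mul_ite, mul_one, mul_zero]
    rw [Finset.sum_ite_eq', if_pos (by simp)]
    simp
  · rintro (i | i)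
    · exact le_weightedOrder_X wt i
    · exact le_weightedOrder_X wt i

/-- On the diagonal the pairing is the residue `Res_∂ (P Q^*)`. -/
theorem diag_pair (P Q : PDO K) : diag (pair P Q) = (P * Q.adj).res := by
  obtain ⟨N, hQ⟩ := Q.exists_ordLE
  rw [pair, diag_resExp]
  -- both sides are additive in `P` and vanish for `P` of sufficiently negative order
  obtain ⟨s, R, hR, hP⟩ := P.exists_eq_sum_monomial_add (-N - 2)
  let F : PDO K →+ Fn K := AddMonoidHom.mk'
    (fun P => diag ((lAtT P.symbol * negLam (lAtT' Q.symbol)).coeff 1)) fun P P' => by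
      rw [lAtT_add, add_mul, HahnSeries.coeff_add, map_add]
  let G : PDO K →+ Fn K := (PDO.coeffHom (-1)).comp (PDO.mulHom.flip Q.adj)
  change F P = G P
  rw [hP, map_add, map_add, map_sum, map_sum]
  congr 1
  · refine Finset.sum_congr rfl fun n _ => ?_
    generalize P.coeff n = a
    change diag ((lAtT (PDO.monomial n a).symbol * negLam (lAtT' Q.symbol)).coeff 1) =
      (PDO.monomial n a * Q.adj).res
    have h : lAtT (PDO.monomial n a).symbol = HahnSeries.single (-n) (atT a) := by
      ext m : 2
      rw [coeff_lAtT, PDO.coeff_monomial]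
      by_cases hm : m = -n
      · rw [if_pos (by omega), hm, HahnSeries.coeff_single_same]
      · rw [if_neg (by omega), HahnSeries.coeff_single_of_ne hm, map_zero]
    rw [h, HahnSeries.coeff_single_mul, coeff_negLam_lAtT', map_mul, diag_atT, map_zsmul,
      diag_atT', PDO.monomial_mul_eq, PDO.res, PDO.coeff_fn_mul]
    congr 1
    have h2 : PDO.del n * Q.adj = (Int.negOnePow n : ℤ) • (Q * PDO.del n).adj := by
      rw [PDO.adj_mul, PDO.adj_del, smul_mul_assoc, smul_smul, ← Units.val_mul,
        Int.units_mul_self, Units.val_one, one_smul]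
    have h3 := PDO.res_adj (Q * PDO.del n)
    rw [PDO.res, PDO.res, PDO.coeff_mul_del] at h3
    rw [h2, PDO.coeff_zsmul, h3, sub_neg_eq_add, add_comm 1 n, Int.negOnePow_succ, Units.val_neg,
      neg_smul, smul_neg]
    congr 3
    ring
  · have h1 : F R = 0 := by
      change diag ((lAtT R.symbol * negLam (lAtT' Q.symbol)).coeff 1) = 0
      rw [HahnSeries.coeff_mul, Finset.sum_eq_zero, map_zero]
      intro p hp
      have hp1 := (Finset.mem_antidiagonal.mp hp).2.2
      rw [coeff_lAtT, coeff_negLam_lAtT']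
      rcases lt_or_ge (-N - 2) (-p.1) with h | h
      · rw [hR _ h, map_zero, zero_mul]
      · rw [hQ _ (by omega), map_zero, smul_zero, mul_zero]
    rw [h1]
    exact (hR.mul hQ.adj (-1) (by omega)).symm

end Times

/-! ### Bilinear identities and the hierarchy -/

namespace PDO

theorem coeff_mul_of_ordLE {P Q : PDO K} {M N : ℤ} (hP : P.OrdLE M) (hQ : Q.OrdLE N) :
    (P * Q).coeff (M + N) = P.coeff M * Q.coeff N := by
  rw [coeff_mul_eq_sum hP hQ, add_sub_cancel_right, Finset.Icc_self, sub_self, zero_add,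
    Int.toNat_one, Finset.range_one, Finset.singleton_product_singleton, Finset.sum_singleton]
  simp

/-- The leading coefficient of `P f` is that of `P` times `f`. -/
theorem mul_fn_eq_zero {P : PDO K} {f : Fn K} (h : P * fn f = 0) (hf : f ≠ 0) : P = 0 := by
  obtain ⟨N, hP⟩ := P.exists_ordLE
  refine eq_zero_of_ordLE (c := N) fun n => ?_
  induction n with
  | zero => simpa using hP
  | succ n ih =>
    have h1 := coeff_mul_of_ordLE ih (ordLE_monomial 0 f)
    rw [h, coeff_zero', coeff_monomial, if_pos rfl] at h1
    intro i hi
    rcases eq_or_ne i (N - n) with rfl | hne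
    · exact (mul_eq_zero.mp h1.symm).resolve_right hf
    · exact ih i (by push_cast at hi; omega)

theorem IsDiff.res_eq_zero {P : PDO K} (hP : P.IsDiff) : P.res = 0 := hP _ (by decide)

theorem res_add (P Q : PDO K) : (P + Q).res = P.res + Q.res := rfl

theorem res_sub (P Q : PDO K) : (P - Q).res = P.res - Q.res := coeff_sub P Q _

theorem res_mul_fn (P : PDO K) (f : Fn K) : (P * fn f).res = P.res * f := by
  have h : P * fn f = P.nonneg * fn f + P.neg * fn f := by rw [← add_mul, nonneg_add_neg]
  rw [h, res_add, (P.isDiff_nonneg.mul (isDiff_monomial le_rfl f)).res_eq_zero, zero_add, res]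
  have := coeff_mul_of_ordLE (ordLE_neg P) (ordLE_monomial 0 f)
  rw [add_zero, coeff_monomial, if_pos rfl, neg_coeff, if_pos (by decide)] at this
  exact this

/-- An integral operator `X` is determined by the residues of `∂^l X`. -/
theorem eq_zero_of_res_del_mul {X : PDO K} (hX : X.OrdLE (-1))
    (h : ∀ l : ℕ, (del l * X).res = 0) : X = 0 := by
  refine eq_zero_of_ordLE (c := -1) fun n => ?_
  induction n with
  | zero => simpa using hX
  | succ n ih =>
    have h1 := coeff_mul_of_ordLE (ordLE_monomial (n : ℤ) 1) ih
    rw [show (n : ℤ) + (-1 - n) = -1 by ring, coeff_monomial, if_pos rfl, one_mul] at h1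
    intro i hi
    rcases eq_or_ne i (-1 - n) with rfl | hne
    · exact h1.symm.trans (h n)
    · exact ih i (by push_cast at hi; omega)

theorem fn_neg (f : Fn K) : fn (-f) = -fn f := monomial_neg 0 f

theorem fn_zero : fn (0 : Fn K) = 0 := monomial_zero 0

theorem app_add (P Q : PDO K) (f : Fn K) : (P + Q).app f = P.app f + Q.app f := by
  rw [← coeff_zero_mul_fn, add_mul, coeff_add, coeff_zero_mul_fn, coeff_zero_mul_fn]

theorem app_map_neg (P : PDO K) (f : Fn K) : P.app (-f) = -P.app f := by
  rw [← coeff_zero_mul_fn, fn_neg, mul_neg, coeff_neg, coeff_zero_mul_fn]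

theorem one_app (f : Fn K) : (1 : PDO K).app f = f := by
  rw [← coeff_zero_mul_fn, one_mul, coeff_monomial, if_pos rfl]

/-- The term of order `0` of `C X` only depends on that of `X`, as `X - X_0 = Y ∂`. -/
theorem coeff_zero_mul {C X : PDO K} (hC : C.IsDiff) (hX : X.IsDiff) :
    (C * X).coeff 0 = C.app (X.coeff 0) := by
  set Y := (X - fn (X.coeff 0)) * del (-1) with hY
  have hYd : Y.IsDiff := fun i hi => by
    rw [hY, coeff_mul_del, coeff_sub, coeff_monomial]
    split_ifs with h
    · rw [h, sub_self]
    · rw [hX _ (by omega), sub_zero]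
  have hXY : X = Y * del 1 + fn (X.coeff 0) := by
    rw [hY, mul_assoc, del_mul_del, neg_add_cancel, del_zero, mul_one, sub_add_cancel]
  conv_lhs => rw [hXY]
  rw [mul_add, coeff_add, ← mul_assoc, coeff_mul_del, hC.mul hYd _ (by decide), zero_add,
    coeff_zero_mul_fn]

theorem app_mul {C P : PDO K} (hC : C.IsDiff) (hP : P.IsDiff) (f : Fn K) :
    (C * P).app f = C.app (P.app f) := by
  rw [← coeff_zero_mul_fn, mul_assoc, coeff_zero_mul hC (hP.mul (isDiff_monomial le_rfl f)),
    coeff_zero_mul_fn]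

theorem dt_app (i : ℕ) (P : PDO K) (f : Fn K) :
    dt i (P.app f) = (P.flow i).app f + P.app (dt i f) := by
  rw [← coeff_zero_mul_fn, ← flow_coeff, flow_mul, coeff_add, flow_monomial, coeff_zero_mul_fn,
    coeff_zero_mul_fn]

theorem IsDiff.eq_sum {C : PDO K} (hC : C.IsDiff) {M : ℕ} (hM : C.OrdLE (M - 1)) :
    C = ∑ l ∈ Finset.range M, fn (C.coeff l) * del l := by
  ext1 i
  rw [coeff_sum]
  simp only [fn_mul_del, coeff_monomial]
  rcases lt_or_ge i 0 with h | h
  · rw [hC i h, Finset.sum_eq_zero]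
    intro l _
    rw [if_neg (by omega)]
  · lift i to ℕ using h
    simp only [Nat.cast_inj]
    rw [Finset.sum_ite_eq]
    split_ifs with h1
    · rfl
    · rw [hM]
      rw [Finset.mem_range] at h1
      omega

theorem isDiff_flow {P : PDO K} (hP : P.IsDiff) (i : ℕ) : (P.flow i).IsDiff := fun n hn => by
  rw [flow_coeff, hP n hn, dt_zero]

theorem isDiff_add {P Q : PDO K} (hP : P.IsDiff) (hQ : Q.IsDiff) : (P + Q).IsDiff := fun n hn => by
  rw [coeff_add, hP n hn, hQ n hn, add_zero]

theorem del_natCast_mul (l : ℕ) : (del ((l + 1 : ℕ) : ℤ) : PDO K) = del 1 * del l := by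
  rw [del_mul_del, add_comm]
  push_cast
  rfl

end PDO

section Bilinear

open PDO

theorem IsMonic.ordLE {W : PDO K} (h : IsMonic W) : W.OrdLE 0 := h.2

theorem isDiff_B (L : PDO K) (i : ℕ) : (B L i).IsDiff := isDiff_nonneg _

theorem B_add_neg (L : PDO K) (i : ℕ) : B L i + (L ^ (2 * i + 1)).neg = L ^ (2 * i + 1) :=
  nonneg_add_neg _

theorem IsDressing.mul_eq {L W : PDO K} (h : IsDressing L W) : L * W = W * del 1 := by
  obtain ⟨V, -, hVW, rfl⟩ := h
  rw [mul_assoc, hVW, mul_one]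

theorem IsDressing.pow_mul_eq {L W : PDO K} (h : IsDressing L W) (n : ℕ) :
    L ^ n * W = W * del n := by
  induction n with
  | zero => exact (one_mul W).trans (mul_one W).symm
  | succ n ih => rw [pow_succ', mul_assoc, ih, ← mul_assoc, h.mul_eq, mul_assoc, ← del_natCast_mul]

theorem IsDressing.pow_odd_mul_eq {L W : PDO K} (h : IsDressing L W) (i : ℕ) :
    L ^ (2 * i + 1) * W = W * del (2 * i + 1) := by
  have := h.pow_mul_eq (2 * i + 1)
  push_cast at this
  exact this

theorem IsCKPWave.inv_eq {L W : PDO K} (h : IsCKPWave L W) : L = W * del 1 * W.adj := by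
  rw [← h.dressing.mul_eq, mul_assoc, h.mul_adj, mul_one]

/-- In terms of the wave function: `∂_{t_n} ψ = (L^n)_{≥0}(ψ)`. -/
theorem IsCKPWave.flow_add {L W : PDO K} (h : IsCKPWave L W) (i : ℕ) :
    W.flow i + W * del (2 * i + 1) = B L i * W := by
  rw [h.sato, ← h.dressing.pow_odd_mul_eq, neg_add_eq_sub, ← sub_mul]
  congr 1
  rw [sub_eq_iff_eq_add, B_add_neg]

theorem commute_pow (L : PDO K) (n : ℕ) : L ^ n * L = L * L ^ n := (pow_mul_comm' L n)

theorem IsCKPLax.B_zero {L : PDO K} (h : IsCKPLax L) : B L 0 = del 1 := by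
  ext1 i
  have hp : L ^ (2 * 0 + 1) = L := pow_one L
  rw [B, hp, nonneg_coeff, coeff_monomial]
  rcases lt_trichotomy i 1 with h1 | rfl | h1
  · rw [if_neg (by omega : ¬ i = 1)]
    split_ifs with h2
    · rw [show i = 0 by omega, h.coeff_zero]
    · rfl
  · rw [if_pos (by decide), if_pos rfl, h.coeff_one]
  · rw [if_neg (by omega : ¬ i = 1), h.coeff_of_gt i h1, ite_self]

theorem Omega_adj (q : Fn K) (W : PDO K) : (Omega q W).adj = -(W.adj * fn q * del (-1)) := by
  rw [Omega, mul_assoc, adj_mul, adj_mul, adj_fn, adj_del, Int.negOnePow_neg, Int.negOnePow_one]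
  simp [mul_assoc]

/-- The right-hand side `∑ (q_{1,i} ∂⁻¹ q_{2,i} - (-1)^k q_{2,i} ∂⁻¹ q_{1,i})` of the constraint. -/
def source (k : ℕ) {m : ℕ} (q : Fin 2 → Fin m → Fn K) : PDO K := ∑ i : Fin m,
    (PDO.fn (q 0 i) * PDO.del (-1) * PDO.fn (q 1 i)
      - ((-1 : ℤ) ^ k) • (PDO.fn (q 1 i) * PDO.del (-1) * PDO.fn (q 0 i)))

theorem ordLE_source (k : ℕ) {m : ℕ} (q : Fin 2 → Fin m → Fn K) : (source k q).OrdLE (-1) := by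
  intro i hi
  rw [source, coeff_sum]
  refine Finset.sum_eq_zero fun j _ => ?_
  have h : ∀ f g : Fn K, (fn f * del (-1) * fn g).coeff i = 0 := fun f g =>
    ((ordLE_monomial 0 f).mul (ordLE_monomial (-1) 1)).mul (ordLE_monomial 0 g) i (by omega)
  rw [coeff_sub, coeff_zsmul, h, h, smul_zero, sub_zero]

theorem res_mul_source (k : ℕ) {m : ℕ} (q : Fin 2 → Fin m → Fn K) (C : PDO K) :
    (C * source k q).res =
      ∑ i : Fin m, (C.app (q 0 i) * q 1 i - (-1) ^ k * (C.app (q 1 i) * q 0 i)) := by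
  rw [source, Finset.mul_sum, PDO.res, coeff_sum]
  refine Finset.sum_congr rfl fun i _ => ?_
  have h : ∀ f g : Fn K, (C * (fn f * del (-1) * fn g)).coeff (-1) = C.app f * g := fun f g => by
    rw [← mul_assoc, ← mul_assoc]
    exact (res_mul_fn _ _).trans (by rw [res_mul_fn_mul_del])
  rw [mul_sub, mul_smul_comm, coeff_sub, coeff_zsmul, h, h, zsmul_eq_mul]
  push_cast
  rfl

variable [CharZero K]

theorem IsCKPWave.isCKPLax {L W : PDO K} (h : IsCKPWave L W) : IsCKPLax L := by
  have hW := h.monic.ordLE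
  have hL : L.OrdLE 1 := by
    rw [h.inv_eq]
    exact ((hW.mul (ordLE_monomial 1 1)).mul hW.adj).mono (by decide)
  have hadj : L.adj = -L := by
    conv_lhs => rw [h.inv_eq]
    conv_rhs => rw [h.inv_eq]
    rw [PDO.adj_mul, PDO.adj_mul, adj_adj, adj_del, Int.negOnePow_one]
    simp [mul_assoc]
  have hc : L.coeff 1 = 1 := by
    have h1 := congrArg (fun P => PDO.coeff P 1) h.dressing.mul_eq
    have h2 := coeff_mul_of_ordLE hL hW
    rw [add_zero, h.monic.1, mul_one] at h2
    simp only [coeff_mul_del, sub_self, h.monic.1] at h1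
    rw [← h2, h1]
  refine ⟨hc, ?_, fun i hi => hL i hi, hadj, fun i => ?_⟩
  · -- the coefficients of `∂^0` in `L^* = -L` give `L_0 = -L_0`
    have h1 := congrArg (fun P => PDO.coeff P 0) hadj
    simp only [PDO.coeff_neg] at h1
    rw [coeff_adj_eq_sum hL 0 (M := 2) (by decide), Finset.sum_range_succ, Finset.sum_range_one]
      at h1
    simp [hc] at h1
    have h2 : (2 : ℕ) • L.coeff 0 = 0 := by
      rw [two_nsmul]
      nth_rewrite 1 [h1]
      exact neg_add_cancel _
    exact (nsmul_right_inj two_ne_zero).mp (h2.trans (nsmul_zero 2).symm)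
  · -- differentiate `L W = W ∂` and cancel `W`
    have h1 := congrArg (PDO.flow i) h.dressing.mul_eq
    rw [flow_mul, flow_mul, flow_del, mul_zero, add_zero] at h1
    have e : W.flow i = B L i * W - L ^ (2 * i + 1) * W := by
      rw [h.dressing.pow_odd_mul_eq, ← h.flow_add, add_sub_cancel_right]
    rw [e] at h1
    have e2 : (B L i * W - L ^ (2 * i + 1) * W) * del 1 =
        B L i * (L * W) - L * (L ^ (2 * i + 1) * W) := by
      rw [sub_mul, mul_assoc, mul_assoc, ← h.dressing.mul_eq, ← mul_assoc (L ^ _), commute_pow,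
        mul_assoc L]
    have h2 : L.flow i * W = (B L i * L - L * B L i) * W := by
      rw [eq_sub_of_add_eq h1, e2, sub_mul, mul_sub, mul_assoc, mul_assoc]
      abel
    rw [← mul_one (L.flow i), ← h.mul_adj, ← mul_assoc, h2, mul_assoc, h.mul_adj, mul_one]

/-! #### The first identity -/

/-- The result of applying the differential operator `C` in the variable `t` to the difference of
the two sides of the first bilinear identity, when `∂_{t_n}` acts by `(L^n)_{≥0}`. -/
def defect (k : ℕ) {m : ℕ} (W : PDO K) (q : Fin 2 → Fin m → Fn K) (C : PDO K) : Fn2 K :=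
  pair (C * (W * del k)) W -
    ∑ i : Fin m, (atT (C.app (q 0 i)) * atT' (q 1 i)
      - (-1) ^ k * (atT (C.app (q 1 i)) * atT' (q 0 i)))

theorem bilinear1_iff (k : ℕ) {m : ℕ} (W : PDO K) (q : Fin 2 → Fin m → Fn K) :
    Bilinear1 k W q ↔ defect k W q 1 = 0 := by
  rw [Bilinear1, defect, sub_eq_zero, pair, one_mul, lAtT_mul_del]
  simp only [one_app]

/-- `∂_{t_n}` turns the defect for `C` into the one for `C_{t_n} + C (L^n)_{≥0}`. -/
theorem dT_defect {k : ℕ} {m : ℕ} {L W : PDO K} {q : Fin 2 → Fin m → Fn K} (hW : IsCKPWave L W)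
    (hq : ∀ a i, IsEigenfunction L (q a i)) {C : PDO K} (hC : C.IsDiff) (i : ℕ) :
    dT i (defect k W q C) = defect k W q (C.flow i + C * B L i) := by
  have h1 : (C * (W * del k)).flow i + C * (W * del k) * del (2 * i + 1) =
      (C.flow i + C * B L i) * (W * del k) := by
    rw [flow_mul, flow_mul, flow_del, mul_zero, add_zero, add_mul, mul_assoc C (B L i),
      ← mul_assoc (B L i), ← hW.flow_add, mul_assoc C, mul_assoc W, del_mul_del,
      add_comm (k : ℤ), ← del_mul_del, add_mul, mul_add C, mul_assoc W (del (2 * (i : ℤ) + 1))]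
    abel
  have h2 : ∀ a j, dt i (C.app (q a j)) = (C.flow i + C * B L i).app (q a j) := fun a j => by
    rw [dt_app, hq a j i, PDO.app_add, app_mul hC (isDiff_B L i)]
  rw [defect, map_sub, dT_pair, h1, defect, map_sum]
  congr 1
  refine Finset.sum_congr rfl fun j _ => ?_
  have h3 : ∀ f g : Fn K, dT i (atT f * atT' g) = atT (dt i f) * atT' g := fun f g => by
    rw [Derivation.leibniz, dT_atT', smul_zero, zero_add, dT_atT, smul_eq_mul, mul_comm]
  have h4 : ∀ G : Fn2 K, dT i ((-1) ^ k * G) = (-1) ^ k * dT i G := fun G => by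
    rcases neg_one_pow_eq_or (Fn2 K) k with h | h <;> simp [h]
  rw [map_sub, h4, h3, h3, h2, h2]

theorem diag_defect {k : ℕ} {m : ℕ} {L W : PDO K} (q : Fin 2 → Fin m → Fn K) (hW : IsCKPWave L W)
    {C : PDO K} (hC : C.IsDiff) :
    diag (defect k W q C) = (C * ((L ^ k).neg - source k q)).res := by
  have h1 : (C * (W * del k) * W.adj).res = (C * (L ^ k).neg).res := by
    rw [← hW.dressing.pow_mul_eq, mul_assoc, mul_assoc, hW.mul_adj, mul_one]
    conv_lhs => rw [← nonneg_add_neg (L ^ k), mul_add, res_add,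
      (hC.mul (isDiff_nonneg _)).res_eq_zero, zero_add]
  rw [defect, map_sub, diag_pair, h1, mul_sub, res_sub, res_mul_source, map_sum]
  simp only [map_sub, map_mul, map_pow, map_neg, map_one, diag_atT, diag_atT']

/-- On the diagonal the defects are the residues of `C ((L^k)_{<0} - source)`. If all of them
vanish, so does the integral operator `(L^k)_{<0} - source`; if it vanishes, the defects form a
set that is stable under `∂_{t_n}` and zero on the diagonal. -/
theorem IsCKPWave.bilinear1_iff_constraint {k : ℕ} {m : ℕ} {L W : PDO K}
    {q : Fin 2 → Fin m → Fn K} (hW : IsCKPWave L W) (hq : ∀ a i, IsEigenfunction L (q a i)) :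
    Bilinear1 k W q ↔ (L ^ k).neg = source k q := by
  rw [bilinear1_iff]
  constructor
  · intro h
    refine sub_eq_zero.mp (eq_zero_of_res_del_mul ((ordLE_neg _).sub (ordLE_source k q))
      fun l => ?_)
    have hl : defect k W q (del l) = 0 := by
      induction l with
      | zero => exact h
      | succ l ih =>
        have := dT_defect (k := k) hW hq (isDiff_monomial (by omega : (0 : ℤ) ≤ l) 1) 0
        rw [ih, map_zero, hW.isCKPLax.B_zero, flow_del, zero_add, del_mul_del] at this
        rw [this]
        push_cast
        rfl
    rw [← diag_defect q hW (isDiff_monomial (by omega) 1), hl, map_zero]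
  · intro h
    refine eq_zero_of_diag_eq_zero (M := {G | ∃ C : PDO K, C.IsDiff ∧ G = defect k W q C}) ?_ ?_
      ⟨1, isDiff_monomial le_rfl 1, rfl⟩
    · rintro _ ⟨C, hC, rfl⟩ i
      exact ⟨_, isDiff_add (isDiff_flow hC i) (hC.mul (isDiff_B L i)), dT_defect hW hq hC i⟩
    · rintro _ ⟨C, hC, rfl⟩
      rw [diag_defect q hW hC, h, sub_self, mul_zero]
      rfl

/-! #### The second identity -/

/-- If the pairing of `P` with `Q` is a function of `t` alone, then so is that of `C P`. -/
theorem pair_mul_of_pair_eq {P Q : PDO K} {g : Fn K} (h : pair P Q = atT g) {C : PDO K}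
    (hC : C.IsDiff) : pair (C * P) Q = atT (C.app g) := by
  have hdel : ∀ l : ℕ, pair (del l * P) Q = atT (dx^[l] g) := by
    intro l
    induction l with
    | zero => exact (congrArg (pair · Q) (one_mul P)).trans h
    | succ l ih =>
      rw [del_natCast_mul, mul_assoc, ← dT_zero_pair, ih, dT_atT]
      exact congrArg atT (dx_iterate_dx l g)
  obtain ⟨N, hN⟩ := C.exists_ordLE
  have hM : C.OrdLE (((N + 1).toNat : ℤ) - 1) := hN.mono (by omega)
  have hM' : N < (N + 1).toNat := by omega
  have e : pair (C * P) Q = pairHom Q (C * P) := rfl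
  rw [app_eq_sum hN g hM', e]
  conv_lhs => rw [hC.eq_sum hM, Finset.sum_mul, map_sum]
  rw [map_sum]
  refine Finset.sum_congr rfl fun l _ => ?_
  change pair _ Q = _
  rw [mul_assoc, pair_fn_mul, hdel, map_mul]

theorem bilinear2_iff (W : PDO K) (q : Fn K) :
    Bilinear2 W q ↔ pair W (Omega q W) = atT (-q) := by
  rw [Bilinear2, pair, map_neg]

/-- If `g(t) = Res_λ ψ(t,λ) A(t',λ)` for some series `A`, then `g` is an eigenfunction, because
`∂_{t_n} ψ = (L^n)_{≥0}(ψ)`. -/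
theorem IsCKPWave.isEigenfunction_of_pair_eq {L W Q : PDO K} {g : Fn K} (hW : IsCKPWave L W)
    (h : pair W Q = atT g) : IsEigenfunction L g := fun i => by
  have h1 := congrArg (dT i) h
  rw [dT_pair, hW.flow_add, pair_mul_of_pair_eq h (isDiff_B L i), dT_atT] at h1
  exact (atT_injective h1).symm

/-- An eigenfunction `g(t)` is equal to `Res_λ ψ(t,λ) A(t',λ)` as soon as the derivatives of the
two by all differential operators `C` in `x` agree on the diagonal. -/
theorem IsCKPWave.pair_eq_of_isEigenfunction {L W Q : PDO K} {g : Fn K} (hW : IsCKPWave L W)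
    (hg : IsEigenfunction L g) (h : ∀ C : PDO K, C.IsDiff → (C * W * Q.adj).res = C.app g) :
    pair W Q = atT g := by
  refine sub_eq_zero.mp (eq_zero_of_diag_eq_zero
    (M := {G | ∃ C : PDO K, C.IsDiff ∧ G = pair (C * W) Q - atT (C.app g)}) ?_ ?_
    ⟨1, isDiff_monomial le_rfl 1, by rw [one_mul, one_app]⟩)
  · rintro _ ⟨C, hC, rfl⟩ i
    refine ⟨C.flow i + C * B L i, isDiff_add (isDiff_flow hC i) (hC.mul (isDiff_B L i)), ?_⟩
    rw [map_sub, dT_pair, dT_atT, dt_app, hg i, PDO.app_add, app_mul hC (isDiff_B L i), flow_mul,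
      add_mul, mul_assoc C W, mul_assoc C (B L i), ← hW.flow_add, mul_add, add_assoc]
  · rintro _ ⟨C, hC, rfl⟩
    rw [map_sub, diag_pair, diag_atT, h C hC, sub_self]

/-- The residue of `C W Ω^*` is `-C(q)`, as `Ω^* = -W^* q ∂⁻¹` and `W W^* = 1`. -/
theorem IsCKPWave.bilinear2_iff_isEigenfunction {L W : PDO K} (hW : IsCKPWave L W) (q : Fn K) :
    Bilinear2 W q ↔ IsEigenfunction L q := by
  rw [bilinear2_iff]
  constructor
  · intro h i
    have := hW.isEigenfunction_of_pair_eq h i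
    rw [dt_neg, app_map_neg, neg_inj] at this
    exact this
  · intro h
    refine hW.pair_eq_of_isEigenfunction (fun i => ?_) fun C _ => ?_
    · rw [dt_neg, app_map_neg, h i]
    · rw [Omega_adj, mul_neg, ← mul_assoc, ← mul_assoc, mul_assoc C, hW.mul_adj, mul_one,
        app_map_neg, ← res_mul_fn_mul_del]
      rfl

/-- A single nonzero `q` that satisfies the second identity makes `ψ` a CKP wave function:
restricted to the diagonal, the identity and its derivatives say `W W^* q = q` and
`(W_{t_n} + (L^n)_{<0} W) W^* q = q_{t_n} - (L^n)_{≥0}(q)`, where the operator on the left has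
negative order. -/
theorem isCKPWave_of_bilinear2 {L W : PDO K} {q : Fn K} (hm : IsMonic W) (hd : IsDressing L W)
    (hq : q ≠ 0) (h : Bilinear2 W q) : IsCKPWave L W := by
  rw [bilinear2_iff] at h
  -- for `Z` of order at most `0`, a value of the pairing with `Ω` that is independent of `t'`
  -- determines the operator `Z W^* q`
  have key : ∀ {Z : PDO K} {r : Fn K}, Z.OrdLE 0 → pair Z (Omega q W) = atT (-r) →
      Z * W.adj * fn q = fn r := by
    intro Z r hZ hr
    have h0 : (Z * W.adj * fn q - fn r) * del (-1) = 0 := by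
      refine eq_zero_of_res_del_mul ?_ fun l => ?_
      · exact ((((hZ.mul hm.ordLE.adj).mul (ordLE_monomial 0 q)).sub
          (ordLE_monomial 0 r)).mul (ordLE_monomial (-1) 1))
      · have h1 := congrArg diag (pair_mul_of_pair_eq hr (isDiff_monomial (by omega : (0:ℤ) ≤ l) 1))
        rw [diag_pair, diag_atT, Omega_adj, app_map_neg, mul_neg, PDO.res, PDO.coeff_neg,
          neg_inj] at h1
        rw [sub_mul, mul_sub, res_sub, sub_eq_zero, ← mul_assoc (del l) (fn r), res_mul_fn_mul_del,
          ← h1, PDO.res]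
        simp only [mul_assoc]
    have h1 := congrArg (· * del 1) h0
    simp only [mul_assoc, del_mul_del, neg_add_cancel, del_zero, mul_one, zero_mul] at h1
    rw [sub_eq_zero] at h1
    rw [mul_assoc, h1]
  have h1 : W * W.adj = 1 := by
    have := key hm.ordLE h
    rw [← sub_eq_zero, ← one_mul (fn q), ← mul_assoc, mul_one, ← sub_mul] at this
    exact sub_eq_zero.mp (mul_fn_eq_zero this hq)
  have h2 : W.adj * W = 1 := by
    obtain ⟨V, hWV, hVW, -⟩ := hd
    have : V = W.adj := by rw [← mul_one V, ← h1, ← mul_assoc, hVW, one_mul]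
    rw [← this, hVW]
  refine ⟨hm, hd, fun i => ?_, h1, h2⟩
  set Z := W.flow i + (L ^ (2 * i + 1)).neg * W with hZdef
  have hZord : Z.OrdLE (-1) := by
    refine OrdLE.add (fun n hn => ?_) (((ordLE_neg _).mul hm.ordLE).mono (by decide))
    rw [flow_coeff]
    rcases eq_or_ne n 0 with rfl | h0
    · rw [hm.1, dt_one]
    · rw [hm.2 n (by omega), dt_zero]
  have hZ : Z = (W.flow i + W * del (2 * i + 1)) - B L i * W := by
    rw [← hd.pow_odd_mul_eq]
    have : L ^ (2 * i + 1) * W = B L i * W + (L ^ (2 * i + 1)).neg * W := by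
      rw [← add_mul, B_add_neg]
    rw [hZdef, this]
    abel
  have hr : pair Z (Omega q W) = atT (-(dt i q - (B L i).app q)) := by
    rw [hZ, pair_sub, ← dT_pair, h, pair_mul_of_pair_eq h (isDiff_B L i), dT_atT, ← map_sub,
      dt_neg, app_map_neg]
    congr 1
    ring
  have h3 := key (hZord.mono (by decide)) hr
  -- `Z W^* q` has negative order and is a function
  have h4 : dt i q - (B L i).app q = 0 := by
    have h5 := (((hZord.mul hm.ordLE.adj).mul (ordLE_monomial 0 q))) 0 (by decide)
    rw [h3, coeff_monomial, if_pos rfl] at h5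
    exact h5
  rw [h4, fn_zero] at h3
  have h5 := mul_fn_eq_zero h3 hq
  have h6 : Z = 0 := by rw [← mul_one Z, ← h2, ← mul_assoc, h5, zero_mul]
  exact eq_neg_of_add_eq_zero_left h6

/-- For a given CKP wave function the bilinear identities are the constrained hierarchy. -/
theorem IsCKPWave.isConstrainedCKP_iff {k : ℕ} {m : ℕ} {L W : PDO K}
    {q : Fin 2 → Fin m → Fn K} (hW : IsCKPWave L W) :
    IsConstrainedCKP k L q ↔ Bilinear1 k W q ∧ ∀ a j, Bilinear2 W (q a j) := by
  simp only [hW.bilinear2_iff_isEigenfunction]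
  constructor
  · rintro ⟨-, h2, h3⟩
    exact ⟨(hW.bilinear1_iff_constraint h3).mpr h2, h3⟩
  · rintro ⟨h1, h2⟩
    exact ⟨hW.isCKPLax, (hW.bilinear1_iff_constraint h2).mp h1, h2⟩

end Bilinear

section WaveFunctions

open PDO

/-! ### The squared eigenfunction potential -/

theorem IsCKPLax.adj_pow_odd {L : PDO K} (h : IsCKPLax L) (i : ℕ) :
    (L ^ (2 * i + 1)).adj = -L ^ (2 * i + 1) := by
  rw [PDO.adj_pow, h.adj_eq]
  exact Odd.neg_pow ⟨i, rfl⟩ L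

theorem IsCKPLax.adj_B {L : PDO K} (h : IsCKPLax L) (i : ℕ) : (B L i).adj = -B L i := by
  have h2 : ∀ P : PDO K, (-P).nonneg = -P.nonneg := fun P => by
    ext1 n
    simp only [nonneg_coeff, PDO.coeff_neg]
    split_ifs <;> simp
  rw [B, adj_nonneg_part, h.adj_pow_odd, h2]

/-- The integral part of `∂⁻¹ C` for a differential operator `C` is `∂⁻¹ C^*(1)`. -/
theorem neg_del_neg_one_mul {C : PDO K} (hC : C.IsDiff) :
    (del (-1) * C).neg = del (-1) * fn (C.adj.coeff 0) := by
  have h1 : (C.adj * del (-1)).neg = fn (C.adj.coeff 0) * del (-1) := by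
    ext1 n
    rw [neg_coeff, coeff_mul_del, fn_mul_del, coeff_monomial]
    rcases lt_trichotomy n (-1) with h | rfl | h
    · rw [if_pos (by omega), if_neg (by omega), hC.adj _ (by omega)]
    · rw [if_pos (by omega), if_pos rfl]
      rfl
    · rw [if_neg (by omega), if_neg (by omega)]
  have h2 := congrArg adj h1
  rw [adj_neg_part, adj_mul, adj_adj, adj_mul, adj_fn, adj_del, Int.negOnePow_neg,
    Int.negOnePow_one] at h2
  simpa [PDO.neg_neg] using h2

/-- The differential part of `∂⁻¹ q L^n` is `∂⁻¹ ((L^n)_{≥0}(q) + q (L^n)_{≥0})`. For an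
eigenfunction `q` its product with `W` is what `∂_{t_n}` makes of `Ω(q, ψ)`. -/
theorem nonneg_del_neg_one_mul_pow {L : PDO K} (hL : IsCKPLax L) (q : Fn K) (i : ℕ) :
    (del (-1) * fn q * L ^ (2 * i + 1)).nonneg =
      del (-1) * (fn ((B L i).app q) + fn q * B L i) := by
  have h1 : del (-1) * fn q * L ^ (2 * i + 1) =
      del (-1) * (fn q * B L i) + del (-1) * fn q * (L ^ (2 * i + 1)).neg := by
    rw [← mul_assoc, ← mul_add, B_add_neg]
  have h2 : (del (-1) * fn q * (L ^ (2 * i + 1)).neg).OrdLE (-1) :=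
    (((ordLE_monomial (-1) 1).mul (ordLE_monomial 0 q)).mul (ordLE_neg _)).mono (by decide)
  have h3 := neg_del_neg_one_mul ((isDiff_monomial le_rfl q).mul (isDiff_B L i))
  rw [adj_mul, adj_fn, hL.adj_B, neg_mul, PDO.coeff_neg, coeff_zero_mul_fn, fn_neg, mul_neg] at h3
  have h4 := nonneg_add_neg (del (-1) * (fn q * B L i))
  rw [h1, nonneg_add, h2.nonneg_eq_zero, add_zero, eq_sub_of_add_eq h4, h3, mul_add]
  abel

/-- The action of a differential operator on the coefficients of `P(e^ξ)` is the product of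
operators. -/
theorem app_expCoeff [CharZero K] {C : PDO K} (hC : C.IsDiff) (P : PDO K) (j : ℤ) :
    C.app (expCoeff timeT P.symbol j) = expCoeff timeT (C * P).symbol j := by
  let F : PDO K →+ Fn K := AddMonoidHom.mk' (fun P => expCoeff timeT P.symbol j)
    fun P Q => expCoeff_add isTimes_timeT P.symbol Q.symbol j
  change C.app (F P) = F (C * P)
  have hdel : ∀ l : ℕ, F (del l * P) = dx^[l] (F P) := by
    intro l
    induction l with
    | zero => exact congrArg F (one_mul P)
    | succ l ih =>
      rw [Function.iterate_succ_apply', ← ih]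
      refine Eq.trans ?_ (dt_expCoeff 0 (del l * P) j).symm
      change F _ = F _
      rw [flow_zero_eq, del_natCast_mul, mul_assoc]
      simp
  obtain ⟨N, hN⟩ := C.exists_ordLE
  have hM : C.OrdLE (((N + 1).toNat : ℤ) - 1) := hN.mono (by omega)
  have hM' : N < (N + 1).toNat := by omega
  rw [app_eq_sum hN _ hM']
  conv_rhs => rw [hC.eq_sum hM, Finset.sum_mul, map_sum]
  refine Finset.sum_congr rfl fun l _ => ?_
  rw [mul_assoc, ← hdel]
  refine mul_expCoeff isTimes_timeT _ (fun n => ?_) j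
  rw [symbol_coeff, symbol_coeff, coeff_fn_mul]

theorem neg_res (P : PDO K) : (-P).res = -P.res := rfl

/-- Both sides are the action of `(∂⁻¹ q L^n)_{≥0}` on `ψ`: the right-hand side is the residue of
`∂⁻¹ ψ L^n q ∂⁻¹`, or minus the residue of its adjoint `-(∂⁻¹ q L^n ψ ∂⁻¹)`. -/
theorem IsCKPWave.isSquaredEigenfunctionPotential [CharZero K] {L W : PDO K} {q : Fn K}
    (hW : IsCKPWave L W) (hq : IsEigenfunction L q) : IsSquaredEigenfunctionPotential L W q := by
  intro i j
  have hL := hW.isCKPLax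
  have h1 : (Omega q W).flow i + Omega q W * del (2 * i + 1) =
      (del (-1) * fn q * L ^ (2 * i + 1)).nonneg * W := by
    rw [nonneg_del_neg_one_mul_pow hL, ← hq i, Omega, mul_assoc (del (-1) * fn q),
      flow_mul, flow_mul, flow_del,
      zero_mul, zero_add, flow_monomial, add_assoc, ← mul_add, hW.flow_add]
    simp only [mul_add, add_mul, mul_assoc]
  have h2 := res_adj (del (-1) * fn (expCoeff timeT W.symbol j) * L ^ (2 * i + 1) * fn q * del (-1))
  rw [dt_expCoeff, h1, ← app_expCoeff (isDiff_nonneg _), app_nonneg, ← res_mul_fn_mul_del,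
    ← neg_eq_iff_eq_neg.mpr h2, ← neg_res]
  congr 1
  rw [PDO.adj_mul, PDO.adj_mul, PDO.adj_mul, PDO.adj_mul, adj_fn, adj_fn, adj_del,
    hL.adj_pow_odd, Int.negOnePow_neg, Int.negOnePow_one]
  simp [mul_assoc]

/-! ### Existence of wave functions -/

/-- The formal Poincaré lemma. -/
theorem exists_dt_eq [CharZero K] {f : ℕ → Fn K} (hf : ∀ i j, dt i (f j) = dt j (f i)) :
    ∃ g : Fn K, ∀ i, dt i g = f i := by
  classical
  have hex : ∀ d : ℕ →₀ ℕ, d ≠ 0 → ∃ i, d i ≠ 0 := fun d hd => by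
    by_contra hcon
    push Not at hcon
    exact hd (Finsupp.ext hcon)
  -- the coefficient of `t^d` is found from `f i` for any `i` with `d i ≠ 0`; by compatibility the
  -- choice of `i` does not matter
  let g : Fn K := fun d => if h : d = 0 then 0 else
    MvPowerSeries.coeff (d - Finsupp.single (hex d h).choose 1) (f (hex d h).choose)
      / (d (hex d h).choose : K)
  have hg : ∀ d (i : ℕ), MvPowerSeries.coeff (d + Finsupp.single i 1) g * ((d i : K) + 1)
      = MvPowerSeries.coeff d (f i) := by
    intro d i
    have hd : d + Finsupp.single i 1 ≠ 0 := fun h => by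
      have := DFunLike.congr_fun h i
      simp at this
    have hgd : MvPowerSeries.coeff (d + Finsupp.single i 1) g = MvPowerSeries.coeff
      (d + Finsupp.single i 1 - Finsupp.single (hex _ hd).choose 1) (f (hex _ hd).choose)
      / (((d + Finsupp.single i 1 : ℕ →₀ ℕ) (hex _ hd).choose : ℕ) : K) := dif_neg hd
    have hj := (hex _ hd).choose_spec
    rw [hgd]
    generalize (hex _ hd).choose = j at hj ⊢
    have hj' : (((d + Finsupp.single i 1 : ℕ →₀ ℕ) j : ℕ) : K) ≠ 0 := Nat.cast_ne_zero.mpr hj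
    rw [div_mul_eq_mul_div, div_eq_iff hj']
    rcases eq_or_ne j i with rfl | hne
    · rw [add_tsub_cancel_right, Finsupp.add_apply, Finsupp.single_eq_same]
      push_cast
      ring
    · have hdj : d j ≠ 0 := by
        rwa [Finsupp.add_apply, Finsupp.single_eq_of_ne hne, add_zero] at hj
      obtain ⟨c, rfl⟩ : ∃ c, d = c + Finsupp.single j 1 := by
        refine ⟨d - Finsupp.single j 1, (tsub_add_cancel_of_le ?_).symm⟩
        rw [Finsupp.single_le_iff]
        omega
      have h := congrArg (MvPowerSeries.coeff c) (hf i j)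
      rw [MvPowerSeries.coeff_pderiv, MvPowerSeries.coeff_pderiv] at h
      rw [add_right_comm, add_tsub_cancel_right, Finsupp.add_apply, Finsupp.add_apply,
        Finsupp.add_apply, Finsupp.single_eq_of_ne hne, Finsupp.single_eq_of_ne hne.symm,
        Finsupp.single_eq_same]
      push_cast
      rw [add_zero, add_zero, h]
  refine ⟨g, fun i => ?_⟩
  ext d
  rw [MvPowerSeries.coeff_pderiv, hg]

/-- Operators are complete with respect to the order filtration. -/
theorem exists_limit {V : ℕ → PDO K} (h0 : (V 0).OrdLE 0)
    (h : ∀ N : ℕ, (V (N + 1) - V N).OrdLE (-(N + 1))) :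
    ∃ X : PDO K, ∀ N : ℕ, (X - V N).OrdLE (-(N + 1)) := by
  refine ⟨ofCoeff (fun i => (V (-i).toNat).coeff i) ⟨0, fun i hi => ?_⟩, fun N i hi => ?_⟩
  · rw [Int.toNat_of_nonpos (by omega)]
    exact h0 i hi
  · rw [coeff_sub, coeff_ofCoeff, sub_eq_zero]
    have hle : (-i).toNat ≤ N := by omega
    induction N, hle using Nat.le_induction with
    | base => rfl
    | succ N hN ih =>
      have h1 := h N i (by omega)
      rw [coeff_sub, sub_eq_zero] at h1
      rw [ih (by omega), h1]

theorem IsMonic.one : IsMonic (1 : PDO K) :=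
  ⟨by rw [one_def, coeff_monomial, if_pos rfl], fun i hi => by
    rw [one_def, coeff_monomial, if_neg (by omega)]⟩

theorem IsMonic.sub_one {W : PDO K} (h : IsMonic W) : (W - 1).OrdLE (-1) := fun i hi => by
  rcases eq_or_ne i 0 with rfl | h0
  · rw [coeff_sub, h.1, IsMonic.one.1, sub_self]
  · rw [coeff_sub, h.2 i (by omega), IsMonic.one.2 i (by omega), sub_self]

theorem isMonic_of_sub {V W : PDO K} (hV : IsMonic V) (h : (W - V).OrdLE (-1)) : IsMonic W :=
  ⟨by rw [← sub_add_cancel W V, coeff_add, h 0 (by decide), hV.1, zero_add], fun i hi => by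
    rw [← sub_add_cancel W V, coeff_add, h i (by omega), hV.2 i hi, zero_add]⟩

theorem IsMonic.mul {V W : PDO K} (hV : IsMonic V) (hW : IsMonic W) : IsMonic (V * W) := by
  refine isMonic_of_sub hV ?_
  rw [← mul_sub_one]
  exact (hV.ordLE.mul hW.sub_one).mono (by decide)

theorem IsMonic.adj {W : PDO K} (hW : IsMonic W) : IsMonic W.adj := by
  refine isMonic_of_sub IsMonic.one ?_
  rw [← adj_one, ← adj_sub]
  exact hW.sub_one.adj

/-- The inverse is the limit of the iteration `X ↦ X + (1 - W X)`. -/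
theorem IsMonic.exists_inv {W : PDO K} (hW : IsMonic W) : ∃ V : PDO K, W * V = 1 ∧ V * W = 1 := by
  have hright : ∀ {W : PDO K}, IsMonic W → ∃ V : PDO K, IsMonic V ∧ W * V = 1 := by
    intro W hW
    let V : ℕ → PDO K := fun N => Nat.rec 1 (fun _ X => X + (1 - W * X)) N
    have hVs : ∀ N, V (N + 1) = V N + (1 - W * V N) := fun _ => rfl
    have hE : ∀ N : ℕ, (1 - W * V N).OrdLE (-(N + 1)) := by
      intro N
      induction N with
      | zero =>
        change (1 - W * 1).OrdLE _
        rw [mul_one, ← _root_.neg_sub W 1]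
        exact hW.sub_one.neg.mono (by simp)
      | succ N ih =>
        have : 1 - W * V (N + 1) = (1 - W) * (1 - W * V N) := by
          rw [hVs]
          noncomm_ring
        rw [this, ← _root_.neg_sub W 1]
        exact (hW.sub_one.neg.mul ih).mono (by push_cast; omega)
    obtain ⟨X, hX⟩ := exists_limit (V := V) IsMonic.one.ordLE fun N => by
      rw [hVs, add_sub_cancel_left]
      exact hE N
    refine ⟨X, isMonic_of_sub IsMonic.one (hX 0), ?_⟩
    refine sub_eq_zero.mp (eq_zero_of_ordLE (c := -1) fun N => ?_)
    have : W * X - 1 = W * (X - V N) - (1 - W * V N) := by noncomm_ring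
    rw [this]
    exact (((hW.ordLE.mul (hX N)).mono (by omega)).sub ((hE N).mono (by omega)))
  obtain ⟨V, hV, hWV⟩ := hright hW
  obtain ⟨U, -, hVU⟩ := hright hV
  have : W = U := by rw [← mul_one W, ← hVU, ← mul_assoc, hWV, one_mul]
  exact ⟨V, hWV, by rw [this, hVU]⟩

theorem IsCKPLax.flow_pow {L : PDO K} (h : IsCKPLax L) (j n : ℕ) :
    (L ^ n).flow j = B L j * L ^ n - L ^ n * B L j := by
  induction n with
  | zero =>
    rw [pow_zero, flow_one, mul_one, one_mul, sub_self]
  | succ n ih =>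
    rw [pow_succ, flow_mul, ih, h.lax]
    noncomm_ring

/-- The zero curvature equations for the integral parts. -/
theorem IsCKPLax.zero_curvature {L : PDO K} (h : IsCKPLax L) (i j : ℕ) :
    (L ^ (2 * i + 1)).neg.flow j - (L ^ (2 * j + 1)).neg.flow i =
      (L ^ (2 * i + 1)).neg * (L ^ (2 * j + 1)).neg -
        (L ^ (2 * j + 1)).neg * (L ^ (2 * i + 1)).neg := by
  have hi := B_add_neg L i
  have hj := B_add_neg L j
  have hc : L ^ (2 * i + 1) * L ^ (2 * j + 1) = L ^ (2 * j + 1) * L ^ (2 * i + 1) := by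
    rw [← pow_add, ← pow_add, add_comm]
  rw [flow_neg_part, flow_neg_part, h.flow_pow, h.flow_pow, ← PDO.neg_sub]
  rw [← hi, ← hj] at hc
  have hBB : (B L i * B L j - B L j * B L i).neg = 0 := by
    rw [PDO.neg_sub, ((isDiff_B L i).mul (isDiff_B L j)).neg_eq_zero,
      ((isDiff_B L j).mul (isDiff_B L i)).neg_eq_zero, sub_zero]
  have hNN : ((L ^ (2 * i + 1)).neg * (L ^ (2 * j + 1)).neg -
      (L ^ (2 * j + 1)).neg * (L ^ (2 * i + 1)).neg).OrdLE (-1) :=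
    OrdLE.sub (((ordLE_neg _).mul (ordLE_neg _)).mono (by decide))
      (((ordLE_neg _).mul (ordLE_neg _)).mono (by decide))
  -- the difference of the two sides is, up to sign, the integral part of the commutator of two
  -- differential operators
  rw [← hNN.neg_eq, ← sub_eq_zero, ← PDO.neg_sub, ← neg_eq_zero, ← PDO.neg_neg, ← hBB]
  congr 1
  generalize (L ^ (2 * i + 1)).neg = M at *
  generalize (L ^ (2 * j + 1)).neg = N at *
  rw [← hi, ← hj, ← sub_eq_zero]
  rw [← sub_eq_zero] at hc
  rw [← hc]
  noncomm_ring

/-- One step of the construction of a solution of Sato's equations: a solution modulo order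
`-(N+1)` is corrected by a term `g ∂^{-(N+1)}`, where the equations for `g` are solvable by zero
curvature. -/
theorem IsCKPLax.exists_sato_step [CharZero K] {L : PDO K} (h : IsCKPLax L) {W : PDO K} {N : ℕ}
    (hW : ∀ i, (W.flow i + (L ^ (2 * i + 1)).neg * W).OrdLE (-(N + 1))) :
    ∃ g : Fn K, ∀ i, ((W + monomial (-(N + 1)) g).flow i +
      (L ^ (2 * i + 1)).neg * (W + monomial (-(N + 1)) g)).OrdLE (-((N + 1 : ℕ) + 1)) := by
  set R : ℕ → PDO K := fun i => W.flow i + (L ^ (2 * i + 1)).neg * W with hR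
  obtain ⟨g, hg⟩ := exists_dt_eq (f := fun i => -(R i).coeff (-(N + 1))) fun i j => by
    have hNR : ∀ i j, ((L ^ (2 * i + 1)).neg * R j).coeff (-(N + 1)) = 0 := fun i j =>
      (ordLE_neg _).mul (hW j) _ (by omega)
    have hflow : ∀ i, W.flow i = R i - (L ^ (2 * i + 1)).neg * W := fun i => by
      rw [hR, add_sub_cancel_right]
    have hz := h.zero_curvature i j
    have key : (R i).flow j - (R j).flow i =
        (L ^ (2 * i + 1)).neg * R j - (L ^ (2 * j + 1)).neg * R i := by
      have e : (R i).flow j - (R j).flow i = ((L ^ (2 * i + 1)).neg.flow j -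
          (L ^ (2 * j + 1)).neg.flow i) * W + (L ^ (2 * i + 1)).neg * W.flow j
            - (L ^ (2 * j + 1)).neg * W.flow i := by
        simp only [hR, flow_add, flow_mul]
        rw [flow_comm i j]
        noncomm_ring
      rw [e, hz, hflow i, hflow j]
      noncomm_ring
    have hc := congrArg (fun P => PDO.coeff P (-(N + 1))) key
    simp only [coeff_sub, hNR, sub_zero, flow_coeff, sub_eq_zero] at hc
    rw [dt_neg, dt_neg, hc]
  refine ⟨g, fun i n hn => ?_⟩
  have e : (W + monomial (-(N + 1)) g).flow i +
      (L ^ (2 * i + 1)).neg * (W + monomial (-(N + 1)) g) = R i +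
      monomial (-(N + 1)) (dt i g) + (L ^ (2 * i + 1)).neg * monomial (-(N + 1)) g := by
    rw [flow_add, flow_monomial, mul_add]
    exact (add_add_add_comm _ _ _ _).trans (add_assoc _ _ _).symm
  rw [e, coeff_add, coeff_add, (ordLE_neg _).mul (ordLE_monomial _ g) n (by push_cast at hn; omega),
    add_zero, coeff_monomial, hg]
  split_ifs with h1
  · rw [h1, add_neg_cancel]
  · rw [hW i n (by push_cast at hn; omega), add_zero]

theorem IsCKPLax.exists_sato [CharZero K] {L : PDO K} (h : IsCKPLax L) :
    ∃ W : PDO K, IsMonic W ∧ ∀ i, W.flow i = -((L ^ (2 * i + 1)).neg * W) := by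
  have h0 : ∀ i, ((1 : PDO K).flow i + (L ^ (2 * i + 1)).neg * 1).OrdLE (-((0 : ℕ) + 1)) :=
    fun i => by
      rw [flow_one, zero_add, mul_one]
      exact ordLE_neg _
  let V : ∀ N : ℕ, {W : PDO K // ∀ i, (W.flow i + (L ^ (2 * i + 1)).neg * W).OrdLE (-(N + 1))} :=
    fun N => Nat.rec ⟨1, h0⟩
      (fun N W => ⟨W.1 + monomial (-(N + 1)) (h.exists_sato_step W.2).choose,
        (h.exists_sato_step W.2).choose_spec⟩) N
  obtain ⟨W, hW⟩ := exists_limit (V := fun N => (V N).1) IsMonic.one.ordLE fun N => by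
    have : (V (N + 1)).1 = (V N).1 + monomial (-(N + 1)) _ := rfl
    rw [this, add_sub_cancel_left]
    exact ordLE_monomial _ _
  refine ⟨W, isMonic_of_sub IsMonic.one (hW 0), fun i => eq_neg_of_add_eq_zero_left ?_⟩
  refine eq_zero_of_ordLE (c := -1) fun N => ?_
  have e : W.flow i + (L ^ (2 * i + 1)).neg * W = (W - (V N).1).flow i +
      (L ^ (2 * i + 1)).neg * (W - (V N).1) +
      ((V N).1.flow i + (L ^ (2 * i + 1)).neg * (V N).1) := by
    rw [flow_sub, mul_sub]
    abel
  rw [e]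
  refine (((hW N).flow i).add (((ordLE_neg _).mul (hW N)).mono (by omega))).add ((V N).2 i)
    |>.mono (by omega)

theorem mul_fn_C (P : PDO K) (c : K) :
    P * fn (MvPowerSeries.C c) = fn (MvPowerSeries.C c) * P := by
  ext1 n
  rw [coeff_fn_mul, coeff_mul, finsum_eq_single _ (n, 0)]
  · simp [coeff_monomial, mul_comm]
  · rintro ⟨i, l⟩ hne
    rw [coeff_monomial]
    split_ifs with h
    · have hl : l ≠ 0 := by
        rintro rfl
        exact hne (by ext <;> simp at *; omega)
      obtain ⟨l, rfl⟩ := Nat.exists_eq_succ_of_ne_zero hl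
      rw [Function.iterate_succ_apply]
      have : dx (MvPowerSeries.C c : Fn K) = 0 := MvPowerSeries.pderiv_C
      rw [this, iterate_dx_zero, mul_zero, smul_zero]
    · rw [iterate_dx_zero, mul_zero, smul_zero]

/-- The inverse square root of a selfadjoint monic operator with constant coefficients, as the limit
of the iteration `D ↦ D + (1 - D C D) / 2`. -/
theorem exists_inv_sqrt [CharZero K] {C : PDO K} (hC : IsMonic C) (hadj : C.adj = C)
    (hflow : ∀ i, C.flow i = 0) :
    ∃ D : PDO K, IsMonic D ∧ D.adj = D ∧ (∀ i, D.flow i = 0) ∧ D * C * D = 1 := by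
  set c : PDO K := fn (MvPowerSeries.C (2⁻¹ : K)) with hc
  have hcc : c + c = 1 := by
    rw [hc, ← monomial_add, ← map_add, ← two_mul, mul_inv_cancel₀ two_ne_zero, map_one]
    rfl
  have hcm : ∀ P : PDO K, P * c = c * P := fun P => mul_fn_C P _
  -- the error `E = 1 - X C X` becomes `(1 - 2c) E = 0` up to terms of lower order
  let V : ℕ → PDO K := fun N => Nat.rec 1 (fun _ X => X + c * (1 - X * C * X)) N
  have hVs : ∀ N, V (N + 1) = V N + c * (1 - V N * C * V N) := fun _ => rfl
  have hcord : c.OrdLE 0 := ordLE_monomial 0 _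
  have hV : ∀ N : ℕ, IsMonic (V N) ∧ (1 - V N * C * V N).OrdLE (-(N + 1)) := by
    intro N
    induction N with
    | zero =>
      refine ⟨IsMonic.one, ?_⟩
      change (1 - 1 * C * 1).OrdLE _
      rw [mul_one, one_mul, ← _root_.neg_sub C 1]
      exact hC.sub_one.neg.mono (by simp)
    | succ N ih =>
      obtain ⟨ih1, ih2⟩ := ih
      set E := 1 - V N * C * V N with hE
      have hcE := hcord.mul ih2
      refine ⟨isMonic_of_sub ih1 ?_, ?_⟩
      · rw [hVs, add_sub_cancel_left]
        exact hcE.mono (by omega)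
      · have e : 1 - V (N + 1) * C * V (N + 1) = -(c * (E * (C * V N - 1)))
            - c * ((V N * C - 1) * E) - c * E * C * (c * E) + (1 - (c + c)) * E := by
          have h1 : V N * C * (c * E) = c * (V N * C * E) := by
            rw [← mul_assoc, hcm, mul_assoc]
          have h2 : V (N + 1) * C * V (N + 1) = V N * C * V N + c * E * C * V N
              + V N * C * (c * E) + c * E * C * (c * E) := by
            have hexp : ∀ X F : PDO K, (X + c * F) * C * (X + c * F) = X * C * X
                + c * F * C * X + X * C * (c * F) + c * F * C * (c * F) := by
              intro X F
              noncomm_ring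
            rw [hVs, hexp]
          have h3 : V N * C * V N = 1 - E := by
            rw [hE, sub_sub_cancel]
          rw [h2, h1, h3]
          noncomm_ring
        have hVC : (V N * C - 1).OrdLE (-1) := (ih1.mul hC).sub_one
        have hCV : (C * V N - 1).OrdLE (-1) := (hC.mul ih1).sub_one
        rw [e, hcc, sub_self, zero_mul, add_zero]
        refine ((OrdLE.neg ?_).sub ?_).sub ?_
        · exact (hcord.mul (ih2.mul hCV)).mono (by push_cast; omega)
        · exact (hcord.mul (hVC.mul ih2)).mono (by push_cast; omega)
        · exact ((hcE.mul hC.ordLE).mul hcE).mono (by push_cast; omega)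
  have hVadj : ∀ N, (V N).adj = V N := by
    intro N
    induction N with
    | zero => exact adj_one
    | succ N ih =>
      rw [hVs, adj_add, ih, adj_fn_mul, adj_sub, adj_one, PDO.adj_mul, PDO.adj_mul, ih, hadj,
        ← mul_assoc]
      exact congrArg (V N + ·) (hcm _)
  have hVflow : ∀ N i, (V N).flow i = 0 := by
    intro N i
    induction N with
    | zero => exact flow_one i
    | succ N ih =>
      have hci : c.flow i = 0 := by
        rw [hc, flow_monomial]
        have : dt i (MvPowerSeries.C (2⁻¹ : K) : Fn K) = 0 := MvPowerSeries.pderiv_C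
        rw [this, monomial_zero]
      rw [hVs, flow_add, ih, flow_mul, hci, flow_sub, flow_one, flow_mul, flow_mul, ih, hflow]
      simp
  obtain ⟨D, hD⟩ := exists_limit (V := V) IsMonic.one.ordLE fun N => by
    rw [hVs, add_sub_cancel_left]
    exact (hcord.mul (hV N).2).mono (by omega)
  have hDm : IsMonic D := isMonic_of_sub IsMonic.one (hD 0)
  refine ⟨D, hDm, ?_, fun i => ?_, ?_⟩
  · refine sub_eq_zero.mp (eq_zero_of_ordLE (c := -1) fun N => ?_)
    have e : D.adj - D = (D - V N).adj - (D - V N) := by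
      rw [adj_sub, hVadj]
      abel
    rw [e]
    exact ((hD N).adj.sub (hD N)).mono (by omega)
  · refine eq_zero_of_ordLE (c := -1) fun N => ?_
    have e : D.flow i = (D - V N).flow i := by rw [flow_sub, hVflow, sub_zero]
    rw [e]
    exact ((hD N).flow i).mono (by omega)
  · refine sub_eq_zero.mp (eq_zero_of_ordLE (c := -1) fun N => ?_)
    have e : D * C * D - 1 = (D - V N) * C * D + V N * C * (D - V N) - (1 - V N * C * V N) := by
      noncomm_ring
    rw [e]
    refine OrdLE.sub (OrdLE.add ?_ ?_) ((hV N).2.mono (by omega))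
    · exact (((hD N).mul hC.ordLE).mul hDm.ordLE).mono (by omega)
    · exact (((hV N).1.ordLE.mul hC.ordLE).mul (hD N)).mono (by omega)

/-- Every Lax operator of the CKP hierarchy has a CKP wave function. For a solution `W` of Sato's
equations `C = W^* W` is constant in all times, and `W C^{-1/2}` is a CKP dressing operator. -/
theorem IsCKPLax.exists_isCKPWave [CharZero K] {L : PDO K} (h : IsCKPLax L) :
    ∃ W : PDO K, IsCKPWave L W := by
  obtain ⟨W, hWm, hW⟩ := h.exists_sato
  have hWadj : ∀ i, W.adj.flow i = W.adj * (L ^ (2 * i + 1)).neg := fun i => by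
    rw [flow_adj, hW, adj_neg, PDO.adj_mul, adj_neg_part, h.adj_pow_odd, PDO.neg_neg, mul_neg,
      _root_.neg_neg]
  obtain ⟨D, hDm, hDadj, hDflow, hDCD⟩ := exists_inv_sqrt (C := W.adj * W) (hWm.adj.mul hWm)
    (by rw [PDO.adj_mul, adj_adj]) fun i => by
      rw [flow_mul, hWadj, hW, mul_neg, mul_assoc, add_neg_cancel]
  have hm : IsMonic (W * D) := hWm.mul hDm
  have hadj_mul : (W * D).adj * (W * D) = 1 := by
    rw [PDO.adj_mul, hDadj, ← hDCD]
    simp only [mul_assoc]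
  have hmul_adj : (W * D) * (W * D).adj = 1 := by
    obtain ⟨V, hV, -⟩ := hm.exists_inv
    have : V = (W * D).adj := by rw [← one_mul V, ← hadj_mul, mul_assoc, hV, mul_one]
    rw [← this, hV]
  have hLW : L * W = W * del 1 := by
    have h1 := hW 0
    have h2 : (L ^ (2 * 0 + 1)).neg = L - del 1 := by
      rw [eq_sub_iff_add_eq', ← h.B_zero, B_add_neg]
      exact pow_one L
    rw [h2, flow_zero_eq, sub_mul, _root_.neg_sub, sub_right_inj] at h1
    exact h1.symm
  -- `D` is constant in `x`
  have hD : D * del 1 = del 1 * D := by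
    have h1 := hDflow 0
    rw [flow_zero_eq, sub_eq_zero] at h1
    exact h1.symm
  refine ⟨W * D, hm, ⟨(W * D).adj, hmul_adj, hadj_mul, ?_⟩, fun i => ?_, hmul_adj, hadj_mul⟩
  · rw [mul_assoc W D, hD, ← mul_assoc W, ← hLW, mul_assoc L, mul_assoc L, hmul_adj, mul_one]
  · rw [flow_mul, hDflow, mul_zero, add_zero, hW, neg_mul, mul_assoc]

end WaveFunctions

/-! ### Shifts of the times by `[λ⁻¹]` -/

section Shift

open MvPowerSeries

open scoped MvPowerSeries.WithPiTopology in
theorem continuous_pderiv {σ : Type*} [TopologicalSpace K] [DiscreteTopology K] (i : σ) :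
    Continuous (pderiv K i : MvPowerSeries σ K → MvPowerSeries σ K) := by
  refine continuous_pi fun d => ?_
  have : (fun f : MvPowerSeries σ K => (pderiv K i f) d) =
      fun f => coeff (d + Finsupp.single i 1) f * ((d i : K) + 1) := by
    ext f
    exact coeff_pderiv f d
  rw [this]
  exact (WithPiTopology.continuous_coeff K _).mul continuous_const

open scoped MvPowerSeries.WithPiTopology in
/-- The chain rule for substitutes of which only `a s` depends on the variable `t`, with
derivative `1`. Both sides are continuous in `f`, so that it is enough to have it for
polynomials. -/
theorem pderiv_subst {σ τ : Type*} {a : σ → MvPowerSeries τ K} (ha : HasSubst a) {s : σ} {t : τ}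
    (hs : pderiv K t (a s) = 1) (hn : ∀ i, i ≠ s → pderiv K t (a i) = 0) (f : MvPowerSeries σ K) :
    pderiv K t (subst a f) = subst a (pderiv K s f) := by
  classical
  let : UniformSpace K := ⊥
  have hd := WithPiTopology.denseRange_toMvPowerSeries (σ := σ) (R := K)
  refine congrFun (hd.equalizer ((continuous_pderiv t).comp (continuous_subst ha))
    ((continuous_subst ha).comp (continuous_pderiv s)) (funext fun p => ?_)) f
  simp only [Function.comp_apply]
  rw [pderiv_coe, subst_coe, subst_coe]
  induction p using MvPolynomial.induction_on with
  | C r => simp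
  | add p q hp hq => rw [map_add, map_add, map_add, map_add, hp, hq]
  | mul_X p i hp =>
    rw [map_mul, Derivation.leibniz, hp, Derivation.leibniz, MvPolynomial.aeval_X,
      MvPolynomial.pderiv_X, map_add]
    by_cases hi : i = s
    · rw [hi, hs]
      simp
    · rw [hn i hi]
      simp [hi]

/-- A homomorphism with `X ↦ X` is given by its values on the coefficients. -/
theorem coeff_hom_eq_sum {R S : Type*} [CommRing R] [CommRing S]
    {Φ : PowerSeries R →+* PowerSeries S} (hX : Φ PowerSeries.X = PowerSeries.X)
    (f : PowerSeries R) {n M : ℕ} (hn : n < M) :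
    PowerSeries.coeff n (Φ f) = PowerSeries.coeff n (∑ i ∈ Finset.range M,
      Φ (PowerSeries.C (PowerSeries.coeff i f)) * PowerSeries.X ^ i) := by
  have hd : PowerSeries.X ^ M ∣ f - ∑ i ∈ Finset.range M,
      PowerSeries.C (PowerSeries.coeff i f) * PowerSeries.X ^ i := by
    rw [PowerSeries.X_pow_dvd_iff]
    intro m hm
    simp only [map_sub, map_sum, PowerSeries.coeff_C_mul, PowerSeries.coeff_X_pow, mul_ite, mul_one,
      mul_zero]
    rw [Finset.sum_ite_eq, if_pos (Finset.mem_range.mpr hm), sub_self]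
  obtain ⟨g, hg⟩ := hd
  have h := congrArg Φ hg
  simp only [map_sub, map_sum, map_mul, map_pow, hX] at h
  rw [sub_eq_iff_eq_add.mp h, map_add, PowerSeries.coeff_X_pow_mul', if_neg (by omega), zero_add]

/-- Homomorphisms between rings of power series that preserve `X` are determined by their values
on constants. -/
theorem hom_ext {R S : Type*} [CommRing R] [CommRing S] {Φ Ψ : PowerSeries R →+* PowerSeries S}
    (hΦ : Φ PowerSeries.X = PowerSeries.X) (hΨ : Ψ PowerSeries.X = PowerSeries.X)
    (h : ∀ r, Φ (PowerSeries.C r) = Ψ (PowerSeries.C r)) (f : PowerSeries R) : Φ f = Ψ f := by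
  ext1 n
  rw [coeff_hom_eq_sum hΦ f n.lt_succ_self, coeff_hom_eq_sum hΨ f n.lt_succ_self]
  simp only [h]

variable {σ : Type*}

/-- The family `a` of substitutes, extended to the variable `λ⁻¹` by `λ⁻¹ ↦ λ⁻¹`. -/
def optionFamily (a : σ → MvPowerSeries (Option ℕ) K) (i : Option σ) :
    MvPowerSeries (Option ℕ) K :=
  i.elim (X none) a

theorem hasSubst_optionFamily {a : σ → MvPowerSeries (Option ℕ) K} (ha : HasSubst a) :
    HasSubst (optionFamily a) := by
  constructor
  · rintro (_ | i)
    · simp [optionFamily]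
    · exact ha.const_coeff i
  · intro d
    refine (((ha.coeff_zero d).image some).union (Set.finite_singleton none)).subset ?_
    rintro (_ | i) hi
    · exact Or.inr rfl
    · exact Or.inl ⟨i, hi, rfl⟩

/-- The substitution `a` in all coefficients of a power series in `λ⁻¹`. The substitutes may contain
`λ⁻¹`. -/
def substSeries {a : σ → MvPowerSeries (Option ℕ) K} (ha : HasSubst a) :
    PowerSeries (MvPowerSeries σ K) →+* PowerSeries (Fn K) :=
  ((optionEquivLeft ℕ K).toAlgHom.comp ((substAlgHom (hasSubst_optionFamily ha)).comp
    (optionEquivLeft σ K).symm.toAlgHom)).toRingHom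

theorem substSeries_apply {a : σ → MvPowerSeries (Option ℕ) K} (ha : HasSubst a)
    (f : PowerSeries (MvPowerSeries σ K)) : substSeries ha f =
      optionEquivLeft ℕ K (subst (optionFamily a) ((optionEquivLeft σ K).symm f)) := by
  rw [← substAlgHom_apply (hasSubst_optionFamily ha)]
  rfl

theorem optionEquivLeft_rename_some (f : MvPowerSeries σ K) :
    optionEquivLeft σ K (rename (Function.Embedding.some : σ ↪ Option σ) f) = PowerSeries.C f := by
  ext n x
  rw [coeff_coeff_optionEquivLeft, PowerSeries.coeff_C]
  split_ifs with hn
  · have : x.optionElim n = x.embDomain Function.Embedding.some := by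
      ext (_ | i)
      · rw [Finsupp.optionElim_apply_none, hn, Finsupp.embDomain_of_notMem_range _ _ _ (by simp)]
      · rw [Finsupp.optionElim_apply_some]
        exact (Finsupp.embDomain_apply_self Function.Embedding.some x i).symm
    rw [this, coeff_embDomain_rename]
  · rw [coeff_rename_eq_zero, map_zero]
    rintro ⟨y, hy⟩
    have := DFunLike.congr_fun hy none
    rw [Finsupp.mapDomain_of_notMem_range _ _ (by simp), Finsupp.optionElim_apply_none] at this
    exact hn this.symm

theorem rename_some_eq_subst (f : MvPowerSeries σ K) :
    rename (Function.Embedding.some : σ ↪ Option σ) f = subst (fun i => X (some i)) f :=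
  rename_eq_subst _ f

theorem subst_rename {τ υ : Type*} (e : σ ↪ τ) {a : τ → MvPowerSeries υ K} (ha : HasSubst a)
    (f : MvPowerSeries σ K) : subst a (rename e f) = subst (a ∘ e) f := by
  rw [rename_eq_subst, subst_comp_subst_apply (HasSubst.X_comp _) ha]
  congr 1
  ext1 i
  exact subst_X ha _

theorem substSeries_C {a : σ → MvPowerSeries (Option ℕ) K} (ha : HasSubst a)
    (f : MvPowerSeries σ K) :
    substSeries ha (PowerSeries.C f) = optionEquivLeft ℕ K (subst a f) := by
  rw [substSeries_apply, ← optionEquivLeft_rename_some, AlgEquiv.symm_apply_apply,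
    subst_rename _ (hasSubst_optionFamily ha)]
  rfl

theorem substSeries_X {a : σ → MvPowerSeries (Option ℕ) K} (ha : HasSubst a) :
    substSeries ha PowerSeries.X = PowerSeries.X := by
  rw [substSeries_apply, ← optionEquivLeft_X_none, AlgEquiv.symm_apply_apply,
    subst_X (hasSubst_optionFamily ha), optionFamily, Option.elim_none, optionEquivLeft_X_none]

theorem shift_eq (c : K) (f : Fn K) :
    shift c f = substSeries (hasSubst_shiftFamily c) (PowerSeries.C f) :=
  (substSeries_C _ f).symm

/-- `t ↦ t + c[λ⁻¹]` undoes `t ↦ t - c[λ⁻¹]`. -/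
theorem substSeries_shift {c d : K} (h : c + d = 0) (f : Fn K) :
    substSeries (hasSubst_shiftFamily c) (shift d f) = PowerSeries.C f := by
  have ha := hasSubst_optionFamily (hasSubst_shiftFamily c)
  have he : (fun i => subst (optionFamily (shiftFamily c)) (shiftFamily d i)) =
      fun i => X (some i) := by
    ext1 i
    rw [shiftFamily, subst_add ha, subst_mul ha, subst_X ha, subst_pow ha, subst_X ha, subst_C,
      optionFamily, optionFamily, Option.elim_none, Option.elim_some, shiftFamily, add_assoc,
      ← add_mul, ← map_add, ← add_div, h, zero_div, map_zero, zero_mul, add_zero]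
  rw [substSeries_apply, shift, AlgEquiv.symm_apply_apply,
    subst_comp_subst_apply (hasSubst_shiftFamily d) ha, ← optionEquivLeft_rename_some,
    rename_some_eq_subst, he]

/-- `[λ⁻¹]` is odd in `λ`. -/
theorem evalNegHom_shift (c : K) (f : Fn K) :
    PowerSeries.evalNegHom (shift c f) = shift (-c) f := by
  set r : Option ℕ → K := fun i => i.elim (-1) fun _ => 1 with hr
  have h : ∀ g : MvPowerSeries (Option ℕ) K, PowerSeries.evalNegHom (optionEquivLeft ℕ K g) =
      optionEquivLeft ℕ K (rescale r g) := by
    intro g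
    ext n x
    have h1 : (-1 : Fn K) ^ n = C ((-1 : K) ^ n) := by rw [map_pow, map_neg, map_one]
    rw [coeff_coeff_optionEquivLeft, coeff_rescale, PowerSeries.evalNegHom,
      PowerSeries.coeff_rescale, h1, coeff_C_mul, coeff_coeff_optionEquivLeft,
      Finsupp.prod_option_index]
    · simp [hr]
    · simp
    · intro o m₁ m₂
      exact pow_add _ _ _
  have hs := HasSubst.smul_X (R := K) r
  have he : (fun i => subst (r • X) (shiftFamily c i)) = shiftFamily (-c) := by
    ext1 i
    rw [shiftFamily, subst_add hs, subst_mul hs, subst_X hs, subst_pow hs, subst_X hs, subst_C,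
      shiftFamily]
    simp only [hr, Pi.smul_apply', Option.elim_some, Option.elim_none, one_smul, neg_smul]
    rw [Odd.neg_pow ⟨i, rfl⟩, neg_div, map_neg, neg_mul, mul_neg]
  rw [shift, h, rescale_eq_subst, subst_comp_subst_apply (hasSubst_shiftFamily c) hs, shift, he]

theorem dxSeries_optionEquivLeft (f : MvPowerSeries (Option ℕ) K) :
    dxSeries (optionEquivLeft ℕ K f) = optionEquivLeft ℕ K (pderiv K (some 0) f) := by
  ext n x
  rw [dxSeries, PowerSeries.coeff_mk, coeff_coeff_optionEquivLeft, coeff_pderiv, coeff_pderiv,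
    coeff_coeff_optionEquivLeft, Finsupp.optionElim_apply_some]
  have h : x.optionElim n + Finsupp.single (some 0) 1 =
      (x + Finsupp.single 0 1).optionElim n := by
    ext (_ | i)
    · simp
    · simp [Finsupp.single_apply]
  rw [h]

/-- Shifts of the times commute with `∂_x`. -/
theorem substSeries_dxSeries (c : K) (f : PowerSeries (Fn K)) :
    substSeries (hasSubst_shiftFamily c) (dxSeries f) =
      dxSeries (substSeries (hasSubst_shiftFamily c) f) := by
  obtain ⟨g, rfl⟩ := (optionEquivLeft ℕ K).surjective f
  rw [dxSeries_optionEquivLeft, substSeries_apply, substSeries_apply, AlgEquiv.symm_apply_apply,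
    AlgEquiv.symm_apply_apply, dxSeries_optionEquivLeft,
    pderiv_subst (hasSubst_optionFamily (hasSubst_shiftFamily c)) (s := some 0)]
  · simp [optionFamily, shiftFamily]
  · rintro (_ | i) hi
    · simp [optionFamily]
    · simp [optionFamily, shiftFamily, pderiv_X_of_ne hi]

end Shift

/-! ### Formal square roots -/

section Sqrt

open PowerSeries

variable {R S : Type*} [CommRing R] [CommRing S] [Algebra ℚ R] [Algebra ℚ S]

/-- Uniqueness of the square root with constant term `1`: the sum of two such roots is a unit. -/
theorem eq_sqrt {f g : PowerSeries R} (hg : constantCoeff g = 1) (h : g ^ 2 = f) : g = sqrt f := by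
  have hf : constantCoeff f = 1 := by rw [← h, map_pow, hg, one_pow]
  have hu : IsUnit (g + sqrt f) := by
    rw [isUnit_iff_constantCoeff, map_add, hg, constantCoeff_sqrt]
    have h2 : ((1 : R) + 1) * algebraMap ℚ R 2⁻¹ = 1 := by
      rw [← map_one (algebraMap ℚ R), ← map_add, ← map_mul]
      norm_num
    exact IsUnit.of_mul_eq_one _ h2
  have h0 : (g - sqrt f) * (g + sqrt f) = 0 := by
    linear_combination h - sqrt_sq f hf
  exact sub_eq_zero.mp ((hu.mul_left_eq_zero).mp h0)

theorem map_sqrt (Φ : PowerSeries R →+* PowerSeries S) {f : PowerSeries R}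
    (hf : constantCoeff f = 1) (hΦ : constantCoeff (Φ (sqrt f)) = 1) :
    Φ (sqrt f) = sqrt (Φ f) :=
  eq_sqrt hΦ (by rw [← map_pow, sqrt_sq f hf])

theorem sqrt_mul {f g : PowerSeries R} (hf : constantCoeff f = 1) (hg : constantCoeff g = 1) :
    sqrt (f * g) = sqrt f * sqrt g :=
  (eq_sqrt (by rw [map_mul, constantCoeff_sqrt, constantCoeff_sqrt, one_mul])
    (by rw [mul_pow, sqrt_sq f hf, sqrt_sq g hg])).symm

theorem sqrt_mul_inverse {f g : PowerSeries R} (hf : constantCoeff f = 1)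
    (hg : constantCoeff g = 1) : sqrt (f * Ring.inverse g) * sqrt g = sqrt f := by
  have hu : IsUnit g := isUnit_iff_constantCoeff.mpr (by rw [hg]; exact isUnit_one)
  have h1 : g * Ring.inverse g = 1 := Ring.mul_inverse_cancel g hu
  have h2 : constantCoeff (f * Ring.inverse g) = 1 := by
    have := congrArg constantCoeff h1
    rw [map_mul, hg, one_mul, map_one] at this
    rw [map_mul, hf, this, one_mul]
  refine eq_sqrt (by rw [map_mul, constantCoeff_sqrt, constantCoeff_sqrt, one_mul]) ?_
  rw [mul_pow, sqrt_sq _ h2, sqrt_sq g hg, mul_assoc, mul_comm _ g, h1, mul_one]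

end Sqrt

theorem constantCoeff_hom {R S : Type*} [CommRing R] [CommRing S]
    {Φ : PowerSeries R →+* PowerSeries S} (hX : Φ PowerSeries.X = PowerSeries.X)
    {f : PowerSeries R} (hf : PowerSeries.constantCoeff f = 1) :
    PowerSeries.constantCoeff (Φ f) = 1 := by
  rw [← PowerSeries.coeff_zero_eq_constantCoeff_apply, coeff_hom_eq_sum hX f one_pos]
  simp [hf]

theorem constantCoeff_evalNegHom {R : Type*} [CommRing R] (f : PowerSeries R) :
    PowerSeries.constantCoeff (PowerSeries.evalNegHom f) = PowerSeries.constantCoeff f := by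
  rw [← PowerSeries.coeff_zero_eq_constantCoeff_apply, PowerSeries.evalNegHom,
    PowerSeries.coeff_rescale, pow_zero, one_mul, PowerSeries.coeff_zero_eq_constantCoeff_apply]

theorem evalNegHom_evalNegHom {R : Type*} [CommRing R] (f : PowerSeries R) :
    PowerSeries.evalNegHom (PowerSeries.evalNegHom f) = f := by
  ext n
  rw [PowerSeries.evalNegHom, PowerSeries.coeff_rescale, PowerSeries.coeff_rescale, ← mul_assoc,
    ← mul_pow, neg_one_mul, neg_neg, one_pow, one_mul]

theorem evalNegHom_C {R : Type*} [CommRing R] (r : R) :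
    PowerSeries.evalNegHom (PowerSeries.C r) = PowerSeries.C r := by
  ext n
  rw [PowerSeries.evalNegHom, PowerSeries.coeff_rescale, PowerSeries.coeff_C]
  split_ifs with h
  · rw [h, pow_zero, one_mul]
  · rw [mul_zero]

theorem map_evalNegHom {R S : Type*} [CommRing R] [CommRing S] (h : R →+* S) (f : PowerSeries R) :
    PowerSeries.map h (PowerSeries.evalNegHom f) = PowerSeries.evalNegHom (PowerSeries.map h f) := by
  ext n
  simp [PowerSeries.evalNegHom, PowerSeries.coeff_rescale]

theorem dxSeries_mul (f g : PowerSeries (Fn K)) :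
    dxSeries (f * g) = dxSeries f * g + f * dxSeries g :=
  dmap_mul (MvPowerSeries.pderiv K 0) f g

theorem dxSeries_evalNegHom (f : PowerSeries (Fn K)) :
    dxSeries (PowerSeries.evalNegHom f) = PowerSeries.evalNegHom (dxSeries f) := by
  ext1 n
  rw [dxSeries, PowerSeries.coeff_mk, PowerSeries.evalNegHom, PowerSeries.coeff_rescale,
    PowerSeries.coeff_rescale, dxSeries, PowerSeries.coeff_mk]
  rcases neg_one_pow_eq_or (Fn K) n with h | h
  · rw [h, one_mul, one_mul]
  · rw [h, neg_one_mul, neg_one_mul]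
    exact dt_neg 0 _

/-! ### Residues of power series in `λ⁻¹` -/

theorem lAtT_coe (F : PowerSeries (Fn K)) :
    lAtT (F : LaurentSeries (Fn K)) = (sAtT F : PowerSeries (Fn2 K)) := by
  ext n : 2
  rw [lAtT, HahnSeries.map_coeff, PowerSeries.coeff_coe, PowerSeries.coeff_coe, sAtT,
    PowerSeries.coeff_map]
  split_ifs
  · rw [map_zero]
  · rfl

theorem negLam_lAtT'_coe (F : PowerSeries (Fn K)) :
    negLam (lAtT' (F : LaurentSeries (Fn K))) = (sAtT'Neg F : PowerSeries (Fn2 K)) := by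
  ext n : 2
  change (Int.negOnePow n : ℤ) • (lAtT' (F : LaurentSeries (Fn K))).coeff n = _
  rw [lAtT', HahnSeries.map_coeff, PowerSeries.coeff_coe, PowerSeries.coeff_coe, sAtT'Neg,
    PowerSeries.evalNegHom, PowerSeries.coeff_rescale, PowerSeries.coeff_map]
  split_ifs with h
  · rw [map_zero, smul_zero]
  · obtain ⟨m, rfl⟩ := Int.eq_ofNat_of_zero_le (not_lt.mp h)
    rw [zsmul_eq_mul]
    congr 1
    rw [Int.natAbs_natCast]
    simp [Int.negOnePow_def]

theorem sAtT'Neg_eq (F : PowerSeries (Fn K)) :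
    sAtT'Neg F = sAtT' (PowerSeries.evalNegHom F) :=
  (map_evalNegHom _ F).symm

theorem sAtT_C (f : Fn K) : sAtT (PowerSeries.C f) = PowerSeries.C (atT f) :=
  PowerSeries.map_C _ _

theorem sAtT'_C (f : Fn K) : sAtT' (PowerSeries.C f) = PowerSeries.C (atT' f) :=
  PowerSeries.map_C _ _

theorem sAtT_X : sAtT (PowerSeries.X : PowerSeries (Fn K)) = PowerSeries.X :=
  PowerSeries.map_X _

theorem sAtT'_X : sAtT' (PowerSeries.X : PowerSeries (Fn K)) = PowerSeries.X :=
  PowerSeries.map_X _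

theorem mul_resExp [CharZero K] (k : ℕ) (f : Fn2 K) (A : PowerSeries (Fn2 K)) :
    f * resExp (lam ^ k * (A : LaurentSeries (Fn2 K))) =
      resExp (lam ^ k * ((PowerSeries.C f * A : PowerSeries (Fn2 K)) : LaurentSeries (Fn2 K))) := by
  refine mul_expCoeff isTimes_timeDiff f (fun n => ?_) (-1)
  rw [PowerSeries.coe_mul, PowerSeries.coe_C, mul_left_comm, HahnSeries.C_mul_eq_smul,
    HahnSeries.coeff_smul, smul_eq_mul]

/-! ### The substitution `t = t' + 2[μ⁻¹]` -/

section Subst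

open MvPowerSeries

/-- The substitutes for `(t, t')` under `t ↦ t' + 2[λ⁻¹]`, `t' ↦ t'`. -/
def diagShift : ℕ ⊕ ℕ → MvPowerSeries (Option ℕ) K :=
  Sum.elim (shiftFamily 2) fun i => X (some i)

theorem hasSubst_diagShift : HasSubst (diagShift (K := K)) := by
  have h1 := hasSubst_shiftFamily (2 : K)
  have h2 : HasSubst (fun i : ℕ => (X (some i) : MvPowerSeries (Option ℕ) K)) :=
    HasSubst.X_comp (Function.Embedding.some : ℕ ↪ Option ℕ)
  constructor
  · rintro (i | i)
    · exact h1.const_coeff i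
    · exact h2.const_coeff i
  · intro d
    refine (((h1.coeff_zero d).image Sum.inl).union ((h2.coeff_zero d).image Sum.inr)).subset ?_
    rintro (i | i) hi
    · exact Or.inl ⟨i, hi, rfl⟩
    · exact Or.inr ⟨i, hi, rfl⟩

theorem subst_diagShift_atT (f : Fn K) :
    subst (diagShift (K := K)) (atT f) = subst (shiftFamily 2) f := by
  rw [atT_eq, subst_rename _ hasSubst_diagShift]
  rfl

theorem subst_diagShift_atT' (f : Fn K) :
    optionEquivLeft ℕ K (subst (diagShift (K := K)) (atT' f)) = PowerSeries.C f := by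
  rw [atT'_eq, subst_rename _ hasSubst_diagShift, ← optionEquivLeft_rename_some,
    rename_some_eq_subst]
  rfl

theorem substSeries_sAtT (F : PowerSeries (Fn K)) :
    substSeries hasSubst_diagShift (sAtT F) = substSeries (hasSubst_shiftFamily 2) F := by
  have h := hom_ext (Φ := (substSeries hasSubst_diagShift).comp sAtT)
    (Ψ := substSeries (hasSubst_shiftFamily (2 : K)))
    (by rw [RingHom.comp_apply, sAtT_X, substSeries_X]) (substSeries_X _)
    (fun f => by
      rw [RingHom.comp_apply, sAtT_C, substSeries_C, substSeries_C, subst_diagShift_atT]) F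
  rwa [RingHom.comp_apply] at h

theorem substSeries_sAtT' (F : PowerSeries (Fn K)) :
    substSeries hasSubst_diagShift (sAtT' F) = F := by
  have h := hom_ext (Φ := (substSeries hasSubst_diagShift).comp sAtT')
    (Ψ := RingHom.id (PowerSeries (Fn K)))
    (by rw [RingHom.comp_apply, sAtT'_X, substSeries_X]) (RingHom.id_apply _)
    (fun f => by
      rw [RingHom.comp_apply, sAtT'_C, substSeries_C, subst_diagShift_atT', RingHom.id_apply]) F
  rwa [RingHom.comp_apply, RingHom.id_apply] at h

variable [CharZero K]

/-- A homomorphism maps `e^{ξ(s,λ)}` to `e^{ξ(G(s),λ)}`, by uniqueness for `∂_λ e^ξ = e^ξ ∂_λ ξ`. -/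
theorem map_expXi {σ τ : Type*} (G : MvPowerSeries σ K →ₐ[K] MvPowerSeries τ K)
    (s : ℕ → MvPowerSeries σ K) (n : ℕ) :
    G (PowerSeries.coeff n (expXi s)) = PowerSeries.coeff n (expXi (fun i => G (s i))) := by
  have hxi : PowerSeries.map (G : _ →+* MvPowerSeries τ K) (xi s) = xi fun i => G (s i) := by
    ext1 n
    rw [PowerSeries.coeff_map, xi, xi, PowerSeries.coeff_mk, PowerSeries.coeff_mk]
    split_ifs
    · rfl
    · exact map_zero G
  have h : PowerSeries.map (G : _ →+* MvPowerSeries τ K) (expXi s) =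
      expXi fun i => G (s i) := by
    have hd : ∀ F : PowerSeries (MvPowerSeries σ K), PowerSeries.derivative _
        (PowerSeries.map (G : _ →+* MvPowerSeries τ K) F) =
        PowerSeries.map (G : _ →+* MvPowerSeries τ K) (PowerSeries.derivative _ F) := by
      intro F
      ext1 n
      simp [PowerSeries.coeff_derivative]
    refine eq_of_derivative_eq_mul ?_ (derivative_expXi _) ?_
    · rw [hd, derivative_expXi, map_mul, ← hd, hxi]
    · rw [constantCoeff_expXi, ← PowerSeries.coeff_zero_eq_constantCoeff_apply,
        PowerSeries.coeff_map, PowerSeries.coeff_zero_eq_constantCoeff_apply, constantCoeff_expXi,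
        map_one]
  rw [← h, PowerSeries.coeff_map]
  rfl

/-- `e^{ξ(2[μ⁻¹],λ)} = (1 + λ/μ) / (1 - λ/μ) = 1 + 2 ∑_{N ≥ 1} (λ/μ)^N`. -/
theorem coeff_expXi_two {y : MvPowerSeries (Option ℕ) K} (N : ℕ) :
    PowerSeries.coeff N (expXi fun i => C ((2 : K) / (2 * i + 1)) * y ^ (2 * i + 1)) =
      2 * y ^ N - if N = 0 then 1 else 0 := by
  set s : ℕ → MvPowerSeries (Option ℕ) K := fun i => C ((2 : K) / (2 * i + 1)) * y ^ (2 * i + 1)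
    with hs
  set F : PowerSeries (MvPowerSeries (Option ℕ) K) :=
    PowerSeries.mk fun N => 2 * y ^ N - if N = 0 then 1 else 0 with hF
  set g := PowerSeries.derivative _ (xi s) with hg
  set u : PowerSeries (MvPowerSeries (Option ℕ) K) := PowerSeries.X * PowerSeries.C y with hu
  -- with `u = λ y`, one has `F = (1 + u) / (1 - u)` and `∂_λ ξ = 2 y / (1 - u²)`, so that `F`
  -- satisfies the differential equation of `e^ξ`
  have hgc : ∀ n, PowerSeries.coeff n g = if Even n then 2 * y ^ (n + 1) else 0 := by
    intro n
    rw [hg, coeff_derivative_xi]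
    refine if_ctx_congr Iff.rfl (fun hn => ?_) fun _ => rfl
    obtain ⟨m, rfl⟩ := even_iff_two_dvd.mp hn
    have hne : (2 * (m : K) + 1) ≠ 0 := by exact_mod_cast Nat.succ_ne_zero (2 * m)
    rw [hs, Nat.mul_div_cancel_left m two_pos, ← Nat.cast_smul_eq_nsmul K, MvPowerSeries.smul_eq_C_mul,
      ← mul_assoc, ← map_mul]
    push_cast
    rw [mul_div_cancel₀ _ hne, map_ofNat]
  have h1 : F * (1 - u) = 1 + u := by
    ext1 n
    rw [mul_sub, mul_one, hu, mul_left_comm, map_sub, map_add]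
    cases n with
    | zero => simp [hF]; ring
    | succ n =>
      rw [PowerSeries.coeff_succ_X_mul, PowerSeries.coeff_mul_C, PowerSeries.coeff_succ_X_mul,
        PowerSeries.coeff_C, hF, PowerSeries.coeff_mk, PowerSeries.coeff_mk, if_neg n.succ_ne_zero,
        PowerSeries.coeff_one, if_neg n.succ_ne_zero]
      split_ifs with hn
      · rw [hn]; ring
      · ring
  have h2 : g * (1 - u ^ 2) = PowerSeries.C (2 * y) := by
    ext1 n
    rw [mul_sub, mul_one, hu, mul_pow, ← map_pow, mul_left_comm, map_sub,
      PowerSeries.coeff_X_pow_mul', PowerSeries.coeff_C, PowerSeries.coeff_mul_C, hgc, hgc]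
    rcases n with _ | _ | n
    · simp
    · simp
    · rw [if_pos (by omega : 2 ≤ n + 1 + 1)]
      by_cases hn : Even n
      · rw [if_pos (by simpa [parity_simps] using hn), if_pos (by simpa using hn), if_neg (by omega)]
        rw [show n + 1 + 1 - 2 = n by omega]
        ring
      · rw [if_neg (by simpa [parity_simps] using hn), if_neg (by simpa using hn), if_neg (by omega),
          zero_mul, sub_zero]
  have hdu : PowerSeries.derivative _ u = PowerSeries.C y := by
    rw [hu, Derivation.leibniz, PowerSeries.derivative_X, PowerSeries.derivative_C]
    simp
  have h3 : PowerSeries.derivative _ F * (1 - u) - F * PowerSeries.C y = PowerSeries.C y := by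
    have := congrArg (PowerSeries.derivative _) h1
    rw [Derivation.leibniz, map_sub, map_add, hdu, Derivation.map_one_eq_zero] at this
    simp only [smul_eq_mul] at this
    linear_combination this
  have hne : (1 - u) ≠ 0 := by
    intro h
    have := congrArg PowerSeries.constantCoeff h
    simp [hu] at this
  have hFd : PowerSeries.derivative _ F = F * g := by
    refine mul_right_cancel₀ (pow_ne_zero 2 hne) ?_
    rw [map_mul, map_ofNat] at h2
    linear_combination (1 - u) * h3 + (PowerSeries.C y) * h1 - (1 - u) * g * h1 - h2
  rw [eq_of_derivative_eq_mul (derivative_expXi s) hFd]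
  · rw [hF, PowerSeries.coeff_mk]
  · rw [constantCoeff_expXi, ← PowerSeries.coeff_zero_eq_constantCoeff_apply, hF,
      PowerSeries.coeff_mk]
    simp; ring

end Subst

/-! ### Tau functions -/

section Tau

theorem isUnit_of_constantCoeff_ne_zero {τ : Fn K} (hτ : MvPowerSeries.constantCoeff τ ≠ 0) :
    IsUnit τ :=
  MvPowerSeries.isUnit_iff_constantCoeff.mpr hτ.isUnit

theorem constantCoeff_phi (τ : Fn K) : PowerSeries.constantCoeff (phi τ) = 1 := by
  simp [phi]

theorem shift_mul (c : K) (f g : Fn K) : shift c (f * g) = shift c f * shift c g := by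
  rw [shift_eq, shift_eq, shift_eq, map_mul, map_mul]

theorem isUnit_shift {τ : Fn K} (hτ : MvPowerSeries.constantCoeff τ ≠ 0) (c : K) :
    IsUnit (shift c τ) := by
  rw [shift_eq]
  exact ((isUnit_of_constantCoeff_ne_zero hτ).map PowerSeries.C).map
    (substSeries (hasSubst_shiftFamily c))

theorem evalNegHom_tauRatio (τ : Fn K) :
    PowerSeries.evalNegHom (tauRatio τ) = shift 2 τ * PowerSeries.C τ⁻¹ := by
  rw [tauRatio, map_mul, evalNegHom_shift, neg_neg, evalNegHom_C]

/-- `τ(t - 2[λ⁻¹]) / τ(t)` turns into `τ(t) / τ(t + 2[λ⁻¹])` under `t ↦ t + 2[λ⁻¹]`. -/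
theorem substSeries_tauRatio_mul {τ : Fn K} (hτ : MvPowerSeries.constantCoeff τ ≠ 0) :
    substSeries (hasSubst_shiftFamily 2) (tauRatio τ) * shift 2 τ = PowerSeries.C τ := by
  rw [tauRatio, map_mul, substSeries_shift (by norm_num), shift_eq, mul_assoc, ← map_mul, ← map_mul,
    MvPowerSeries.inv_mul_cancel _ hτ, map_one, map_one, mul_one]

/-- The weights of the times, with weight `1` for `λ⁻¹`. -/
def optionWt (i : Option ℕ) : ℕ := i.elim 1 wt

open MvPowerSeries in
theorem le_weightedOrder_diagShift (i : ℕ ⊕ ℕ) : ((Sum.elim wt wt : ℕ ⊕ ℕ → ℕ) i : ℕ∞) ≤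
    (diagShift (K := K) i).weightedOrder optionWt := by
  have hX : ((1 : ℕ) : ℕ∞) ≤ (X none : MvPowerSeries (Option ℕ) K).weightedOrder optionWt :=
    le_weightedOrder_X optionWt none
  rcases i with i | i
  · change (wt i : ℕ∞) ≤ (shiftFamily (2 : K) i).weightedOrder optionWt
    rw [shiftFamily]
    refine le_trans (le_min ?_ ?_) (min_weightedOrder_le_add _)
    · exact le_weightedOrder_X optionWt (some i)
    · refine le_trans ?_ (le_weightedOrder_mul optionWt)
      refine le_trans ?_ le_add_self
      refine le_trans ?_ (le_weightedOrder_pow optionWt _)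
      rw [wt, nsmul_eq_mul]
      exact le_trans (by simp) (mul_le_mul_right hX _)
  · exact le_weightedOrder_X optionWt (some i)

/-- `φ(t + 2[λ⁻¹], λ) = φ(t, -λ)`. -/
theorem substSeries_phi {τ : Fn K} (hτ : MvPowerSeries.constantCoeff τ ≠ 0) :
    substSeries (hasSubst_shiftFamily 2) (phi τ) = PowerSeries.evalNegHom (phi τ) := by
  set Δ := substSeries (hasSubst_shiftFamily (2 : K)) with hΔ
  set r := tauRatio τ with hr
  have hC : PowerSeries.C τ * PowerSeries.C τ⁻¹ = 1 := by
    rw [← map_mul, MvPowerSeries.mul_inv_cancel _ hτ, map_one]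
  have hu : IsUnit r := (isUnit_shift hτ _).mul (IsUnit.of_mul_eq_one_right _ hC)
  have h1 : Δ r * PowerSeries.evalNegHom r = 1 := by
    rw [evalNegHom_tauRatio, ← mul_assoc, substSeries_tauRatio_mul hτ, hC]
  have h2 : r * Ring.inverse r = 1 := Ring.mul_inverse_cancel r hu
  have h3 : Δ (Ring.inverse r) = PowerSeries.evalNegHom r := by
    have h := congrArg Δ h2
    rw [map_mul, map_one] at h
    linear_combination PowerSeries.evalNegHom r * h - Δ (Ring.inverse r) * h1
  have h4 : PowerSeries.evalNegHom (Ring.inverse r) = Δ r := by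
    have h := congrArg PowerSeries.evalNegHom h2
    rw [map_mul, map_one] at h
    linear_combination Δ r * h - PowerSeries.evalNegHom (Ring.inverse r) * h1
  have h5 : dxSeries (Δ r) * PowerSeries.evalNegHom r +
      Δ r * PowerSeries.evalNegHom (dxSeries r) = 0 := by
    rw [← dxSeries_evalNegHom, ← dxSeries_mul, h1]
    exact dmap_one (MvPowerSeries.pderiv K 0)
  rw [phi, map_add, map_add, map_mul, map_mul, map_mul, map_mul, map_one, map_one, substSeries_X,
    PowerSeries.evalNegHom_X, h3, h4, substSeries_dxSeries]
  linear_combination PowerSeries.X * h5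

theorem atT_mul_atT'_ne_zero {τ : Fn K} (hτ : MvPowerSeries.constantCoeff τ ≠ 0) (a b : ℕ) :
    atT τ ^ a * atT' τ ^ b ≠ 0 := by
  have h1 := ((isUnit_of_constantCoeff_ne_zero hτ).map atT).pow a
  have h2 := ((isUnit_of_constantCoeff_ne_zero hτ).map atT').pow b
  exact mul_ne_zero h1.ne_zero h2.ne_zero

theorem constantCoeff_sAtT_phi (τ : Fn K) : PowerSeries.constantCoeff (sAtT (phi τ)) = 1 := by
  have h := constantCoeff_hom (sAtT_X (K := K)) (constantCoeff_phi τ)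
  exact h

theorem constantCoeff_sAtT'Neg_phi (τ : Fn K) :
    PowerSeries.constantCoeff (sAtT'Neg (phi τ)) = 1 := by
  rw [sAtT'Neg_eq]
  have h0 : PowerSeries.constantCoeff (PowerSeries.evalNegHom (phi τ)) = 1 := by
    rw [constantCoeff_evalNegHom, constantCoeff_phi]
  have h := constantCoeff_hom (sAtT'_X (K := K)) h0
  exact h

theorem exists_symbol_eq (F : PowerSeries (Fn K)) :
    ∃ Y : PDO K, Y.symbol = (F : LaurentSeries (Fn K)) :=
  ⟨(F : LaurentSeries (Fn K)), rfl⟩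

/-- `Ω(q, ψ)` has order `-1` and leading coefficient `q`. -/
theorem exists_symbol_Omega {W : PDO K} (hW : IsMonic W) (q : Fn K) :
    ∃ y : PowerSeries (Fn K), PowerSeries.constantCoeff y = q ∧ (Omega q W).symbol =
      ((PowerSeries.X * y : PowerSeries (Fn K)) : LaurentSeries (Fn K)) := by
  have hord := (PDO.ordLE_monomial (-1) (1 : Fn K)).mul (PDO.ordLE_monomial 0 q)
  have hlead := PDO.coeff_mul_of_ordLE hord hW.ordLE
  rw [PDO.coeff_mul_of_ordLE (PDO.ordLE_monomial (-1) (1 : Fn K)) (PDO.ordLE_monomial 0 q),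
    PDO.coeff_monomial, PDO.coeff_monomial, if_pos rfl, if_pos rfl, hW.1, one_mul, mul_one] at hlead
  refine ⟨PowerSeries.mk fun n => (Omega q W).coeff (-(n + 1)), ?_, ?_⟩
  · rw [← PowerSeries.coeff_zero_eq_constantCoeff_apply, PowerSeries.coeff_mk]
    exact hlead
  · ext n : 2
    rw [symbol_coeff, PowerSeries.coeff_coe]
    split_ifs with hn
    · exact (hord.mul hW.ordLE) _ (by omega)
    · obtain ⟨m, rfl⟩ := Int.eq_ofNat_of_zero_le (not_lt.mp hn)
      rw [Int.natAbs_natCast]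
      cases m with
      | zero =>
        rw [PowerSeries.coeff_zero_X_mul]
        exact (hord.mul hW.ordLE) _ (by simp)
      | succ m =>
        rw [PowerSeries.coeff_succ_X_mul, PowerSeries.coeff_mk]
        push_cast
        rfl

variable [CharZero K]

open MvPowerSeries in
theorem subst_diagShift_expXi (N : ℕ) :
    subst (diagShift (K := K)) (PowerSeries.coeff N (expXi (timeDiff (K := K)))) =
      (2 * X none ^ N - if N = 0 then 1 else 0 : MvPowerSeries (Option ℕ) K) := by
  have he : (fun i => substAlgHom (R := K) (hasSubst_diagShift (K := K)) (timeDiff i)) =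
      fun i : ℕ => C ((2 : K) / (2 * i + 1)) * (X none : MvPowerSeries (Option ℕ) K) ^ (2 * i + 1) := by
    ext1 i
    have hl : diagShift (K := K) (Sum.inl i) = shiftFamily 2 i := rfl
    have hr : diagShift (K := K) (Sum.inr i) = X (some i) := rfl
    rw [timeDiff, map_sub, substAlgHom_X, substAlgHom_X, hl, hr, shiftFamily, add_sub_cancel_left]
  rw [← substAlgHom_apply (R := K) hasSubst_diagShift, map_expXi, he, coeff_expXi_two]

open MvPowerSeries in
/-- The residue after the substitution `t = t' + 2[μ⁻¹]`, where `e^{ξ(t-t',λ)}` becomes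
`1 + 2 ∑_{N ≥ 1} (λ/μ)^N`, so that the residue evaluates the series at `λ = μ`. -/
theorem subst_resExp (b : PowerSeries (Fn2 K)) :
    optionEquivLeft ℕ K (subst diagShift (resExp
      ((PowerSeries.X * b : PowerSeries (Fn2 K)) : LaurentSeries (Fn2 K)))) =
    2 * substSeries hasSubst_diagShift b -
      substSeries hasSubst_diagShift (PowerSeries.C (PowerSeries.coeff 0 b)) := by
  ext n x
  obtain ⟨M, hM⟩ : ∃ M, Finsupp.weight optionWt (x.optionElim n) + n < M :=
    ⟨_, Nat.lt_succ_self _⟩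
  have hMp : 0 < M := by omega
  have hn : n < M := by omega
  have hco : ∀ N : ℕ, HahnSeries.coeff ((PowerSeries.X * b : PowerSeries (Fn2 K)) :
      LaurentSeries (Fn2 K)) ((N : ℤ) - -1) = PowerSeries.coeff N b := by
    intro N
    rw [PowerSeries.coeff_coe, if_neg (by omega), show ((N : ℤ) - -1).natAbs = N + 1 by omega,
      PowerSeries.coeff_succ_X_mul]
  have hterm : ∀ N, optionEquivLeft ℕ K (subst diagShift (PowerSeries.coeff N b) *
      (2 * X none ^ N - if N = 0 then 1 else 0)) =
      2 * (substSeries hasSubst_diagShift (PowerSeries.C (PowerSeries.coeff N b)) *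
        PowerSeries.X ^ N) - if N = 0 then
          substSeries hasSubst_diagShift (PowerSeries.C (PowerSeries.coeff 0 b)) else 0 := by
    intro N
    rw [map_mul, map_sub, map_mul, map_pow, optionEquivLeft_X_none, map_ofNat,
      ← substSeries_C hasSubst_diagShift]
    split_ifs with h
    · rw [h, map_one]
      ring
    · rw [map_zero]
      ring
  have hsum : optionEquivLeft ℕ K (∑ N ∈ Finset.range M,
      subst diagShift (PowerSeries.coeff N b) * (2 * X none ^ N - if N = 0 then 1 else 0)) =
      2 * (∑ N ∈ Finset.range M, substSeries hasSubst_diagShift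
        (PowerSeries.C (PowerSeries.coeff N b)) * PowerSeries.X ^ N) -
        substSeries hasSubst_diagShift (PowerSeries.C (PowerSeries.coeff 0 b)) := by
    rw [map_sum, Finset.sum_congr rfl fun N _ => hterm N, Finset.sum_sub_distrib, ← Finset.mul_sum,
      Finset.sum_ite_eq', if_pos (Finset.mem_range.mpr hMp)]
  have hL := coeff_subst_expCoeff isTimes_timeDiff hasSubst_diagShift le_weightedOrder_diagShift
    ((PowerSeries.X * b : PowerSeries (Fn2 K)) : LaurentSeries (Fn2 K)) (-1) (M := M)
    (d := x.optionElim n) (by omega)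
  simp only [hco, subst_diagShift_expXi] at hL
  have hR := coeff_hom_eq_sum (substSeries_X (hasSubst_diagShift (K := K))) b hn
  rw [coeff_coeff_optionEquivLeft, resExp, hL, ← coeff_coeff_optionEquivLeft, hsum, two_mul, map_sub,
    map_add, ← hR, ← map_add, ← two_mul, ← map_sub]

/-- The power series `√φ(t,λ) τ(t - 2[λ⁻¹]) / τ(t)`. -/
def tauSymbol (τ : Fn K) : PowerSeries (Fn K) := sqrt (phi τ) * tauRatio τ

theorem substSeries_tauSymbol_mul {τ : Fn K} (hτ : MvPowerSeries.constantCoeff τ ≠ 0) :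
    substSeries (hasSubst_shiftFamily 2) (tauSymbol τ) * shift 2 τ =
      sqrt (PowerSeries.evalNegHom (phi τ)) * PowerSeries.C τ := by
  have h1 := constantCoeff_hom (substSeries_X (hasSubst_shiftFamily (2 : K)))
    (constantCoeff_sqrt (phi τ))
  have h2 := map_sqrt _ (constantCoeff_phi τ) h1
  rw [tauSymbol, map_mul, mul_assoc, substSeries_tauRatio_mul hτ, h2, substSeries_phi hτ]

theorem sAtT_tauSymbol_mul {τ : Fn K} (hτ : MvPowerSeries.constantCoeff τ ≠ 0) :
    PowerSeries.C (atT τ) * sAtT (tauSymbol τ) = sAtT (sqrt (phi τ)) * sAtT (shift (-2) τ) := by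
  rw [← sAtT_C, ← map_mul, ← map_mul, tauSymbol, tauRatio]
  congr 1
  have hC : PowerSeries.C τ * PowerSeries.C τ⁻¹ = 1 := by
    rw [← map_mul, MvPowerSeries.mul_inv_cancel _ hτ, map_one]
  linear_combination sqrt (phi τ) * shift (-2) τ * hC

theorem sAtT'Neg_tauSymbol_mul {τ : Fn K} (hτ : MvPowerSeries.constantCoeff τ ≠ 0) :
    PowerSeries.C (atT' τ) * sAtT'Neg (tauSymbol τ) =
      sAtT' (sqrt (PowerSeries.evalNegHom (phi τ))) * sAtT' (shift 2 τ) := by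
  have hC : PowerSeries.C τ * PowerSeries.C τ⁻¹ = 1 := by
    rw [← map_mul, MvPowerSeries.mul_inv_cancel _ hτ, map_one]
  have h1 : PowerSeries.constantCoeff (PowerSeries.evalNegHom (sqrt (phi τ))) = 1 := by
    rw [constantCoeff_evalNegHom, constantCoeff_sqrt]
  have h2 := map_sqrt _ (constantCoeff_phi τ) h1
  have h3 : PowerSeries.evalNegHom (sqrt (phi τ) * tauRatio τ) =
      PowerSeries.evalNegHom (sqrt (phi τ)) * PowerSeries.evalNegHom (tauRatio τ) := map_mul _ _ _
  rw [sAtT'Neg_eq, ← sAtT'_C, ← map_mul, ← map_mul, tauSymbol, h3, evalNegHom_tauRatio, h2]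
  congr 1
  linear_combination sqrt (PowerSeries.evalNegHom (phi τ)) * shift 2 τ * hC

theorem sAtT_sqrt_phi (τ : Fn K) : sAtT (sqrt (phi τ)) = sqrt (sAtT (phi τ)) := by
  have h1 := constantCoeff_hom (sAtT_X (K := K)) (constantCoeff_sqrt (phi τ))
  have h2 := map_sqrt _ (constantCoeff_phi τ) h1
  exact h2

theorem sAtT'_sqrt_evalNegHom_phi (τ : Fn K) :
    sAtT' (sqrt (PowerSeries.evalNegHom (phi τ))) = sqrt (sAtT'Neg (phi τ)) := by
  rw [sAtT'Neg_eq]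
  have h0 : PowerSeries.constantCoeff (PowerSeries.evalNegHom (phi τ)) = 1 := by
    rw [constantCoeff_evalNegHom, constantCoeff_phi]
  have h1 := constantCoeff_hom (sAtT'_X (K := K)) (constantCoeff_sqrt (PowerSeries.evalNegHom (phi τ)))
  have h2 := map_sqrt _ h0 h1
  exact h2

theorem bilinear1_iff_tauBilinear1 {W : PDO K} {τ : Fn K} (h : IsTau W τ) (k : ℕ) {m : ℕ}
    (q : Fin 2 → Fin m → Fn K) : Bilinear1 k W q ↔ TauBilinear1 k τ fun a j => τ * q a j := by
  obtain ⟨hτ, hW⟩ := h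
  have hne := atT_mul_atT'_ne_zero hτ 1 1
  rw [pow_one, pow_one] at hne
  rw [Bilinear1, TauBilinear1, ← mul_right_inj' hne, hW]
  have hA : PowerSeries.C (atT τ * atT' τ) * (sAtT (tauSymbol τ) * sAtT'Neg (tauSymbol τ)) =
      sqrt (sAtT (phi τ) * sAtT'Neg (phi τ)) * sAtT (shift (-2) τ) * sAtT' (shift 2 τ) := by
    rw [sqrt_mul (constantCoeff_sAtT_phi τ) (constantCoeff_sAtT'Neg_phi τ), ← sAtT_sqrt_phi,
      ← sAtT'_sqrt_evalNegHom_phi, map_mul, mul_mul_mul_comm, sAtT_tauSymbol_mul hτ,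
      sAtT'Neg_tauSymbol_mul hτ]
    ring
  change atT τ * atT' τ * resExp (lam ^ k * lAtT (tauSymbol τ : LaurentSeries (Fn K)) *
    negLam (lAtT' (tauSymbol τ : LaurentSeries (Fn K)))) = _ ↔ _
  rw [lAtT_coe, negLam_lAtT'_coe, mul_assoc (lam ^ k), ← PowerSeries.coe_mul, mul_resExp, hA,
    Finset.mul_sum]
  refine Eq.congr_right (Finset.sum_congr rfl fun i _ => ?_)
  simp only [map_mul]
  ring

/-- Let `w(t,λ) = √φ(t,λ) τ(t - 2[λ⁻¹]) / τ(t)` and `z = (q(t) + q(t + 2[λ⁻¹])) / (2 w(t +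
2[λ⁻¹], λ))`. Then the second identity in terms of `τ` is `Res_λ λ⁻¹ w(t,λ) z(t',λ) e^{ξ(t-t',λ)}
= q(t)`, multiplied by `2 τ(t) τ(t')²`. -/
theorem tauBilinear2_iff {τ : Fn K} (hτ : MvPowerSeries.constantCoeff τ ≠ 0) (q : Fn K)
    {z : PowerSeries (Fn K)} (hz : 2 * substSeries (hasSubst_shiftFamily 2) (tauSymbol τ) * z =
      PowerSeries.C q + shift 2 q) :
    TauBilinear2 τ (τ * q) ↔ resExp ((PowerSeries.X * (sAtT (tauSymbol τ) * sAtT' z) :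
      PowerSeries (Fn2 K)) : LaurentSeries (Fn2 K)) = atT q := by
  have h2 : (2 : Fn2 K) ≠ 0 := fun h => by
    have := congrArg MvPowerSeries.constantCoeff h
    rw [map_ofNat, map_zero] at this
    exact two_ne_zero this
  have hne : (2 : Fn2 K) * (atT τ ^ 1 * atT' τ ^ 2) ≠ 0 :=
    mul_ne_zero h2 (atT_mul_atT'_ne_zero hτ 1 2)
  have hz2 : shift 2 τ * (PowerSeries.C q + shift 2 q) =
      sqrt (PowerSeries.evalNegHom (phi τ)) * PowerSeries.C τ * (2 * z) := by
    rw [← substSeries_tauSymbol_mul hτ, ← hz]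
    ring
  have hA : PowerSeries.C (2 * (atT τ ^ 1 * atT' τ ^ 2)) *
      (PowerSeries.X * (sAtT (tauSymbol τ) * sAtT' z)) =
      PowerSeries.X * sqrt (sAtT (phi τ) * Ring.inverse (sAtT'Neg (phi τ)))
      * sAtT (shift (-2) τ) * (PowerSeries.C (atT' τ) * sAtT' (shift 2 (τ * q)) +
        PowerSeries.C (atT' (τ * q)) * sAtT' (shift 2 τ)) := by
    have h1 := congrArg sAtT' hz2
    have h2 := sqrt_mul_inverse (constantCoeff_sAtT_phi τ) (constantCoeff_sAtT'Neg_phi τ)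
    have h3 := sAtT_tauSymbol_mul hτ
    rw [← sAtT'_sqrt_evalNegHom_phi, ← sAtT_sqrt_phi] at h2
    simp only [map_mul, map_add, sAtT'_C, map_ofNat] at h1
    simp only [map_mul, map_pow, map_ofNat, shift_mul]
    generalize sqrt (sAtT (phi τ) * Ring.inverse (sAtT'Neg (phi τ))) = s at *
    linear_combination 2 * PowerSeries.C (atT' τ) ^ 2 * PowerSeries.X * sAtT' z * h3
      - 2 * PowerSeries.C (atT' τ) ^ 2 * PowerSeries.X * sAtT' z * sAtT (shift (-2) τ) * h2
      - PowerSeries.X * s * sAtT (shift (-2) τ) * PowerSeries.C (atT' τ) * h1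
  have hm := mul_resExp 0 (2 * (atT τ ^ 1 * atT' τ ^ 2))
    (PowerSeries.X * (sAtT (tauSymbol τ) * sAtT' z))
  rw [pow_zero, one_mul, one_mul, hA] at hm
  rw [TauBilinear2, ← hm, ← mul_right_inj' hne (c := atT q)]
  refine Eq.congr_right ?_
  rw [map_mul]
  ring

theorem isUnit_two_mul_substSeries_tauSymbol {τ : Fn K}
    (hτ : MvPowerSeries.constantCoeff τ ≠ 0) :
    IsUnit (2 * substSeries (hasSubst_shiftFamily 2) (tauSymbol τ)) := by
  have h1 : IsUnit (sqrt (PowerSeries.evalNegHom (phi τ)) * PowerSeries.C τ) := by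
    refine IsUnit.mul ?_ ((isUnit_of_constantCoeff_ne_zero hτ).map PowerSeries.C)
    rw [PowerSeries.isUnit_iff_constantCoeff, constantCoeff_sqrt]
    exact isUnit_one
  rw [← substSeries_tauSymbol_mul hτ] at h1
  have h2 : IsUnit (2 : Fn K) := by
    rw [MvPowerSeries.isUnit_iff_constantCoeff, map_ofNat]
    exact isUnit_iff_ne_zero.mpr two_ne_zero
  have h3 := h2.map (PowerSeries.C (R := Fn K))
  rw [map_ofNat] at h3
  exact h3.mul (isUnit_of_mul_isUnit_left h1)

theorem pair_eq_resExp {P Q : PDO K} {F G : PowerSeries (Fn K)}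
    (hP : P.symbol = (F : LaurentSeries (Fn K))) (hQ : Q.symbol = (G : LaurentSeries (Fn K))) :
    pair P Q = resExp ((sAtT F * sAtT'Neg G : PowerSeries (Fn2 K)) : LaurentSeries (Fn2 K)) := by
  rw [pair, hP, hQ, lAtT_coe, negLam_lAtT'_coe, PowerSeries.coe_mul]

/-- The second identity in terms of `τ` has the form `Res_λ ψ(t,λ) Y(t',λ) = q(t)`, which makes
`q` an eigenfunction, whatever `Y` is. -/
theorem IsCKPWave.bilinear2_of_tauBilinear2 {L W : PDO K} {τ : Fn K} (hW : IsCKPWave L W)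
    (h : IsTau W τ) {q : Fn K} (hq : TauBilinear2 τ (τ * q)) : Bilinear2 W q := by
  obtain ⟨hτ, hWτ⟩ := h
  obtain ⟨z, hz⟩ : ∃ z, 2 * substSeries (hasSubst_shiftFamily 2) (tauSymbol τ) * z =
      PowerSeries.C q + shift 2 q := by
    refine ⟨Ring.inverse (2 * substSeries (hasSubst_shiftFamily 2) (tauSymbol τ)) *
      (PowerSeries.C q + shift 2 q), ?_⟩
    rw [← mul_assoc, Ring.mul_inverse_cancel _ (isUnit_two_mul_substSeries_tauSymbol hτ), one_mul]
  obtain ⟨Y, hY⟩ := exists_symbol_eq (PowerSeries.evalNegHom (PowerSeries.X * z))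
  have h1 : pair W Y = atT q := by
    rw [pair_eq_resExp (F := tauSymbol τ) hWτ hY, sAtT'Neg_eq, evalNegHom_evalNegHom,
      map_mul sAtT', sAtT'_X, mul_left_comm]
    exact (tauBilinear2_iff hτ q hz).mp hq
  exact (hW.bilinear2_iff_isEigenfunction q).mpr (hW.isEigenfunction_of_pair_eq h1)

/-- Substituting `t = t' + 2[μ⁻¹]` in the second identity computes
`Ω(q(t'), ψ(t',-μ))` as `-(q(t') + q(t' + 2[μ⁻¹])) / (2 μ ψ(t' + 2[μ⁻¹], μ))`, up to exponentials. -/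
theorem IsMonic.tauBilinear2_of_bilinear2 {W : PDO K} {τ : Fn K} (hW : IsMonic W)
    (h : IsTau W τ) {q : Fn K} (hq : Bilinear2 W q) : TauBilinear2 τ (τ * q) := by
  obtain ⟨hτ, hWτ⟩ := h
  obtain ⟨y, hy0, hy⟩ := exists_symbol_Omega hW q
  set z := PowerSeries.evalNegHom y with hz
  have hz0 : PowerSeries.constantCoeff z = q := by
    rw [hz, constantCoeff_evalNegHom, hy0]
  have hw0 : PowerSeries.constantCoeff (tauSymbol τ) = 1 := by
    have h1 := hW.1
    rw [← neg_zero, ← symbol_coeff, hWτ, PowerSeries.coeff_coe] at h1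
    rw [← PowerSeries.coeff_zero_eq_constantCoeff_apply]
    exact h1
  have hres : resExp ((PowerSeries.X * (sAtT (tauSymbol τ) * sAtT' z) :
      PowerSeries (Fn2 K)) : LaurentSeries (Fn2 K)) = atT q := by
    have h1 := (bilinear2_iff W q).mp hq
    have h4 : PowerSeries.C (-1 : Fn2 K) * (sAtT (tauSymbol τ) * sAtT'Neg (PowerSeries.X * y)) =
        PowerSeries.X * (sAtT (tauSymbol τ) * sAtT' z) := by
      rw [sAtT'Neg_eq, map_mul, PowerSeries.evalNegHom_X, ← hz, map_mul, map_neg, map_neg, map_one,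
        sAtT'_X]
      ring
    have h2 := mul_resExp 0 (-1) (sAtT (tauSymbol τ) * sAtT'Neg (PowerSeries.X * y))
    rw [pow_zero, one_mul, one_mul, ← pair_eq_resExp (F := tauSymbol τ) hWτ hy, h1, h4, map_neg,
      neg_mul_neg, one_mul] at h2
    exact h2.symm
  refine (tauBilinear2_iff hτ q ?_).mpr hres
  have h3 := subst_resExp (sAtT (tauSymbol τ) * sAtT' z)
  have h5 : PowerSeries.coeff 0 (sAtT (tauSymbol τ) * sAtT' z) = atT' q := by
    have h6 : PowerSeries.constantCoeff (sAtT (tauSymbol τ)) = 1 := by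
      have h := constantCoeff_hom (sAtT_X (K := K)) hw0
      exact h
    have h7 : PowerSeries.constantCoeff (sAtT' z) = atT' q := by
      rw [← hz0, sAtT', ← PowerSeries.coeff_zero_eq_constantCoeff_apply, PowerSeries.coeff_map,
        PowerSeries.coeff_zero_eq_constantCoeff_apply]
    rw [PowerSeries.coeff_zero_eq_constantCoeff_apply, map_mul, h6, h7, one_mul]
  rw [hres, subst_diagShift_atT, h5, map_mul, substSeries_sAtT, substSeries_sAtT', substSeries_C,
    subst_diagShift_atT'] at h3
  rw [shift, h3]
  ring

end Tau

end CKP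

end

theorem theorem1 {K : Type*} [Field K] [CharZero K] (k m : ℕ) (hk : 0 < k) (hm : 0 < m) :
    -- the Lax system for `(L, q)` is equivalent to the two bilinear identities for some
    -- CKP wave function of `L`
    (∀ (L : CKP.PDO K) (q : Fin 2 → Fin m → CKP.Fn K),
      CKP.IsConstrainedCKP k L q ↔
        ∃ W : CKP.PDO K, CKP.IsCKPWave L W ∧
          CKP.Bilinear1 k W q ∧ ∀ a j, CKP.Bilinear2 W (q a j)) ∧
    -- for fixed `L = W ∂ W⁻¹`: the bilinear identities give back the whole system, including
    -- the CKP hierarchy itself when the `q` do not all vanish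
    (∀ (L W : CKP.PDO K) (q : Fin 2 → Fin m → CKP.Fn K),
      CKP.IsMonic W → CKP.IsDressing L W →
      ((∃ a j, q a j ≠ 0) ∨ CKP.IsCKPWave L W) →
        ((CKP.IsCKPWave L W ∧ CKP.IsConstrainedCKP k L q) ↔
          (CKP.Bilinear1 k W q ∧ ∀ a j, CKP.Bilinear2 W (q a j)))) ∧
    -- the potential in the second identity obeys its defining flow equations
    (∀ (L W : CKP.PDO K) (q : Fin 2 → Fin m → CKP.Fn K),
      CKP.IsCKPWave L W → CKP.IsConstrainedCKP k L q →
        ∀ a j, CKP.IsSquaredEigenfunctionPotential L W (q a j)) ∧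
    -- the form of the two identities in terms of `τ` and `ρ = τ q`
    (∀ (L W : CKP.PDO K) (τ : CKP.Fn K) (q : Fin 2 → Fin m → CKP.Fn K),
      CKP.IsCKPWave L W → CKP.IsTau W τ →
        (CKP.Bilinear1 k W q ↔ CKP.TauBilinear1 k τ (fun a j => τ * q a j)) ∧
        ∀ a j, (CKP.Bilinear2 W (q a j) ↔ CKP.TauBilinear2 τ (τ * q a j))) := by
  refine ⟨fun L q => ⟨fun h => ?_, fun ⟨W, hW, h⟩ => hW.isConstrainedCKP_iff.mpr h⟩,
    fun L W q hmon hd hq => ⟨fun ⟨hW, h⟩ => hW.isConstrainedCKP_iff.mp h, fun h => ?_⟩,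
    fun L W q hW h a j => hW.isSquaredEigenfunctionPotential (h.eigen a j),
    fun L W τ q hW hτ => ⟨CKP.bilinear1_iff_tauBilinear1 hτ k q, fun a j =>
      ⟨hW.monic.tauBilinear2_of_bilinear2 hτ, hW.bilinear2_of_tauBilinear2 hτ⟩⟩⟩
  · obtain ⟨W, hW⟩ := h.isCKPLax.exists_isCKPWave
    exact ⟨W, hW, hW.isConstrainedCKP_iff.mp h⟩
  · have hW : CKP.IsCKPWave L W := by
      rcases hq with ⟨a, j, hne⟩ | hW
      · exact CKP.isCKPWave_of_bilinear2 hmon hd hne (h.2 a j)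
      · exact hW
    exact ⟨hW, hW.isConstrainedCKP_iff.mpr h⟩
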